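/- Let $k$ be a field (for example $k=\mathbb C$, or $k=\mathbb C(q^{1/2},q'^{1/2},\ell^{1/2})$ if the parameters are regarded as indeterminates), and let $q,q',\ell\in k^\times$ come with chosen square roots $q^{1/2},q'^{1/2},\ell^{1/2}\in k^\times$. Assume that neither $q$ nor $q'$ is a root of unity. Let $U=\mathcal U_{q,q'}(\mathrm{sl}_2^{(s)}\stackrel{\ell}{\oplus}\mathrm{sl}_2^{(s)})$ be the associative $k$-algebra generated by $e_\pm, q^{\pm\mathbf h},\ell^{\pm\mathbf h}$ (chiral sector) and $e'_\pm,q'^{\pm\mathbf h'},\ell^{\pm\mathbf h'}$ (antichiral sector), with the following relations: in the chiral sector $$q^{\mathbf h}q^{-\mathbf h}=q^{-\mathbf h}q^{\mathbf h}=\ell^{\mathbf h}\ell^{-\mathbf h}=\ell^{-\mathbf h}\ell^{\mathbf h}=1,\quad q^{\mathbf h}\ell^{\mathbf h}=\ell^{\mathbf h}q^{\mathbf h},\quad q^{\mathbf h}e_\pm=q^{\pm1}e_\pm q^{\mathbf h},\quad \ell^{\mathbf h}e_\pm=\ell^{\pm1}e_\pm\ell^{\mathbf h},$$ $$[e_+,e_-]=\frac{q^{2\mathbf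 h}-q^{-2\mathbf h}}{q-q^{-1}},\qquad (q^{\mathbf h})^m(\ell^{\mathbf h})^n=(q^{\mathbf h})^{m'}(\ell^{\mathbf h})^{n'}\ \text{ whenever }\ q^{m/2}\ell^{n/2}=q^{m'/2}\ell^{n'/2}\quad(m,n,m',n'\ge 0)$$ (the last rule imposes nothing when $q^{1/2}$ and $\ell^{1/2}$ are multiplicatively independent); the same relations with primes in the antichiral sector ($q,\mathbf h,e_\pm$ replaced by $q',\mathbf h',e'_\pm$, and $\ell$ unchanged); and every chiral generator commutes with every antichiral one. Its Hopf algebra structure is $$\Delta(e_\pm)=e_\pm\otimes q^{\mathbf h}\ell^{\pm\mathbf h'}+q^{-\mathbf h}\ell^{\mp\mathbf h'}\otimes e_\pm,\qquad \Delta(e'_\pm)=e'_\pm\otimes q'^{\mathbf h'}\ell^{\mp\mathbf h}+q'^{-\mathbf h'}\ell^{\pm\mathbf h}\otimes e'_\pm,$$ with $q^{\pm\mathbf h},q'^{\pm\mathbf h'},\ell^{\pm\mathbf h},\ell^{\pm\mathbf h'}$ group-like, $\epsilon(e_\pm)=\epsilon(e'_\pm)=0$, $S(e_\pm)=-q^{\pm1}e_\pm$,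 $S(e'_\pm)=-q'^{\pm1}e'_\pm$, and $S(g)=g^{-1}$ for the group-like generators. Let $F=\mathrm{SL}_q(2)\stackrel{\ell}{\oplus}\mathrm{SL}_{1/q'}(2)$ be the associative $k$-algebra generated by $a,b,c,d,a',b',c',d'$ with the Manin relations and determinant one in each sector, $$ab=q^{-1}ba,\ ac=q^{-1}ca,\ bd=q^{-1}db,\ cd=q^{-1}dc,\ ad-da=(q^{-1}-q)bc,\ bc=cb,\ ad-q^{-1}bc=1,$$ the same with primes and $q$ replaced by $1/q'$, and the link relations $$b'a=\ell ab',\ ac'=\ell c'a,\ a'b=\ell ba',\ bd'=\ell d'b,\ ca'=\ell a'c,\ d'c=\ell cd',\ db'=\ell b'd,\ c'd=\ell dc',$$ $$aa'=a'a,\ ad'=d'a,\ bb'=b'b,\ bc'=c'b,\ cb'=b'c,\ cc'=c'c,\ da'=a'd,\ dd'=d'd.$$ Its Hopf algebra structure is given by $\Delta(x_{ij})=\sum_k x_{ik}\otimes x_{kj}$ and $\epsilon(x_{ij})=\delta_{ij}$ for each of the matrices $\begin{pmatrix}a&b\\c&d\end{pmatrix}$, $\begin{pmatrix}a'&b'\\c'&d'\end{pmatrix}$,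 and $$S\begin{pmatrix}a&b\\c&d\end{pmatrix}=\begin{pmatrix}d&-qb\\-q^{-1}c&a\end{pmatrix},\qquad S\begin{pmatrix}a'&b'\\c'&d'\end{pmatrix}=\begin{pmatrix}d'&-q'^{-1}b'\\-q'c'&a'\end{pmatrix}.$$ Then there is exactly one bilinear pairing $\langle\cdot,\cdot\rangle:U\times F\to k$ that is a dual pairing of Hopf algebras, i.e. for all $x,y\in U$ and $f,g\in F$ $$\langle xy,f\rangle=\sum\langle x,f_{(1)}\rangle\langle y,f_{(2)}\rangle,\quad \langle x,fg\rangle=\sum\langle x_{(1)},f\rangle\langle x_{(2)},g\rangle,\quad \langle 1,f\rangle=\epsilon(f),\quad \langle x,1\rangle=\epsilon(x),\quad \langle S(x),f\rangle=\langle x,S(f)\rangle,$$ and that has the following values on generators: $$\langle q^{\mathbf h},a\rangle=q^{1/2},\ \langle q^{\mathbf h},d\rangle=q^{-1/2},\ \langle e_+,b\rangle=\langle e_-,c\rangle=1,\qquad \langle q'^{\mathbf h'},a'\rangle=q'^{-1/2},\ \langle q'^{\mathbf h'},d'\rangle=q'^{1/2},\ \langle e'_+,c'\rangle=\langle e'_-,b'\rangle=1,$$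 $$\langle \ell^{\mathbf h},a\rangle=\ell^{1/2},\ \langle \ell^{\mathbf h},d\rangle=\ell^{-1/2},\qquad \langle \ell^{\mathbf h'},a'\rangle=\ell^{-1/2},\ \langle \ell^{\mathbf h'},d'\rangle=\ell^{1/2},$$ $$\langle q^{\mathbf h},a'\rangle=\langle q^{\mathbf h},d'\rangle=\langle q'^{\mathbf h'},a\rangle=\langle q'^{\mathbf h'},d\rangle=\langle \ell^{\mathbf h},a'\rangle=\langle \ell^{\mathbf h},d'\rangle=\langle \ell^{\mathbf h'},a\rangle=\langle \ell^{\mathbf h'},d\rangle=1,$$ all other pairings of $e_\pm,q^{\mathbf h},\ell^{\mathbf h},e'_\pm,q'^{\mathbf h'},\ell^{\mathbf h'}$ with $a,b,c,d,a',b',c',d'$ being $0$. This pairing is perfect: $\langle x,F\rangle=0$ implies $x=0$, and $\langle U,f\rangle=0$ implies $f=0$. -/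

import Mathlib

open scoped TensorProduct

noncomputable section

set_option linter.unusedSimpArgs false
set_option linter.unusedVariables false

namespace QLinked

/-- The two copies of `sl₂`: the unprimed (chiral) and the primed (antichiral) one. -/
inductive Sector
  | chiral
  | anti

/-- The names of the generators in one sector of the enveloping algebra:
`K = q^h`, `Kinv = q^{-h}`, `L = ℓ^h`, `Linv = ℓ^{-h}`, `E = e₊`, `F = e₋`. -/
inductive UGen
  | K
  | Kinv
  | L
  | Linv
  | E
  | F

/-- The names of the entries of the matrix of generators in one sector of the function algebra. -/
inductive OGen
  | a
  | b
  | c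
  | d

/-! ### Two auxiliary facts on algebras -/

section Aux

variable {k A : Type*} [Field k] [Ring A]

/-- The linear map underlying an anti-homomorphism. -/
def ofAnti [Algebra k A] (S : A →ₐ[k] Aᵐᵒᵖ) : A →ₗ[k] A :=
  (MulOpposite.opLinearEquiv k).symm.toLinearMap ∘ₗ S.toLinearMap

lemma ofAnti_apply [Algebra k A] (S : A →ₐ[k] Aᵐᵒᵖ) (x : A) : ofAnti S x = (S x).unop := rfl

lemma ofAnti_mul [Algebra k A] (S : A →ₐ[k] Aᵐᵒᵖ) (x y : A) :
    ofAnti S (x * y) = ofAnti S y * ofAnti S x := by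
  simp [ofAnti_apply]

lemma ofAnti_one [Algebra k A] (S : A →ₐ[k] Aᵐᵒᵖ) :
    ofAnti S (1 : A) = 1 := by
  simp [ofAnti_apply]

lemma ofAnti_algebraMap [Algebra k A] (S : A →ₐ[k] Aᵐᵒᵖ) (c : k) :
    ofAnti S (algebraMap k A c) = algebraMap k A c := by
  simp [ofAnti_apply, MulOpposite.algebraMap_apply]

lemma assoc_of_eq {x y w : A} (h : x * y = w) (z : A) :
    x * (y * z) = w * z := by
  rw [← mul_assoc, h]

lemma skew_comm [Algebra k A] {t e g g' : A} {c : k} (h1 : t * e = c • (e * t))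
    (h2 : t * g = g * t) (h3 : t * g' = g' * t) :
    t ⊗ₜ[k] t * (e ⊗ₜ g + g' ⊗ₜ e) = c • ((e ⊗ₜ g + g' ⊗ₜ e) * t ⊗ₜ t) := by
  simp only [mul_add, add_mul, Algebra.TensorProduct.tmul_mul_tmul, h1, h2, h3, smul_add,
    TensorProduct.tmul_smul, TensorProduct.smul_tmul']

lemma skew_comm_one [Algebra k A] {t e g g' : A} (h1 : t * e = e * t)
    (h2 : t * g = g * t) (h3 : t * g' = g' * t) :
    t ⊗ₜ[k] t * (e ⊗ₜ g + g' ⊗ₜ e) = (e ⊗ₜ g + g' ⊗ₜ e) * t ⊗ₜ t := by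
  simp only [mul_add, add_mul, Algebra.TensorProduct.tmul_mul_tmul, h1, h2, h3]

variable [Bialgebra k A]

lemma antipode_right_mul (S : A →ₐ[k] Aᵐᵒᵖ) {x y : A}
    (hx : LinearMap.mul' k A ((ofAnti S).rTensor A (Coalgebra.comul x)) =
      algebraMap k A (Coalgebra.counit x))
    (hy : LinearMap.mul' k A ((ofAnti S).rTensor A (Coalgebra.comul y)) =
      algebraMap k A (Coalgebra.counit y)) :
    LinearMap.mul' k A ((ofAnti S).rTensor A (Coalgebra.comul (x * y))) =
      algebraMap k A (Coalgebra.counit (x * y)) := by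
  have key : ∀ u v : A ⊗[k] A, ∀ c : k,
      LinearMap.mul' k A ((ofAnti S).rTensor A u) = algebraMap k A c →
      LinearMap.mul' k A ((ofAnti S).rTensor A (u * v)) =
        c • LinearMap.mul' k A ((ofAnti S).rTensor A v) := by
    intro u v c hu
    induction v with
    | zero => simp
    | add v w hv hw => rw [mul_add, map_add, map_add, map_add, map_add, hv, hw, smul_add]
    | tmul y z =>
      have h : LinearMap.mul' k A ((ofAnti S).rTensor A (u * y ⊗ₜ z)) =
          ofAnti S y * LinearMap.mul' k A ((ofAnti S).rTensor A u) * z := by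
        clear hu
        induction u with
        | zero => simp
        | add v w hv hw =>
          rw [add_mul, map_add, map_add, map_add, map_add, hv, hw, mul_add, add_mul]
        | tmul p r => simp [ofAnti_apply, mul_assoc]
      rw [h, hu]
      simp [Algebra.algebraMap_eq_smul_one]
  rw [Bialgebra.comul_mul, key _ _ _ hx, hy, Bialgebra.counit_mul, map_mul, Algebra.smul_def]

lemma antipode_left_mul (S : A →ₐ[k] Aᵐᵒᵖ) {x y : A}
    (hx : LinearMap.mul' k A ((ofAnti S).lTensor A (Coalgebra.comul x)) =
      algebraMap k A (Coalgebra.counit x))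
    (hy : LinearMap.mul' k A ((ofAnti S).lTensor A (Coalgebra.comul y)) =
      algebraMap k A (Coalgebra.counit y)) :
    LinearMap.mul' k A ((ofAnti S).lTensor A (Coalgebra.comul (x * y))) =
      algebraMap k A (Coalgebra.counit (x * y)) := by
  have key : ∀ u v : A ⊗[k] A, ∀ c : k,
      LinearMap.mul' k A ((ofAnti S).lTensor A v) = algebraMap k A c →
      LinearMap.mul' k A ((ofAnti S).lTensor A (u * v)) =
        c • LinearMap.mul' k A ((ofAnti S).lTensor A u) := by
    intro u v c hv
    induction u with
    | zero => simp
    | add u w hu hw => rw [add_mul, map_add, map_add, map_add, map_add, hu, hw, smul_add]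
    | tmul y z =>
      have h : LinearMap.mul' k A ((ofAnti S).lTensor A (y ⊗ₜ z * v)) =
          y * LinearMap.mul' k A ((ofAnti S).lTensor A v) * ofAnti S z := by
        clear hv
        induction v with
        | zero => simp
        | add v w hv hw =>
          rw [mul_add, map_add, map_add, map_add, map_add, hv, hw, mul_add, add_mul]
        | tmul p r => simp [ofAnti_apply, mul_assoc]
      rw [h, hv]
      simp [Algebra.algebraMap_eq_smul_one]
  rw [Bialgebra.comul_mul, key _ _ _ hy, hx, Bialgebra.counit_mul, map_mul, Algebra.smul_def,
    Algebra.commutes]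

end Aux

/-! ### The enveloping algebra side -/

section QUEA

variable {k : Type*} [Field k]

/-- The square root `q^{1/2}` or `q'^{1/2}` of the deformation parameter of a sector. -/
def root (r r' : kˣ) : Sector → kˣ
  | .chiral => r
  | .anti => r'

/-- The free generator of name `x` in the sector `σ`. -/
abbrev ug (k : Type*) [Field k] (σ : Sector) (x : UGen) : FreeAlgebra k (Sector × UGen) :=
  FreeAlgebra.ι k (σ, x)

/-- The defining relations of the enveloping algebra, with `r = q^{1/2}`, `r' = q'^{1/2}` and
`s = ℓ^{1/2}`. The elements `ℓ^h` and `ℓ^{h'}` that occur in the coproduct are adjoined as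
exponentials of the same Cartan generators; `exp_rule` says that the exponential
`(q^h)^m (ℓ^h)^n` depends only on its base `q^m ℓ^n` (with chosen square root `r^m s^n`).
It is vacuous when `r` and `s` are multiplicatively independent. -/
inductive URel (r r' s : kˣ) :
    FreeAlgebra k (Sector × UGen) → FreeAlgebra k (Sector × UGen) → Prop
  | K_Kinv (σ : Sector) : URel r r' s (ug k σ .K * ug k σ .Kinv) 1
  | Kinv_K (σ : Sector) : URel r r' s (ug k σ .Kinv * ug k σ .K) 1
  | L_Linv (σ : Sector) : URel r r' s (ug k σ .L * ug k σ .Linv) 1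
  | Linv_L (σ : Sector) : URel r r' s (ug k σ .Linv * ug k σ .L) 1
  | K_L (σ : Sector) : URel r r' s (ug k σ .K * ug k σ .L) (ug k σ .L * ug k σ .K)
  | exp_rule (σ : Sector) (m n m' n' : ℕ)
      (h : root r r' σ ^ m * s ^ n = root r r' σ ^ m' * s ^ n') :
      URel r r' s (ug k σ .K ^ m * ug k σ .L ^ n) (ug k σ .K ^ m' * ug k σ .L ^ n')
  | K_E (σ : Sector) : URel r r' s (ug k σ .K * ug k σ .E)
      ((root r r' σ : k) ^ 2 • (ug k σ .E * ug k σ .K))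
  | K_F (σ : Sector) : URel r r' s (ug k σ .K * ug k σ .F)
      (((root r r' σ : k) ^ 2)⁻¹ • (ug k σ .F * ug k σ .K))
  | L_E (σ : Sector) : URel r r' s (ug k σ .L * ug k σ .E)
      ((s : k) ^ 2 • (ug k σ .E * ug k σ .L))
  | L_F (σ : Sector) : URel r r' s (ug k σ .L * ug k σ .F)
      (((s : k) ^ 2)⁻¹ • (ug k σ .F * ug k σ .L))
  | E_F (σ : Sector) : URel r r' s (ug k σ .E * ug k σ .F - ug k σ .F * ug k σ .E)
      (((root r r' σ : k) ^ 2 - ((root r r' σ : k) ^ 2)⁻¹)⁻¹ •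
        (ug k σ .K ^ 2 - ug k σ .Kinv ^ 2))
  | comm (x y : UGen) : URel r r' s (ug k .chiral x * ug k .anti y) (ug k .anti y * ug k .chiral x)

/-- The algebra `U_{q,q'}(sl₂ ⊕^ℓ sl₂)` with `q = r²`, `q' = r'²`, `ℓ = s²`. -/
def QUEA (r r' s : kˣ) : Type _ := RingQuot (URel r r' s)

variable (r r' s : kˣ)

instance : Ring (QUEA r r' s) := inferInstanceAs (Ring (RingQuot (URel r r' s)))

instance QUEA.instAlgebra : Algebra k (QUEA r r' s) :=
  inferInstanceAs (Algebra k (RingQuot (URel r r' s)))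

namespace QUEA

variable {r r' s}

/-- The generators of the enveloping algebra. -/
def gen (σ : Sector) (x : UGen) : QUEA r r' s :=
  RingQuot.mkAlgHom k (URel r r' s) (ug k σ x)

/-- The homomorphism defined by images of the generators that satisfy the relations. -/
def lift {B : Type*} [Ring B] [Algebra k B] (f : Sector → UGen → B)
    (h : ∀ x y, URel r r' s x y →
      FreeAlgebra.lift k (fun p : Sector × UGen => f p.1 p.2) x =
        FreeAlgebra.lift k (fun p : Sector × UGen => f p.1 p.2) y) : QUEA r r' s →ₐ[k] B :=
  RingQuot.liftAlgHom k ⟨FreeAlgebra.lift k (fun p : Sector × UGen => f p.1 p.2), h⟩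

lemma lift_gen {B : Type*} [Ring B] [Algebra k B] (f : Sector → UGen → B) (h) (σ x) :
    lift (r := r) (r' := r') (s := s) f h (gen σ x) = f σ x := by
  unfold lift gen
  erw [RingQuot.liftAlgHom_mkAlgHom_apply]
  simp

theorem induction {C : QUEA r r' s → Prop} (hc : ∀ c : k, C (algebraMap k _ c))
    (hg : ∀ σ x, C (gen σ x)) (hm : ∀ x y, C x → C y → C (x * y))
    (ha : ∀ x y, C x → C y → C (x + y)) (x : QUEA r r' s) : C x := by
  obtain ⟨y, rfl⟩ := RingQuot.mkAlgHom_surjective k (URel r r' s) x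
  induction y with
  | grade0 c => simpa using! hc c
  | grade1 p => exact hg p.1 p.2
  | mul a b h1 h2 => rw [map_mul]; exact hm _ _ h1 h2
  | add a b h1 h2 => rw [map_add]; exact ha _ _ h1 h2

theorem hom_ext {B : Type*} [Semiring B] [Algebra k B] {f g : QUEA r r' s →ₐ[k] B}
    (h : ∀ σ x, f (gen σ x) = g (gen σ x)) : f = g := by
  ext x
  induction x using induction with
  | hc c => simp
  | hg σ x => exact h σ x
  | hm x y h1 h2 => rw [map_mul, map_mul, h1, h2]
  | ha x y h1 h2 => rw [map_add, map_add, h1, h2]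


lemma rel {x y : FreeAlgebra k (Sector × UGen)} (h : URel r r' s x y) :
    RingQuot.mkAlgHom k (URel r r' s) x = RingQuot.mkAlgHom k (URel r r' s) y :=
  RingQuot.mkAlgHom_rel k h

/-- The scalar `(q - q⁻¹)⁻¹` of a sector. -/
abbrev kap (r r' : kˣ) (σ : Sector) : k :=
  ((root r r' σ : k) ^ 2 - ((root r r' σ : k) ^ 2)⁻¹)⁻¹

variable (σ : Sector)

lemma K_Kinv : (gen σ .K * gen σ .Kinv : QUEA r r' s) = 1 := by
  simpa [gen] using! rel (URel.K_Kinv (r := r) (r' := r') (s := s) σ)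
lemma Kinv_K : (gen σ .Kinv * gen σ .K : QUEA r r' s) = 1 := by
  simpa [gen] using! rel (URel.Kinv_K (r := r) (r' := r') (s := s) σ)
lemma L_Linv : (gen σ .L * gen σ .Linv : QUEA r r' s) = 1 := by
  simpa [gen] using! rel (URel.L_Linv (r := r) (r' := r') (s := s) σ)
lemma Linv_L : (gen σ .Linv * gen σ .L : QUEA r r' s) = 1 := by
  simpa [gen] using! rel (URel.Linv_L (r := r) (r' := r') (s := s) σ)
lemma L_K : (gen σ .L * gen σ .K : QUEA r r' s) = gen σ .K * gen σ .L := by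
  simpa [gen] using! (rel (URel.K_L (r := r) (r' := r') (s := s) σ)).symm
lemma exp_rule (m n m' n' : ℕ) (h : root r r' σ ^ m * s ^ n = root r r' σ ^ m' * s ^ n') :
    (gen σ .K ^ m * gen σ .L ^ n : QUEA r r' s) = gen σ .K ^ m' * gen σ .L ^ n' := by
  simpa [gen] using! rel (URel.exp_rule (r := r) (r' := r') (s := s) σ m n m' n' h)
lemma K_E : (gen σ .K * gen σ .E : QUEA r r' s) =
    (root r r' σ : k) ^ 2 • (gen σ .E * gen σ .K) := by
  simpa [gen] using! rel (URel.K_E (r := r) (r' := r') (s := s) σ)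
lemma K_F : (gen σ .K * gen σ .F : QUEA r r' s) =
    ((root r r' σ : k) ^ 2)⁻¹ • (gen σ .F * gen σ .K) := by
  simpa [gen] using! rel (URel.K_F (r := r) (r' := r') (s := s) σ)
lemma L_E : (gen σ .L * gen σ .E : QUEA r r' s) = (s : k) ^ 2 • (gen σ .E * gen σ .L) := by
  simpa [gen] using! rel (URel.L_E (r := r) (r' := r') (s := s) σ)
lemma L_F : (gen σ .L * gen σ .F : QUEA r r' s) = ((s : k) ^ 2)⁻¹ • (gen σ .F * gen σ .L) := by
  simpa [gen] using! rel (URel.L_F (r := r) (r' := r') (s := s) σ)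
lemma F_E : (gen σ .F * gen σ .E : QUEA r r' s) = gen σ .E * gen σ .F -
    kap r r' σ • (gen σ .K * gen σ .K - gen σ .Kinv * gen σ .Kinv) := by
  have h : (gen σ .E * gen σ .F - gen σ .F * gen σ .E : QUEA r r' s) =
      kap r r' σ • (gen σ .K ^ 2 - gen σ .Kinv ^ 2) := by
    simpa [gen] using! rel (URel.E_F (r := r) (r' := r') (s := s) σ)
  rw [← pow_two, ← pow_two, ← h, sub_sub_cancel]
lemma cross (x y : UGen) :
    (gen .anti y * gen .chiral x : QUEA r r' s) = gen .chiral x * gen .anti y := by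
  simpa [gen] using! (rel (URel.comm (r := r) (r' := r') (s := s) x y)).symm

lemma inv_comm {A : Type*} [Ring A] [Algebra k A] {t t' e : A} {c : k} (hc : c ≠ 0)
    (h1 : t * t' = 1) (h2 : t' * t = 1) (h : t * e = c • (e * t)) : t' * e = c⁻¹ • (e * t') := by
  have h3 : t' * (t * e) * t' = c • (t' * e) := by
    rw [h, mul_smul_comm, smul_mul_assoc, mul_assoc t', mul_assoc e, h1, mul_one]
  rw [← mul_assoc, h2, one_mul] at h3
  rw [h3, smul_smul, inv_mul_cancel₀ hc, one_smul]

lemma inv_comm_one {A : Type*} [Ring A] {t t' e : A}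
    (h1 : t * t' = 1) (h2 : t' * t = 1) (h : t * e = e * t) : t' * e = e * t' := by
  have h3 : t' * (t * e) * t' = t' * e := by
    rw [h, mul_assoc t', mul_assoc e, h1, mul_one]
  rw [← mul_assoc, h2, one_mul] at h3
  exact h3.symm

lemma Kinv_E : (gen σ .Kinv * gen σ .E : QUEA r r' s) =
    ((root r r' σ : k) ^ 2)⁻¹ • (gen σ .E * gen σ .Kinv) :=
  inv_comm (by simp) (K_Kinv σ) (Kinv_K σ) (K_E σ)
lemma Kinv_F : (gen σ .Kinv * gen σ .F : QUEA r r' s) =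
    ((root r r' σ : k) ^ 2) • (gen σ .F * gen σ .Kinv) := by
  simpa using inv_comm (by simp) (K_Kinv σ) (Kinv_K σ) (K_F (r := r) (r' := r') (s := s) σ)
lemma Linv_E : (gen σ .Linv * gen σ .E : QUEA r r' s) =
    ((s : k) ^ 2)⁻¹ • (gen σ .E * gen σ .Linv) :=
  inv_comm (by simp) (L_Linv σ) (Linv_L σ) (L_E σ)
lemma Linv_F : (gen σ .Linv * gen σ .F : QUEA r r' s) =
    ((s : k) ^ 2) • (gen σ .F * gen σ .Linv) := by
  simpa using inv_comm (by simp) (L_Linv σ) (Linv_L σ) (L_F (r := r) (r' := r') (s := s) σ)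
lemma Linv_K : (gen σ .Linv * gen σ .K : QUEA r r' s) = gen σ .K * gen σ .Linv :=
  inv_comm_one (L_Linv σ) (Linv_L σ) (L_K σ)
lemma L_Kinv : (gen σ .L * gen σ .Kinv : QUEA r r' s) = gen σ .Kinv * gen σ .L :=
  (inv_comm_one (K_Kinv σ) (Kinv_K σ) (L_K σ).symm).symm
lemma Linv_Kinv : (gen σ .Linv * gen σ .Kinv : QUEA r r' s) = gen σ .Kinv * gen σ .Linv :=
  inv_comm_one (L_Linv σ) (Linv_L σ) (L_Kinv σ)

/-- The comultiplication on the generators. -/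
def comulGen : Sector → UGen → QUEA r r' s ⊗[k] QUEA r r' s
  | .chiral, .E => gen .chiral .E ⊗ₜ (gen .chiral .K * gen .anti .L) +
      (gen .chiral .Kinv * gen .anti .Linv) ⊗ₜ gen .chiral .E
  | .chiral, .F => gen .chiral .F ⊗ₜ (gen .chiral .K * gen .anti .Linv) +
      (gen .chiral .Kinv * gen .anti .L) ⊗ₜ gen .chiral .F
  | .anti, .E => gen .anti .E ⊗ₜ (gen .anti .K * gen .chiral .Linv) +
      (gen .anti .Kinv * gen .chiral .L) ⊗ₜ gen .anti .E
  | .anti, .F => gen .anti .F ⊗ₜ (gen .anti .K * gen .chiral .L) +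
      (gen .anti .Kinv * gen .chiral .Linv) ⊗ₜ gen .anti .F
  | σ, x => gen σ x ⊗ₜ gen σ x

/-- The counit on the generators. -/
def counitGen : UGen → k
  | .E => 0
  | .F => 0
  | _ => 1

/-- The antipode on the generators. -/
def antipodeGen : Sector → UGen → QUEA r r' s
  | σ, .E => -((root r r' σ : k) ^ 2 • gen σ .E)
  | σ, .F => -(((root r r' σ : k) ^ 2)⁻¹ • gen σ .F)
  | σ, .K => gen σ .Kinv
  | σ, .Kinv => gen σ .K
  | σ, .L => gen σ .Linv
  | σ, .Linv => gen σ .L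


set_option maxHeartbeats 4000000 in
lemma comulGen_rel (x y : FreeAlgebra k (Sector × UGen)) (h : URel r r' s x y) :
    FreeAlgebra.lift k (fun p : Sector × UGen =>
      (comulGen p.1 p.2 : QUEA r r' s ⊗[k] QUEA r r' s)) x =
    FreeAlgebra.lift k (fun p : Sector × UGen => comulGen p.1 p.2) y := by
  have hr : ∀ σ, (root r r' σ : k) ≠ 0 := fun σ => Units.ne_zero _
  have hs : (s : k) ≠ 0 := Units.ne_zero _
  rcases h with σ | σ | σ | σ | σ | ⟨σ, m, n, m', n', h⟩ | σ | σ | σ | σ | σ | ⟨x, y⟩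
  · cases σ <;> simp [comulGen, K_Kinv, Algebra.TensorProduct.one_def]
  · cases σ <;> simp [comulGen, Kinv_K, Algebra.TensorProduct.one_def]
  · cases σ <;> simp [comulGen, L_Linv, Algebra.TensorProduct.one_def]
  · cases σ <;> simp [comulGen, Linv_L, Algebra.TensorProduct.one_def]
  · cases σ <;> simp [comulGen, L_K]
  · cases σ <;> simp [comulGen, Algebra.TensorProduct.tmul_pow, exp_rule _ m n m' n' h]
  pick_goal 6
  · simp only [map_mul, FreeAlgebra.lift_ι_apply]
    cases x <;> cases y
    all_goals try (simp only [comulGen, Algebra.TensorProduct.tmul_mul_tmul, cross]; done)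
    all_goals try
      refine skew_comm_one (cross _ _).symm ?_ ?_ <;>
      simp [mul_assoc, cross, assoc_of_eq (cross _ _), K_Kinv, Kinv_K, L_Linv, Linv_L, L_K, Linv_K,
        L_Kinv, Linv_Kinv, assoc_of_eq (K_Kinv _), assoc_of_eq (Kinv_K _), assoc_of_eq (L_Linv _),
        assoc_of_eq (Linv_L _), assoc_of_eq (L_K _), assoc_of_eq (Linv_K _),
        assoc_of_eq (L_Kinv _), assoc_of_eq (Linv_Kinv _)]
    all_goals try
      refine (skew_comm_one (cross _ _) ?_ ?_).symm <;>
      simp [mul_assoc, cross, assoc_of_eq (cross _ _), K_Kinv, Kinv_K, L_Linv, Linv_L, L_K, Linv_K,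
        L_Kinv, Linv_Kinv, assoc_of_eq (K_Kinv _), assoc_of_eq (Kinv_K _), assoc_of_eq (L_Linv _),
        assoc_of_eq (Linv_L _), assoc_of_eq (L_K _), assoc_of_eq (Linv_K _),
        assoc_of_eq (L_Kinv _), assoc_of_eq (Linv_Kinv _)]
    all_goals
      simp [comulGen, kap, pow_two, mul_add, add_mul, mul_sub, sub_mul, mul_assoc, smul_add,
        smul_sub, TensorProduct.tmul_smul, TensorProduct.smul_tmul', TensorProduct.tmul_sub,
        TensorProduct.sub_tmul, smul_smul, hs,
        K_Kinv, Kinv_K, L_Linv, Linv_L, L_K, Linv_K, L_Kinv, Linv_Kinv, K_E, K_F, L_E, L_F, F_E,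
        Kinv_E, Kinv_F, Linv_E, Linv_F, cross, assoc_of_eq (K_Kinv _), assoc_of_eq (Kinv_K _),
        assoc_of_eq (L_Linv _), assoc_of_eq (Linv_L _), assoc_of_eq (L_K _), assoc_of_eq (Linv_K _),
        assoc_of_eq (L_Kinv _), assoc_of_eq (Linv_Kinv _), assoc_of_eq (K_E _), assoc_of_eq (K_F _),
        assoc_of_eq (L_E _), assoc_of_eq (L_F _), assoc_of_eq (F_E _), assoc_of_eq (Kinv_E _),
        assoc_of_eq (Kinv_F _), assoc_of_eq (Linv_E _), assoc_of_eq (Linv_F _),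
        assoc_of_eq (cross _ _)] <;> abel
  all_goals cases σ
  all_goals try simp only [map_mul, map_smul, map_sub, map_pow, FreeAlgebra.lift_ι_apply]
  iterate 2
    refine skew_comm (K_E _) ?_ ?_ <;>
      simp [mul_assoc, cross, assoc_of_eq (cross _ _), K_Kinv, Kinv_K, L_Linv, Linv_L, L_K, Linv_K,
        L_Kinv, Linv_Kinv, assoc_of_eq (K_Kinv _), assoc_of_eq (Kinv_K _), assoc_of_eq (L_Linv _),
        assoc_of_eq (Linv_L _), assoc_of_eq (L_K _), assoc_of_eq (Linv_K _),
        assoc_of_eq (L_Kinv _), assoc_of_eq (Linv_Kinv _)]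
  iterate 2
    refine skew_comm (K_F _) ?_ ?_ <;>
      simp [mul_assoc, cross, assoc_of_eq (cross _ _), K_Kinv, Kinv_K, L_Linv, Linv_L, L_K, Linv_K,
        L_Kinv, Linv_Kinv, assoc_of_eq (K_Kinv _), assoc_of_eq (Kinv_K _), assoc_of_eq (L_Linv _),
        assoc_of_eq (Linv_L _), assoc_of_eq (L_K _), assoc_of_eq (Linv_K _),
        assoc_of_eq (L_Kinv _), assoc_of_eq (Linv_Kinv _)]
  iterate 2
    refine skew_comm (L_E _) ?_ ?_ <;>
      simp [mul_assoc, cross, assoc_of_eq (cross _ _), K_Kinv, Kinv_K, L_Linv, Linv_L, L_K, Linv_K,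
        L_Kinv, Linv_Kinv, assoc_of_eq (K_Kinv _), assoc_of_eq (Kinv_K _), assoc_of_eq (L_Linv _),
        assoc_of_eq (Linv_L _), assoc_of_eq (L_K _), assoc_of_eq (Linv_K _),
        assoc_of_eq (L_Kinv _), assoc_of_eq (Linv_Kinv _)]
  iterate 2
    refine skew_comm (L_F _) ?_ ?_ <;>
      simp [mul_assoc, cross, assoc_of_eq (cross _ _), K_Kinv, Kinv_K, L_Linv, Linv_L, L_K, Linv_K,
        L_Kinv, Linv_Kinv, assoc_of_eq (K_Kinv _), assoc_of_eq (Kinv_K _), assoc_of_eq (L_Linv _),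
        assoc_of_eq (Linv_L _), assoc_of_eq (L_K _), assoc_of_eq (Linv_K _),
        assoc_of_eq (L_Kinv _), assoc_of_eq (Linv_Kinv _)]
  all_goals
    simp [comulGen, kap, pow_two, mul_add, add_mul, mul_sub, sub_mul, mul_assoc, smul_add,
      smul_sub, TensorProduct.tmul_smul, TensorProduct.smul_tmul', TensorProduct.tmul_sub,
      TensorProduct.sub_tmul, smul_smul, hs,
      K_Kinv, Kinv_K, L_Linv, Linv_L, L_K, Linv_K, L_Kinv, Linv_Kinv, K_E, K_F, L_E, L_F, F_E,
      Kinv_E, Kinv_F, Linv_E, Linv_F, cross, assoc_of_eq (K_Kinv _), assoc_of_eq (Kinv_K _),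
      assoc_of_eq (L_Linv _), assoc_of_eq (Linv_L _), assoc_of_eq (L_K _), assoc_of_eq (Linv_K _),
      assoc_of_eq (L_Kinv _), assoc_of_eq (Linv_Kinv _), assoc_of_eq (K_E _), assoc_of_eq (K_F _),
      assoc_of_eq (L_E _), assoc_of_eq (L_F _), assoc_of_eq (F_E _), assoc_of_eq (Kinv_E _),
      assoc_of_eq (Kinv_F _), assoc_of_eq (Linv_E _), assoc_of_eq (Linv_F _),
      assoc_of_eq (cross _ _)] <;> abel

/-- The comultiplication. -/
def comulHom : QUEA r r' s →ₐ[k] QUEA r r' s ⊗[k] QUEA r r' s := lift comulGen comulGen_rel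

lemma comulHom_gen (σ : Sector) (x : UGen) :
    comulHom (gen σ x : QUEA r r' s) = comulGen σ x := lift_gen _ _ _ _

lemma counitGen_rel (x y : FreeAlgebra k (Sector × UGen)) (h : URel r r' s x y) :
    FreeAlgebra.lift k (fun p : Sector × UGen => (counitGen p.2 : k)) x =
    FreeAlgebra.lift k (fun p : Sector × UGen => counitGen p.2) y := by
  rcases h with σ | σ | σ | σ | σ | ⟨σ, m, n, m', n', h⟩ | σ | σ | σ | σ | σ | ⟨x, y⟩ <;>
    simp [counitGen, mul_comm]

/-- The counit. -/
def counitHom : QUEA r r' s →ₐ[k] k := lift (fun _ x => counitGen x) counitGen_rel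

lemma counitHom_gen (σ : Sector) (x : UGen) :
    counitHom (gen σ x : QUEA r r' s) = counitGen x := lift_gen _ _ _ _

instance instBialgebra : Bialgebra k (QUEA r r' s) :=
  Bialgebra.ofAlgHom comulHom counitHom
    (hom_ext fun σ x => by
      cases σ <;> cases x <;>
      simp [comulHom_gen, comulGen, TensorProduct.add_tmul, TensorProduct.tmul_add,
        Algebra.TensorProduct.tmul_mul_tmul, add_assoc] )
    (hom_ext fun σ x => by
      cases σ <;> cases x <;> simp [comulHom_gen, comulGen, counitHom_gen, counitGen])
    (hom_ext fun σ x => by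
      cases σ <;> cases x <;> simp [comulHom_gen, comulGen, counitHom_gen, counitGen])

lemma comul_gen (σ : Sector) (x : UGen) :
    Coalgebra.comul (R := k) (gen σ x : QUEA r r' s) = comulGen σ x := comulHom_gen σ x

lemma counit_gen (σ : Sector) (x : UGen) :
    Coalgebra.counit (R := k) (gen σ x : QUEA r r' s) = counitGen x := counitHom_gen σ x

lemma exp_rule_inv (m n m' n' : ℕ) (h : root r r' σ ^ m * s ^ n = root r r' σ ^ m' * s ^ n') :
    (gen σ .Kinv ^ m * gen σ .Linv ^ n : QUEA r r' s) = gen σ .Kinv ^ m' * gen σ .Linv ^ n' := by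
  have hc : Commute (gen σ .L : QUEA r r' s) (gen σ .K) := L_K σ
  have e1 : ∀ m n : ℕ, (gen σ .Kinv ^ m * gen σ .Linv ^ n : QUEA r r' s) *
      (gen σ .K ^ m * gen σ .L ^ n) = 1 := by
    intro m n
    rw [← (hc.pow_pow n m).eq, mul_assoc, ← mul_assoc (gen σ .Linv ^ n), ← Commute.mul_pow,
      Linv_L, one_pow, one_mul, ← Commute.mul_pow, Kinv_K, one_pow]
    · rw [Commute, SemiconjBy, K_Kinv, Kinv_K]
    · rw [Commute, SemiconjBy, L_Linv, Linv_L]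
  have e2 : ∀ m n : ℕ, (gen σ .K ^ m * gen σ .L ^ n : QUEA r r' s) *
      (gen σ .Kinv ^ m * gen σ .Linv ^ n) = 1 := by
    intro m n
    have hc' : Commute (gen σ .Linv : QUEA r r' s) (gen σ .Kinv) := Linv_Kinv σ
    rw [← (hc'.pow_pow n m).eq, mul_assoc, ← mul_assoc (gen σ .L ^ n), ← Commute.mul_pow,
      L_Linv, one_pow, one_mul, ← Commute.mul_pow, K_Kinv, one_pow]
    · rw [Commute, SemiconjBy, K_Kinv, Kinv_K]
    · rw [Commute, SemiconjBy, L_Linv, Linv_L]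
  exact left_inv_eq_right_inv (by rw [← exp_rule σ m n m' n' h]; exact e1 m n) (e2 m' n')

set_option maxHeartbeats 4000000 in
lemma antipodeGen_rel (x y : FreeAlgebra k (Sector × UGen)) (h : URel r r' s x y) :
    FreeAlgebra.lift k (fun p : Sector × UGen =>
      MulOpposite.op (antipodeGen p.1 p.2 : QUEA r r' s)) x =
    FreeAlgebra.lift k (fun p : Sector × UGen => MulOpposite.op (antipodeGen p.1 p.2)) y := by
  have hr : ∀ σ, (root r r' σ : k) ≠ 0 := fun σ => Units.ne_zero _
  have hs : (s : k) ≠ 0 := Units.ne_zero _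
  apply MulOpposite.unop_injective
  rcases h with σ | σ | σ | σ | σ | ⟨σ, m, n, m', n', h⟩ | σ | σ | σ | σ | σ | ⟨x, y⟩
  · simp [antipodeGen, K_Kinv]
  · simp [antipodeGen, Kinv_K]
  · simp [antipodeGen, L_Linv]
  · simp [antipodeGen, Linv_L]
  · simp [antipodeGen, Linv_Kinv]
  · have hc' : Commute (gen σ .Linv : QUEA r r' s) (gen σ .Kinv) := Linv_Kinv σ
    simp [antipodeGen, (hc'.pow_pow _ _).eq, exp_rule_inv σ m n m' n' h]
  · simp [antipodeGen, Kinv_E, smul_smul, hr]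
  · simp [antipodeGen, Kinv_F, smul_smul, hr]
  · simp [antipodeGen, Linv_E, smul_smul, hs, mul_comm]
  · simp [antipodeGen, Linv_F, smul_smul, hs, mul_comm]
  · have h1 : ((root r r' σ : k))⁻¹ * ((root r r' σ : k))⁻¹ *
        ((root r r' σ : k) * (root r r' σ : k)) = 1 := by have := hr σ; field_simp
    have h2 := (mul_comm _ _).trans h1
    simp [antipodeGen, F_E, smul_smul, pow_two, kap, smul_sub, h1, h2]
  · cases x <;> cases y <;> simp [antipodeGen, cross, smul_smul, mul_comm]

/-- The antipode as an anti-homomorphism. -/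
def antipodeHom : QUEA r r' s →ₐ[k] (QUEA r r' s)ᵐᵒᵖ :=
  lift (fun σ x => MulOpposite.op (antipodeGen σ x)) antipodeGen_rel

lemma antipodeHom_gen (σ : Sector) (x : UGen) :
    ofAnti antipodeHom (gen σ x : QUEA r r' s) = antipodeGen σ x := by
  rw [ofAnti_apply, antipodeHom, lift_gen, MulOpposite.unop_op]

set_option maxHeartbeats 4000000 in
instance instHopfAlgebra : HopfAlgebra k (QUEA r r' s) where
  antipode := ofAnti antipodeHom
  mul_antipode_rTensor_comul := by
    have hr : ∀ σ, (root r r' σ : k) ≠ 0 := fun σ => Units.ne_zero _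
    have hs : (s : k) ≠ 0 := Units.ne_zero _
    ext x
    simp only [LinearMap.comp_apply, Algebra.linearMap_apply]
    induction x using induction with
    | hc c => simp [ofAnti_algebraMap, ofAnti_one]
    | hg σ x =>
      rw [comul_gen, counit_gen]
      cases σ <;> cases x <;>
      simp [comulGen, counitGen, antipodeHom_gen, antipodeGen, ofAnti_mul, mul_assoc, smul_smul, hr, hs,
        K_Kinv, Kinv_K, L_Linv, Linv_L, L_K, Linv_K, L_Kinv, Linv_Kinv, K_E, K_F, L_E, L_F, F_E,
        Kinv_E, Kinv_F, Linv_E, Linv_F, cross, assoc_of_eq (K_Kinv _), assoc_of_eq (Kinv_K _),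
        assoc_of_eq (L_Linv _), assoc_of_eq (Linv_L _), assoc_of_eq (L_K _), assoc_of_eq (Linv_K _),
        assoc_of_eq (L_Kinv _), assoc_of_eq (Linv_Kinv _), assoc_of_eq (K_E _), assoc_of_eq (K_F _),
        assoc_of_eq (L_E _), assoc_of_eq (L_F _), assoc_of_eq (F_E _), assoc_of_eq (Kinv_E _),
        assoc_of_eq (Kinv_F _), assoc_of_eq (Linv_E _), assoc_of_eq (Linv_F _),
        assoc_of_eq (cross _ _)]
    | hm x y h1 h2 => exact antipode_right_mul _ h1 h2
    | ha x y h1 h2 => rw [map_add, map_add, map_add, map_add, map_add, h1, h2]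
  mul_antipode_lTensor_comul := by
    have hr : ∀ σ, (root r r' σ : k) ≠ 0 := fun σ => Units.ne_zero _
    have hs : (s : k) ≠ 0 := Units.ne_zero _
    ext x
    simp only [LinearMap.comp_apply, Algebra.linearMap_apply]
    induction x using induction with
    | hc c => simp [ofAnti_algebraMap, ofAnti_one]
    | hg σ x =>
      rw [comul_gen, counit_gen]
      cases σ <;> cases x <;>
      simp [comulGen, counitGen, antipodeHom_gen, antipodeGen, ofAnti_mul, mul_assoc, smul_smul, hr, hs,
        K_Kinv, Kinv_K, L_Linv, Linv_L, L_K, Linv_K, L_Kinv, Linv_Kinv, K_E, K_F, L_E, L_F, F_E,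
        Kinv_E, Kinv_F, Linv_E, Linv_F, cross, assoc_of_eq (K_Kinv _), assoc_of_eq (Kinv_K _),
        assoc_of_eq (L_Linv _), assoc_of_eq (Linv_L _), assoc_of_eq (L_K _), assoc_of_eq (Linv_K _),
        assoc_of_eq (L_Kinv _), assoc_of_eq (Linv_Kinv _), assoc_of_eq (K_E _), assoc_of_eq (K_F _),
        assoc_of_eq (L_E _), assoc_of_eq (L_F _), assoc_of_eq (F_E _), assoc_of_eq (Kinv_E _),
        assoc_of_eq (Kinv_F _), assoc_of_eq (Linv_E _), assoc_of_eq (Linv_F _),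
        assoc_of_eq (cross _ _)]
    | hm x y h1 h2 => exact antipode_left_mul _ h1 h2
    | ha x y h1 h2 => rw [map_add, map_add, map_add, map_add, map_add, h1, h2]

end QUEA
end QUEA

/-! ### The function algebra side -/

section QFA

variable {k : Type*} [Field k]

/-- The Manin parameter of a sector: `q` for the chiral one, `1/q'` for the antichiral one. -/
def manin (q q' : kˣ) : Sector → kˣ
  | .chiral => q
  | .anti => q'⁻¹

/-- The free generator of name `x` in the sector `σ`. -/
abbrev og (k : Type*) [Field k] (σ : Sector) (x : OGen) : FreeAlgebra k (Sector × OGen) :=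
  FreeAlgebra.ι k (σ, x)

/-- The defining relations of the function algebra: in each sector the Manin relations and
determinant one, and the link relations between the sectors. In the names of the link relations
`p` marks a primed generator. -/
inductive ORel (q q' ℓ : kˣ) :
    FreeAlgebra k (Sector × OGen) → FreeAlgebra k (Sector × OGen) → Prop
  | a_b (σ : Sector) : ORel q q' ℓ (og k σ .a * og k σ .b)
      ((manin q q' σ : k)⁻¹ • (og k σ .b * og k σ .a))
  | a_c (σ : Sector) : ORel q q' ℓ (og k σ .a * og k σ .c)
      ((manin q q' σ : k)⁻¹ • (og k σ .c * og k σ .a))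
  | b_d (σ : Sector) : ORel q q' ℓ (og k σ .b * og k σ .d)
      ((manin q q' σ : k)⁻¹ • (og k σ .d * og k σ .b))
  | c_d (σ : Sector) : ORel q q' ℓ (og k σ .c * og k σ .d)
      ((manin q q' σ : k)⁻¹ • (og k σ .d * og k σ .c))
  | a_d (σ : Sector) : ORel q q' ℓ (og k σ .a * og k σ .d - og k σ .d * og k σ .a)
      (((manin q q' σ : k)⁻¹ - manin q q' σ) • (og k σ .b * og k σ .c))
  | b_c (σ : Sector) : ORel q q' ℓ (og k σ .b * og k σ .c) (og k σ .c * og k σ .b)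
  | det (σ : Sector) : ORel q q' ℓ
      (og k σ .a * og k σ .d - (manin q q' σ : k)⁻¹ • (og k σ .b * og k σ .c)) 1
  | link_bp_a : ORel q q' ℓ (og k .anti .b * og k .chiral .a)
      ((ℓ : k) • (og k .chiral .a * og k .anti .b))
  | link_a_cp : ORel q q' ℓ (og k .chiral .a * og k .anti .c)
      ((ℓ : k) • (og k .anti .c * og k .chiral .a))
  | link_ap_b : ORel q q' ℓ (og k .anti .a * og k .chiral .b)
      ((ℓ : k) • (og k .chiral .b * og k .anti .a))
  | link_b_dp : ORel q q' ℓ (og k .chiral .b * og k .anti .d)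
      ((ℓ : k) • (og k .anti .d * og k .chiral .b))
  | link_c_ap : ORel q q' ℓ (og k .chiral .c * og k .anti .a)
      ((ℓ : k) • (og k .anti .a * og k .chiral .c))
  | link_dp_c : ORel q q' ℓ (og k .anti .d * og k .chiral .c)
      ((ℓ : k) • (og k .chiral .c * og k .anti .d))
  | link_d_bp : ORel q q' ℓ (og k .chiral .d * og k .anti .b)
      ((ℓ : k) • (og k .anti .b * og k .chiral .d))
  | link_cp_d : ORel q q' ℓ (og k .anti .c * og k .chiral .d)
      ((ℓ : k) • (og k .chiral .d * og k .anti .c))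
  | link_a_ap : ORel q q' ℓ (og k .chiral .a * og k .anti .a) (og k .anti .a * og k .chiral .a)
  | link_a_dp : ORel q q' ℓ (og k .chiral .a * og k .anti .d) (og k .anti .d * og k .chiral .a)
  | link_b_bp : ORel q q' ℓ (og k .chiral .b * og k .anti .b) (og k .anti .b * og k .chiral .b)
  | link_b_cp : ORel q q' ℓ (og k .chiral .b * og k .anti .c) (og k .anti .c * og k .chiral .b)
  | link_c_bp : ORel q q' ℓ (og k .chiral .c * og k .anti .b) (og k .anti .b * og k .chiral .c)
  | link_c_cp : ORel q q' ℓ (og k .chiral .c * og k .anti .c) (og k .anti .c * og k .chiral .c)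
  | link_d_ap : ORel q q' ℓ (og k .chiral .d * og k .anti .a) (og k .anti .a * og k .chiral .d)
  | link_d_dp : ORel q q' ℓ (og k .chiral .d * og k .anti .d) (og k .anti .d * og k .chiral .d)

/-- The algebra `SL_q(2) ⊕^ℓ SL_{1/q'}(2)`. -/
def QFA (q q' ℓ : kˣ) : Type _ := RingQuot (ORel q q' ℓ)

variable (q q' ℓ : kˣ)

instance : Ring (QFA q q' ℓ) := inferInstanceAs (Ring (RingQuot (ORel q q' ℓ)))

instance QFA.instAlgebra : Algebra k (QFA q q' ℓ) :=
  inferInstanceAs (Algebra k (RingQuot (ORel q q' ℓ)))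

namespace QFA

variable {q q' ℓ}

/-- The generators of the function algebra. -/
def gen (σ : Sector) (x : OGen) : QFA q q' ℓ :=
  RingQuot.mkAlgHom k (ORel q q' ℓ) (og k σ x)

/-- The homomorphism defined by images of the generators that satisfy the relations. -/
def lift {B : Type*} [Ring B] [Algebra k B] (f : Sector → OGen → B)
    (h : ∀ x y, ORel q q' ℓ x y →
      FreeAlgebra.lift k (fun p : Sector × OGen => f p.1 p.2) x =
        FreeAlgebra.lift k (fun p : Sector × OGen => f p.1 p.2) y) : QFA q q' ℓ →ₐ[k] B :=
  RingQuot.liftAlgHom k ⟨FreeAlgebra.lift k (fun p : Sector × OGen => f p.1 p.2), h⟩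

lemma lift_gen {B : Type*} [Ring B] [Algebra k B] (f : Sector → OGen → B) (h) (σ x) :
    lift (q := q) (q' := q') (ℓ := ℓ) f h (gen σ x) = f σ x := by
  unfold lift gen
  erw [RingQuot.liftAlgHom_mkAlgHom_apply]
  simp

theorem induction {C : QFA q q' ℓ → Prop} (hc : ∀ c : k, C (algebraMap k _ c))
    (hg : ∀ σ x, C (gen σ x)) (hm : ∀ x y, C x → C y → C (x * y))
    (ha : ∀ x y, C x → C y → C (x + y)) (x : QFA q q' ℓ) : C x := by
  obtain ⟨y, rfl⟩ := RingQuot.mkAlgHom_surjective k (ORel q q' ℓ) x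
  induction y with
  | grade0 c => simpa using! hc c
  | grade1 p => exact hg p.1 p.2
  | mul a b h1 h2 => rw [map_mul]; exact hm _ _ h1 h2
  | add a b h1 h2 => rw [map_add]; exact ha _ _ h1 h2

theorem hom_ext {B : Type*} [Semiring B] [Algebra k B] {f g : QFA q q' ℓ →ₐ[k] B}
    (h : ∀ σ x, f (gen σ x) = g (gen σ x)) : f = g := by
  ext x
  induction x using induction with
  | hc c => simp
  | hg σ x => exact h σ x
  | hm x y h1 h2 => rw [map_mul, map_mul, h1, h2]
  | ha x y h1 h2 => rw [map_add, map_add, h1, h2]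

lemma rel {x y : FreeAlgebra k (Sector × OGen)} (h : ORel q q' ℓ x y) :
    RingQuot.mkAlgHom k (ORel q q' ℓ) x = RingQuot.mkAlgHom k (ORel q q' ℓ) y :=
  RingQuot.mkAlgHom_rel k h

lemma flip_smul {A : Type*} [Ring A] [Algebra k A] {x y : A} {c : k} (hc : c ≠ 0)
    (h : x = c • y) : y = c⁻¹ • x := by
  rw [h, smul_smul, inv_mul_cancel₀ hc, one_smul]

lemma x_b_a : (gen .anti .b * gen .chiral .a : QFA q q' ℓ) =
    (ℓ : k) • (gen .chiral .a * gen .anti .b) := by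
  simpa [gen] using! rel (ORel.link_bp_a (q := q) (q' := q') (ℓ := ℓ))
lemma x_c_a : (gen .anti .c * gen .chiral .a : QFA q q' ℓ) =
    (ℓ : k)⁻¹ • (gen .chiral .a * gen .anti .c) := by
  refine flip_smul (Units.ne_zero ℓ) ?_
  simpa [gen] using! rel (ORel.link_a_cp (q := q) (q' := q') (ℓ := ℓ))
lemma x_a_b : (gen .anti .a * gen .chiral .b : QFA q q' ℓ) =
    (ℓ : k) • (gen .chiral .b * gen .anti .a) := by
  simpa [gen] using! rel (ORel.link_ap_b (q := q) (q' := q') (ℓ := ℓ))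
lemma x_d_b : (gen .anti .d * gen .chiral .b : QFA q q' ℓ) =
    (ℓ : k)⁻¹ • (gen .chiral .b * gen .anti .d) := by
  refine flip_smul (Units.ne_zero ℓ) ?_
  simpa [gen] using! rel (ORel.link_b_dp (q := q) (q' := q') (ℓ := ℓ))
lemma x_a_c : (gen .anti .a * gen .chiral .c : QFA q q' ℓ) =
    (ℓ : k)⁻¹ • (gen .chiral .c * gen .anti .a) := by
  refine flip_smul (Units.ne_zero ℓ) ?_
  simpa [gen] using! rel (ORel.link_c_ap (q := q) (q' := q') (ℓ := ℓ))
lemma x_d_c : (gen .anti .d * gen .chiral .c : QFA q q' ℓ) =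
    (ℓ : k) • (gen .chiral .c * gen .anti .d) := by
  simpa [gen] using! rel (ORel.link_dp_c (q := q) (q' := q') (ℓ := ℓ))
lemma x_b_d : (gen .anti .b * gen .chiral .d : QFA q q' ℓ) =
    (ℓ : k)⁻¹ • (gen .chiral .d * gen .anti .b) := by
  refine flip_smul (Units.ne_zero ℓ) ?_
  simpa [gen] using! rel (ORel.link_d_bp (q := q) (q' := q') (ℓ := ℓ))
lemma x_c_d : (gen .anti .c * gen .chiral .d : QFA q q' ℓ) =
    (ℓ : k) • (gen .chiral .d * gen .anti .c) := by
  simpa [gen] using! rel (ORel.link_cp_d (q := q) (q' := q') (ℓ := ℓ))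
lemma x_a_a : (gen .anti .a * gen .chiral .a : QFA q q' ℓ) =
    gen .chiral .a * gen .anti .a := by
  simpa [gen] using! (rel (ORel.link_a_ap (q := q) (q' := q') (ℓ := ℓ))).symm
lemma x_d_a : (gen .anti .d * gen .chiral .a : QFA q q' ℓ) =
    gen .chiral .a * gen .anti .d := by
  simpa [gen] using! (rel (ORel.link_a_dp (q := q) (q' := q') (ℓ := ℓ))).symm
lemma x_b_b : (gen .anti .b * gen .chiral .b : QFA q q' ℓ) =
    gen .chiral .b * gen .anti .b := by
  simpa [gen] using! (rel (ORel.link_b_bp (q := q) (q' := q') (ℓ := ℓ))).symm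
lemma x_c_b : (gen .anti .c * gen .chiral .b : QFA q q' ℓ) =
    gen .chiral .b * gen .anti .c := by
  simpa [gen] using! (rel (ORel.link_b_cp (q := q) (q' := q') (ℓ := ℓ))).symm
lemma x_b_c : (gen .anti .b * gen .chiral .c : QFA q q' ℓ) =
    gen .chiral .c * gen .anti .b := by
  simpa [gen] using! (rel (ORel.link_c_bp (q := q) (q' := q') (ℓ := ℓ))).symm
lemma x_c_c : (gen .anti .c * gen .chiral .c : QFA q q' ℓ) =
    gen .chiral .c * gen .anti .c := by
  simpa [gen] using! (rel (ORel.link_c_cp (q := q) (q' := q') (ℓ := ℓ))).symm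
lemma x_a_d : (gen .anti .a * gen .chiral .d : QFA q q' ℓ) =
    gen .chiral .d * gen .anti .a := by
  simpa [gen] using! (rel (ORel.link_d_ap (q := q) (q' := q') (ℓ := ℓ))).symm
lemma x_d_d : (gen .anti .d * gen .chiral .d : QFA q q' ℓ) =
    gen .chiral .d * gen .anti .d := by
  simpa [gen] using! (rel (ORel.link_d_dp (q := q) (q' := q') (ℓ := ℓ))).symm

variable (σ : Sector)

lemma b_a : (gen σ .b * gen σ .a : QFA q q' ℓ) =
    (manin q q' σ : k) • (gen σ .a * gen σ .b) := by
  have h := flip_smul (by simp)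
    ((rel (ORel.a_b (q := q) (q' := q') (ℓ := ℓ) σ)).trans (map_smul _ _ _))
  simpa [gen] using! h
lemma c_a : (gen σ .c * gen σ .a : QFA q q' ℓ) =
    (manin q q' σ : k) • (gen σ .a * gen σ .c) := by
  have h := flip_smul (by simp)
    ((rel (ORel.a_c (q := q) (q' := q') (ℓ := ℓ) σ)).trans (map_smul _ _ _))
  simpa [gen] using! h
lemma d_b : (gen σ .d * gen σ .b : QFA q q' ℓ) =
    (manin q q' σ : k) • (gen σ .b * gen σ .d) := by
  have h := flip_smul (by simp)
    ((rel (ORel.b_d (q := q) (q' := q') (ℓ := ℓ) σ)).trans (map_smul _ _ _))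
  simpa [gen] using! h
lemma d_c : (gen σ .d * gen σ .c : QFA q q' ℓ) =
    (manin q q' σ : k) • (gen σ .c * gen σ .d) := by
  have h := flip_smul (by simp)
    ((rel (ORel.c_d (q := q) (q' := q') (ℓ := ℓ) σ)).trans (map_smul _ _ _))
  simpa [gen] using! h
lemma c_b : (gen σ .c * gen σ .b : QFA q q' ℓ) = gen σ .b * gen σ .c := by
  simpa [gen] using! (rel (ORel.b_c (q := q) (q' := q') (ℓ := ℓ) σ)).symm
lemma a_d : (gen σ .a * gen σ .d : QFA q q' ℓ) =
    1 + (manin q q' σ : k)⁻¹ • (gen σ .b * gen σ .c) := by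
  rw [← sub_eq_iff_eq_add]
  simpa [gen] using! rel (ORel.det (q := q) (q' := q') (ℓ := ℓ) σ)
lemma d_a : (gen σ .d * gen σ .a : QFA q q' ℓ) =
    1 + (manin q q' σ : k) • (gen σ .b * gen σ .c) := by
  have h : (gen σ .a * gen σ .d - gen σ .d * gen σ .a : QFA q q' ℓ) =
      ((manin q q' σ : k)⁻¹ - manin q q' σ) • (gen σ .b * gen σ .c) := by
    simpa [gen] using! rel (ORel.a_d (q := q) (q' := q') (ℓ := ℓ) σ)
  rw [a_d, sub_eq_iff_eq_add, sub_smul] at h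
  rw [eq_sub_of_add_eq' h.symm]
  abel

/-- The comultiplication on the generators: matrix multiplication. -/
def comulGen : Sector → OGen → QFA q q' ℓ ⊗[k] QFA q q' ℓ
  | σ, .a => gen σ .a ⊗ₜ gen σ .a + gen σ .b ⊗ₜ gen σ .c
  | σ, .b => gen σ .a ⊗ₜ gen σ .b + gen σ .b ⊗ₜ gen σ .d
  | σ, .c => gen σ .c ⊗ₜ gen σ .a + gen σ .d ⊗ₜ gen σ .c
  | σ, .d => gen σ .c ⊗ₜ gen σ .b + gen σ .d ⊗ₜ gen σ .d

/-- The counit on the generators. -/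
def counitGen : OGen → k
  | .a => 1
  | .b => 0
  | .c => 0
  | .d => 1

/-- The antipode on the generators. -/
def antipodeGen : Sector → OGen → QFA q q' ℓ
  | σ, .a => gen σ .d
  | σ, .b => -((manin q q' σ : k) • gen σ .b)
  | σ, .c => -((manin q q' σ : k)⁻¹ • gen σ .c)
  | σ, .d => gen σ .a

set_option maxHeartbeats 8000000 in
lemma comulGen_rel (x y : FreeAlgebra k (Sector × OGen)) (h : ORel q q' ℓ x y) :
    FreeAlgebra.lift k (fun p : Sector × OGen =>
      (comulGen p.1 p.2 : QFA q q' ℓ ⊗[k] QFA q q' ℓ)) x =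
    FreeAlgebra.lift k (fun p : Sector × OGen => comulGen p.1 p.2) y := by
  have hp : ∀ σ, (manin q q' σ : k) ≠ 0 := fun σ => Units.ne_zero _
  have hl : (ℓ : k) ≠ 0 := Units.ne_zero _
  cases h <;>
    simp [comulGen, mul_add, add_mul, mul_assoc, smul_add, TensorProduct.tmul_smul,
      TensorProduct.tmul_add, TensorProduct.add_tmul, smul_smul, hl, hp,
      Algebra.TensorProduct.one_def, sub_smul, smul_sub, sub_mul, mul_sub, ← TensorProduct.smul_tmul',
      b_a, c_a, d_b, d_c, c_b, d_a, a_d, x_b_a, x_c_a, x_a_b, x_d_b, x_a_c, x_d_c, x_b_d, x_c_d,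
      x_a_a, x_d_a, x_b_b, x_c_b, x_b_c, x_c_c, x_a_d, x_d_d] <;>
    abel

/-- The comultiplication. -/
def comulHom : QFA q q' ℓ →ₐ[k] QFA q q' ℓ ⊗[k] QFA q q' ℓ := lift comulGen comulGen_rel

lemma comulHom_gen (σ : Sector) (x : OGen) :
    comulHom (gen σ x : QFA q q' ℓ) = comulGen σ x := lift_gen _ _ _ _

lemma counitGen_rel (x y : FreeAlgebra k (Sector × OGen)) (h : ORel q q' ℓ x y) :
    FreeAlgebra.lift k (fun p : Sector × OGen => (counitGen p.2 : k)) x =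
    FreeAlgebra.lift k (fun p : Sector × OGen => counitGen p.2) y := by
  cases h <;> simp [counitGen]

/-- The counit. -/
def counitHom : QFA q q' ℓ →ₐ[k] k := lift (fun _ x => counitGen x) counitGen_rel

lemma counitHom_gen (σ : Sector) (x : OGen) :
    counitHom (gen σ x : QFA q q' ℓ) = counitGen x := lift_gen _ _ _ _

instance instBialgebra : Bialgebra k (QFA q q' ℓ) :=
  Bialgebra.ofAlgHom comulHom counitHom
    (hom_ext fun σ x => by
      cases x <;>
      simp [comulHom_gen, comulGen, TensorProduct.add_tmul, TensorProduct.tmul_add] <;> abel)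
    (hom_ext fun σ x => by
      cases x <;> simp [comulHom_gen, comulGen, counitHom_gen, counitGen])
    (hom_ext fun σ x => by
      cases x <;> simp [comulHom_gen, comulGen, counitHom_gen, counitGen])

lemma comul_gen (σ : Sector) (x : OGen) :
    Coalgebra.comul (R := k) (gen σ x : QFA q q' ℓ) = comulGen σ x := comulHom_gen σ x

lemma counit_gen (σ : Sector) (x : OGen) :
    Coalgebra.counit (R := k) (gen σ x : QFA q q' ℓ) = counitGen x := counitHom_gen σ x

set_option maxHeartbeats 8000000 in
lemma antipodeGen_rel (x y : FreeAlgebra k (Sector × OGen)) (h : ORel q q' ℓ x y) :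
    FreeAlgebra.lift k (fun p : Sector × OGen =>
      MulOpposite.op (antipodeGen p.1 p.2 : QFA q q' ℓ)) x =
    FreeAlgebra.lift k (fun p : Sector × OGen => MulOpposite.op (antipodeGen p.1 p.2)) y := by
  have hp : ∀ σ, (manin q q' σ : k) ≠ 0 := fun σ => Units.ne_zero _
  have hl : (ℓ : k) ≠ 0 := Units.ne_zero _
  apply MulOpposite.unop_injective
  cases h <;>
    simp [antipodeGen, smul_smul, hl, hp, sub_smul,
      b_a, c_a, d_b, d_c, c_b, d_a, a_d, x_b_a, x_c_a, x_a_b, x_d_b, x_a_c, x_d_c, x_b_d, x_c_d,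
      x_a_a, x_d_a, x_b_b, x_c_b, x_b_c, x_c_c, x_a_d, x_d_d] <;>
    congr 1 <;> field_simp

/-- The antipode as an anti-homomorphism. -/
def antipodeHom : QFA q q' ℓ →ₐ[k] (QFA q q' ℓ)ᵐᵒᵖ :=
  lift (fun σ x => MulOpposite.op (antipodeGen σ x)) antipodeGen_rel

lemma antipodeHom_gen (σ : Sector) (x : OGen) :
    ofAnti antipodeHom (gen σ x : QFA q q' ℓ) = antipodeGen σ x := by
  rw [ofAnti_apply, antipodeHom, lift_gen, MulOpposite.unop_op]

instance instHopfAlgebra : HopfAlgebra k (QFA q q' ℓ) where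
  antipode := ofAnti antipodeHom
  mul_antipode_rTensor_comul := by
    have hp : ∀ σ, (manin q q' σ : k) ≠ 0 := fun σ => Units.ne_zero _
    ext x
    simp only [LinearMap.comp_apply, Algebra.linearMap_apply]
    induction x using induction with
    | hc c => simp [ofAnti_algebraMap, ofAnti_one]
    | hg σ x =>
      rw [comul_gen, counit_gen]
      cases x <;>
      simp [comulGen, counitGen, antipodeHom_gen, antipodeGen, smul_smul, hp,
        b_a, c_a, d_b, d_c, c_b, a_d, d_a]
    | hm x y h1 h2 => exact antipode_right_mul _ h1 h2
    | ha x y h1 h2 => rw [map_add, map_add, map_add, map_add, map_add, h1, h2]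
  mul_antipode_lTensor_comul := by
    have hp : ∀ σ, (manin q q' σ : k) ≠ 0 := fun σ => Units.ne_zero _
    ext x
    simp only [LinearMap.comp_apply, Algebra.linearMap_apply]
    induction x using induction with
    | hc c => simp [ofAnti_algebraMap, ofAnti_one]
    | hg σ x =>
      rw [comul_gen, counit_gen]
      cases x <;>
      simp [comulGen, counitGen, antipodeHom_gen, antipodeGen, smul_smul, hp,
        b_a, c_a, d_b, d_c, c_b, a_d, d_a]
    | hm x y h1 h2 => exact antipode_left_mul _ h1 h2
    | ha x y h1 h2 => rw [map_add, map_add, map_add, map_add, map_add, h1, h2]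

end QFA
end QFA

/-! ### Pairings -/

section Pairing

variable {k : Type*} [Field k]

/-- A dual pairing of Hopf algebras: multiplication on either side is dual to comultiplication
on the other, the units are dual to the counits, and the antipodes are dual to each other. -/
structure IsHopfPairing {U O : Type*} [Ring U] [HopfAlgebra k U] [Ring O] [HopfAlgebra k O]
    (B : U →ₗ[k] O →ₗ[k] k) : Prop where
  mul_left (x y : U) (f : O) :
    B (x * y) f = LinearMap.mul' k k (TensorProduct.map (B x) (B y) (Coalgebra.comul f))
  mul_right (x : U) (f g : O) :
    B x (f * g) =
      LinearMap.mul' k k (TensorProduct.map (B.flip f) (B.flip g) (Coalgebra.comul x))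
  one_left (f : O) : B 1 f = Coalgebra.counit f
  one_right (x : U) : B x 1 = Coalgebra.counit x
  antipode (x : U) (f : O) :
    B (HopfAlgebra.antipode k x) f = B x (HopfAlgebra.antipode k f)

/-- The values of a pairing of `x` with the matrix of generators `(a b; c d)` of a sector. -/
def pairMatrix {q q' ℓ : kˣ} {U : Type*} [AddCommGroup U] [Module k U]
    (B : U →ₗ[k] QFA q q' ℓ →ₗ[k] k) (x : U) (σ : Sector) : Matrix (Fin 2) (Fin 2) k :=
  !![B x (QFA.gen σ .a), B x (QFA.gen σ .b); B x (QFA.gen σ .c), B x (QFA.gen σ .d)]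

/-- The prescribed values on generators, with `r = q^{1/2}`, `r' = q'^{1/2}`, `s = ℓ^{1/2}`. -/
structure HasGeneratorValues (r r' s : kˣ)
    (B : QUEA r r' s →ₗ[k] QFA (r ^ 2) (r' ^ 2) (s ^ 2) →ₗ[k] k) : Prop where
  K_chiral : pairMatrix B (QUEA.gen .chiral .K) .chiral = !![(r : k), 0; 0, (r : k)⁻¹]
  K_anti : pairMatrix B (QUEA.gen .chiral .K) .anti = !![1, 0; 0, 1]
  L_chiral : pairMatrix B (QUEA.gen .chiral .L) .chiral = !![(s : k), 0; 0, (s : k)⁻¹]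
  L_anti : pairMatrix B (QUEA.gen .chiral .L) .anti = !![1, 0; 0, 1]
  E_chiral : pairMatrix B (QUEA.gen .chiral .E) .chiral = !![0, 1; 0, 0]
  E_anti : pairMatrix B (QUEA.gen .chiral .E) .anti = 0
  F_chiral : pairMatrix B (QUEA.gen .chiral .F) .chiral = !![0, 0; 1, 0]
  F_anti : pairMatrix B (QUEA.gen .chiral .F) .anti = 0
  K'_chiral : pairMatrix B (QUEA.gen .anti .K) .chiral = !![1, 0; 0, 1]
  K'_anti : pairMatrix B (QUEA.gen .anti .K) .anti = !![(r' : k)⁻¹, 0; 0, (r' : k)]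
  L'_chiral : pairMatrix B (QUEA.gen .anti .L) .chiral = !![1, 0; 0, 1]
  L'_anti : pairMatrix B (QUEA.gen .anti .L) .anti = !![(s : k)⁻¹, 0; 0, (s : k)]
  E'_chiral : pairMatrix B (QUEA.gen .anti .E) .chiral = 0
  E'_anti : pairMatrix B (QUEA.gen .anti .E) .anti = !![0, 0; 1, 0]
  F'_chiral : pairMatrix B (QUEA.gen .anti .F) .chiral = 0
  F'_anti : pairMatrix B (QUEA.gen .anti .F) .anti = !![0, 1; 0, 0]

end Pairing

end QLinked

end

noncomputable section
namespace QLinked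
open Coalgebra

/-! Existence. Each sector gives a two-dimensional vector representation of `U`, on which the other
sector acts through the counit. A pairing that turns products of functions into coproducts in `U` is
an algebra map from `F` to the dual of `U` with its convolution product (`pairHom`), and the
generators are sent to the matrix coefficients of the vector representations. The relations of `F`
are facts about tensor products of two such representations. In the square of one, the quantum
determinant vector is invariant both as a column and as a row; the two invariances contain all Manin
relations and determinant one (`repTwo_mulVec_detVec`, `detVec_vecMul_repTwo`). The two orders of
the mixed product are isomorphic by the flip and a diagonal matrix with entries `1` and `ℓ`, which
gives the link relations (`repTwo_cross`). The law for products in `U` holds on generators of `F`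
because the coefficients come from a representation, and it passes to products (`mul_left_of_mul`).
The antipode law is then automatic, by uniqueness of convolution inverses (`antipode_of_mul`).

Uniqueness. The values of a Hopf pairing on a matrix of generators form a representation of `U`,
which is determined by its values on generators; products in `F` are then determined through the
coproduct of `U`.

Perfectness. `U` is spanned by the monomials `e₊^i t e₋^j` with `t` in the Cartan group
(`monSpan_eq_top`), and `F` by words consisting of a diagonal power with exponent `N`, then powers
`m`, `l` of the off-diagonal entries (`span_word_eq_top`). The pairing of the two is a constant
times the character of `t` with exponent `N - i - j`; the constant vanishes unless `m ≤ i` and `l ≤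
j`, and is nonzero if `m = i` and `l = j` (`hasType_word`). So the pairing is block triangular, and
its diagonal blocks are, up to nonzero factors, tables of values of characters. Distinct Cartan
elements have distinct weights by the exponential rule, and distinct exponents give distinct
characters because `q` and `q'` have infinite order. Dedekind's independence of characters, used on
either side, makes the rows and the columns of each block independent, and elimination from a
maximal index finishes (`eq_zero_of_triangular`). Only spanning is needed beforehand; independence
of the monomials is a by-product. -/

instance : DecidableEq Sector
  | .chiral, .chiral => isTrue rfl
  | .anti, .anti => isTrue rfl
  | .chiral, .anti => isFalse Sector.noConfusion
  | .anti, .chiral => isFalse Sector.noConfusion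

/-- The sector different from the given one. -/
def Sector.other : Sector → Sector
  | .chiral => .anti
  | .anti => .chiral

variable {k : Type*} [Field k] {r r' s : kˣ}

/-- Neither `q = r²` nor `q' = r'²` is a root of unity. -/
def Generic (r r' : kˣ) : Prop := ∀ σ n, 0 < n → (root r r' σ ^ 2) ^ n ≠ 1

/-- The parameter `s^{±1}` that a sector puts on the other one. -/
def link (s : kˣ) : Sector → kˣ
  | .chiral => s
  | .anti => s⁻¹

/-! ### The vector representations and the coactions that they induce -/

namespace QUEA

/-- The group-like element of the opposite sector that occurs in the coproduct of `e₊`. -/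
def tw : Sector → QUEA r r' s
  | .chiral => gen .anti .L
  | .anti => gen .chiral .Linv

/-- The inverse of `tw`. -/
def twInv : Sector → QUEA r r' s
  | .chiral => gen .anti .Linv
  | .anti => gen .chiral .L

lemma comul_E (σ : Sector) : comul (R := k) (gen σ .E : QUEA r r' s) =
    gen σ .E ⊗ₜ (gen σ .K * tw σ) + (gen σ .Kinv * twInv σ) ⊗ₜ gen σ .E := by
  cases σ <;> rw [comul_gen] <;> rfl

lemma comul_F (σ : Sector) : comul (R := k) (gen σ .F : QUEA r r' s) =
    gen σ .F ⊗ₜ (gen σ .K * twInv σ) + (gen σ .Kinv * tw σ) ⊗ₜ gen σ .F := by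
  cases σ <;> rw [comul_gen] <;> rfl

lemma comul_K (σ : Sector) : comul (R := k) (gen σ .K : QUEA r r' s) = gen σ .K ⊗ₜ gen σ .K := by
  cases σ <;> exact comul_gen _ _
lemma comul_Kinv (σ : Sector) :
    comul (R := k) (gen σ .Kinv : QUEA r r' s) = gen σ .Kinv ⊗ₜ gen σ .Kinv := by
  cases σ <;> exact comul_gen _ _
lemma comul_L (σ : Sector) : comul (R := k) (gen σ .L : QUEA r r' s) = gen σ .L ⊗ₜ gen σ .L := by
  cases σ <;> exact comul_gen _ _
lemma comul_Linv (σ : Sector) :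
    comul (R := k) (gen σ .Linv : QUEA r r' s) = gen σ .Linv ⊗ₜ gen σ .Linv := by
  cases σ <;> exact comul_gen _ _

/-- The vector representation of a single sector, with `p = q^{1/2}`. -/
def vecGen (p s : kˣ) : UGen → Matrix (Fin 2) (Fin 2) k
  | .K => !![(p : k), 0; 0, (p : k)⁻¹]
  | .Kinv => !![(p : k)⁻¹, 0; 0, (p : k)]
  | .L => !![(s : k), 0; 0, (s : k)⁻¹]
  | .Linv => !![(s : k)⁻¹, 0; 0, (s : k)]
  | .E => !![0, 1; 0, 0]
  | .F => !![0, 0; 1, 0]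

/-- The vector representation of the sector `σ` on the generators of the sector `τ`. -/
def repGen (r r' s : kˣ) (σ τ : Sector) (x : UGen) : Matrix (Fin 2) (Fin 2) k :=
  if τ = σ then vecGen (root r r' σ) s x else algebraMap k _ (counitGen x)

/-- If `q = q⁻¹` then `q² = 1`, so the denominator in the commutator of `e₊` and `e₋` is invertible.
-/
lemma root_ne [hg : Fact (Generic r r')] (σ : Sector) :
    (root r r' σ : k) ^ 2 - ((root r r' σ : k) ^ 2)⁻¹ ≠ 0 := by
  intro h
  have h0 : (root r r' σ : k) ≠ 0 := Units.ne_zero _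
  apply hg.out σ 2 two_pos
  ext
  push_cast
  field_simp at h
  linear_combination h

lemma diag_pow (x y : k) (n : ℕ) : (!![x, 0; 0, y] : Matrix (Fin 2) (Fin 2) k) ^ n =
    !![x ^ n, 0; 0, y ^ n] := by
  induction n with
  | zero => simp [Matrix.one_fin_two]
  | succ n ih => simp [pow_succ, ih]

lemma repGen_rel [Fact (Generic r r')] (σ : Sector) (x y : FreeAlgebra k (Sector × UGen))
    (h : URel r r' s x y) :
    FreeAlgebra.lift k (fun p : Sector × UGen => repGen r r' s σ p.1 p.2) x =
    FreeAlgebra.lift k (fun p : Sector × UGen => repGen r r' s σ p.1 p.2) y := by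
  have hr : ∀ σ, (root r r' σ : k) ≠ 0 := fun σ => Units.ne_zero _
  have hs : (s : k) ≠ 0 := Units.ne_zero _
  have hk := root_ne (r := r) (r' := r') σ
  rcases h with τ | τ | τ | τ | τ | ⟨τ, m, n, m', n', h⟩ | τ | τ | τ | τ | τ | ⟨x, y⟩
  pick_goal 12
  · cases σ <;> simp only [map_mul, FreeAlgebra.lift_ι_apply, repGen, reduceCtorEq, if_true,
      if_false, Algebra.commutes]
  all_goals
    by_cases hτ : τ = σ
    swap
    · simp [repGen, hτ, counitGen]
    subst hτ
  pick_goal 6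
  · have h1 : (root r r' τ : k) ^ m * (s : k) ^ n = (root r r' τ : k) ^ m' * (s : k) ^ n' :=
      mod_cast congrArg Units.val h
    -- The second diagonal entry carries the inverse weight, so the exponential rule is needed for
    -- the inverses too.
    have h2 := congrArg (·⁻¹) h1
    simp only [mul_inv] at h2
    simp [repGen, vecGen, diag_pow, h1, h2]
  pick_goal 10
  · simp [repGen, vecGen, diag_pow]
    -- This is `q - q⁻¹` with its denominator cleared, the form in which `field_simp` meets it.
    have hk' : (root r r' τ : k) ^ 4 - 1 ≠ 0 := by
      intro h0
      apply hk
      field_simp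
      linear_combination h0
    constructor
    · field_simp
    · field_simp
      ring
  all_goals simp [repGen, vecGen, hr, hs, Matrix.one_fin_two, mul_comm, pow_two]

/-- The vector representation of the sector `σ`. -/
def rep [Fact (Generic r r')] (σ : Sector) : QUEA r r' s →ₐ[k] Matrix (Fin 2) (Fin 2) k :=
  lift (repGen r r' s σ) (repGen_rel σ)

variable [Fact (Generic r r')]

lemma rep_gen (σ τ : Sector) (x : UGen) :
    rep σ (gen τ x : QUEA r r' s) = repGen r r' s σ τ x := lift_gen _ _ _ _

/-- The coproduct followed by the vector representation of `σ` on the second factor. -/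
def coact (σ : Sector) : QUEA r r' s →ₐ[k] Matrix (Fin 2) (Fin 2) (QUEA r r' s) :=
  ((matrixEquivTensor (Fin 2) k (QUEA r r' s)).symm : _ →ₐ[k] _).comp
    ((Algebra.TensorProduct.map (AlgHom.id k _) (rep σ)).comp (Bialgebra.comulAlgHom k _))

lemma coact_apply (σ : Sector) (x : QUEA r r' s) :
    coact σ x = (matrixEquivTensor (Fin 2) k (QUEA r r' s)).symm
      (TensorProduct.map LinearMap.id (rep σ).toLinearMap (comul x)) := rfl

/-- An entry is `∑ ρ(x₍₂₎)ᵢⱼ x₍₁₎`. As a linear map applied to the coproduct it can be read off from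
any expression of the latter by pure tensors. -/
lemma coact_apply_apply (σ : Sector) (x : QUEA r r' s) (i j : Fin 2) :
    coact σ x i j = TensorProduct.lift ((LinearMap.lsmul k (QUEA r r' s)).flip.compl₂
      (Matrix.entryLinearMap k k i j ∘ₗ (rep σ).toLinearMap)) (comul x) := by
  rw [coact_apply]
  induction comul (R := k) x with
  | zero => simp
  | add a b h1 h2 => simp only [map_add, Matrix.add_apply, h1, h2]
  | tmul a b =>
    simp [matrixEquivTensor_apply_symm, Algebra.smul_def, Algebra.commutes]

lemma coact_groupLike {x : QUEA r r' s} (h : comul (R := k) x = x ⊗ₜ x) (σ : Sector) :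
    coact σ x = Matrix.of fun i j => rep σ x i j • x := by
  ext i j
  rw [coact_apply_apply, h]
  simp

lemma coact_E (σ : Sector) : coact σ (gen σ .E : QUEA r r' s) =
    !![(root r r' σ : k) • gen σ .E, gen σ .Kinv * twInv σ; 0,
      (root r r' σ : k)⁻¹ • gen σ .E] := by
  ext i j
  rw [coact_apply_apply, comul_E]
  cases σ <;> fin_cases i <;> fin_cases j <;>
    simp [rep_gen, repGen, tw, vecGen, counitGen]

lemma coact_F (σ : Sector) : coact σ (gen σ .F : QUEA r r' s) =
    !![(root r r' σ : k) • gen σ .F, 0; gen σ .Kinv * tw σ,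
      (root r r' σ : k)⁻¹ • gen σ .F] := by
  ext i j
  rw [coact_apply_apply, comul_F]
  cases σ <;> fin_cases i <;> fin_cases j <;>
    simp [rep_gen, repGen, twInv, vecGen, counitGen]

/-- The vector representation kills the generators of the other sector, so one term of the coproduct
survives; in it, the twisting factor acts by powers of `s`. This is how `ℓ` enters the link
relations. -/
lemma coact_E_other (σ : Sector) : coact σ (gen σ.other .E : QUEA r r' s) =
    !![(link s σ.other : k) • gen σ.other .E, 0; 0, (link s σ.other : k)⁻¹ • gen σ.other .E] := by
  ext i j
  rw [coact_apply_apply, comul_E]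
  cases σ <;> fin_cases i <;> fin_cases j <;>
    simp [rep_gen, repGen, tw, vecGen, counitGen, Sector.other, link]

lemma coact_F_other (σ : Sector) : coact σ (gen σ.other .F : QUEA r r' s) =
    !![(link s σ.other : k)⁻¹ • gen σ.other .F, 0; 0, (link s σ.other : k) • gen σ.other .F] := by
  ext i j
  rw [coact_apply_apply, comul_F]
  cases σ <;> fin_cases i <;> fin_cases j <;>
    simp [rep_gen, repGen, twInv, vecGen, counitGen, Sector.other, link]

end QUEA

/-! ### Tensor products of two vector representations -/

namespace QUEA
variable [Fact (Generic r r')]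

/-- The tensor product of the vector representations of `σ` and `τ`; in the index pairs the
factor `τ` comes first. -/
def repTwo (σ τ : Sector) : QUEA r r' s →ₐ[k] Matrix (Fin 2 × Fin 2) (Fin 2 × Fin 2) k :=
  ((Matrix.compAlgEquiv (Fin 2) (Fin 2) k k : _ →ₐ[k] _).comp (rep σ).mapMatrix).comp (coact τ)

lemma repTwo_apply (σ τ : Sector) (x : QUEA r r' s) (i j l m : Fin 2) :
    repTwo σ τ x (l, i) (m, j) = rep σ (coact τ x l m) i j := rfl

/-- The vector spanning the trivial submodule of the tensor square of a vector representation. -/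
def detVec (r r' : kˣ) (σ : Sector) (p : Fin 2 × Fin 2) : k :=
  if p = (1, 0) then 1 else if p = (0, 1) then -((root r r' σ : k) ^ 2)⁻¹ else 0

/-- This table reduces invariance of the determinant vector and the exchange of the two sectors to
finite checks on generators. -/
lemma repTwo_gen (σ τ υ : Sector) (x : UGen) (i j l m : Fin 2) :
    repTwo σ τ (gen υ x : QUEA r r' s) (l, i) (m, j) =
      match x with
      | .E => if υ = τ then
            (!![(root r r' τ : k) • repGen r r' s σ υ .E,
                repGen r r' s σ υ .Kinv * rep σ (twInv υ : QUEA r r' s);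
              0, (root r r' τ : k)⁻¹ • repGen r r' s σ υ .E] : Matrix _ _ (Matrix _ _ k)) l m i j
          else (!![(link s υ : k) • repGen r r' s σ υ .E, 0;
              0, (link s υ : k)⁻¹ • repGen r r' s σ υ .E] : Matrix _ _ (Matrix _ _ k)) l m i j
      | .F => if υ = τ then
            (!![(root r r' τ : k) • repGen r r' s σ υ .F, 0;
                repGen r r' s σ υ .Kinv * rep σ (tw υ : QUEA r r' s),
              (root r r' τ : k)⁻¹ • repGen r r' s σ υ .F] : Matrix _ _ (Matrix _ _ k)) l m i j
          else (!![(link s υ : k)⁻¹ • repGen r r' s σ υ .F, 0;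
              0, (link s υ : k) • repGen r r' s σ υ .F] : Matrix _ _ (Matrix _ _ k)) l m i j
      | y => repGen r r' s τ υ y l m * repGen r r' s σ υ y i j := by
  rw [repTwo_apply]
  cases x
  · simp [coact_groupLike (comul_K υ), rep_gen]
  · simp [coact_groupLike (comul_Kinv υ), rep_gen]
  · simp [coact_groupLike (comul_L υ), rep_gen]
  · simp [coact_groupLike (comul_Linv υ), rep_gen]
  · by_cases h : υ = τ
    · subst h
      rw [coact_E]
      fin_cases l <;> fin_cases m <;> simp [rep_gen]
    · obtain rfl : υ = τ.other := by cases υ <;> cases τ <;> simp_all [Sector.other]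
      rw [coact_E_other]
      fin_cases l <;> fin_cases m <;> simp [rep_gen, h]
  · by_cases h : υ = τ
    · subst h
      rw [coact_F]
      fin_cases l <;> fin_cases m <;> simp [rep_gen]
    · obtain rfl : υ = τ.other := by cases υ <;> cases τ <;> simp_all [Sector.other]
      rw [coact_F_other]
      fin_cases l <;> fin_cases m <;> simp [rep_gen, h]

/-- Both sides are compatible with products in `x`, so the invariance need only be checked on
generators. -/
lemma repTwo_mulVec_detVec (σ : Sector) (x : QUEA r r' s) :
    (repTwo σ σ x).mulVec (detVec r r' σ) = (counit x : k) • detVec r r' σ := by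
  have hr : (root r r' σ : k) ≠ 0 := Units.ne_zero _
  have hs : (s : k) ≠ 0 := Units.ne_zero _
  induction x using induction with
  | hc c =>
    rw [AlgHom.commutes, Algebra.algebraMap_eq_smul_one, Matrix.smul_mulVec, Matrix.one_mulVec]
    simp
  | hg υ x =>
    ext ⟨l, i⟩
    rw [counit_gen]
    simp only [Matrix.mulVec, dotProduct, Fintype.sum_prod_type, Fin.sum_univ_two, repTwo_gen]
    by_cases h : υ = σ
    · subst h
      cases υ <;> cases x <;> fin_cases l <;> fin_cases i <;>
        simp [repGen, vecGen, detVec, counitGen, tw, twInv, rep_gen, hr, hs] <;> field_simp <;>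
        try ring
    · cases x <;> fin_cases l <;> fin_cases i <;>
        simp [h, repGen, detVec, counitGen]
  | hm x y hx hy =>
    rw [map_mul, ← Matrix.mulVec_mulVec, hy, Matrix.mulVec_smul, hx, smul_smul,
      Bialgebra.counit_mul, mul_comm]
  | ha x y hx hy => rw [map_add, Matrix.add_mulVec, hx, hy, map_add, add_smul]

lemma detVec_vecMul_repTwo (σ : Sector) (x : QUEA r r' s) :
    Matrix.vecMul (detVec r r' σ) (repTwo σ σ x) = (counit x : k) • detVec r r' σ := by
  have hr : (root r r' σ : k) ≠ 0 := Units.ne_zero _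
  have hs : (s : k) ≠ 0 := Units.ne_zero _
  induction x using induction with
  | hc c =>
    rw [AlgHom.commutes, Algebra.algebraMap_eq_smul_one, Matrix.vecMul_smul, Matrix.vecMul_one]
    simp
  | hg υ x =>
    ext ⟨l, i⟩
    rw [counit_gen]
    simp only [Matrix.vecMul, dotProduct, Fintype.sum_prod_type, Fin.sum_univ_two, repTwo_gen]
    by_cases h : υ = σ
    · subst h
      cases υ <;> cases x <;> fin_cases l <;> fin_cases i <;>
        simp [repGen, vecGen, detVec, counitGen, tw, twInv, rep_gen, hr, hs] <;> field_simp <;>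
        try ring
    · cases x <;> fin_cases l <;> fin_cases i <;>
        simp [h, repGen, detVec, counitGen]
  | hm x y hx hy =>
    rw [map_mul, ← Matrix.vecMul_vecMul, hx, Matrix.smul_vecMul, hy, smul_smul,
      Bialgebra.counit_mul]
  | ha x y hx hy => rw [map_add, Matrix.vecMul_add, hx, hy, map_add, add_smul]

/-- The diagonal gauge relating the two orders of the vector representations. -/
def gauge (s : kˣ) (p : Fin 2 × Fin 2) : k := if p.1 = p.2 then (s : k) ^ 2 else 1

/-- The plain flip does not intertwine the two orders, since `e_±` acquires different powers of `s`
from its position to the left or to the right of the other sector. Rescaling the basis vectors by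
`gauge` absorbs the difference, which again need only be checked on generators. -/
lemma repTwo_cross (x : QUEA r r' s) :
    repTwo .chiral .anti x * Matrix.diagonal (gauge s) = Matrix.diagonal (gauge s) *
      (Matrix.reindexAlgEquiv k k (Equiv.prodComm (Fin 2) (Fin 2)) (repTwo .anti .chiral x)) := by
  induction x using induction with
  | hc c =>
    rw [AlgHom.commutes, AlgHom.commutes, AlgEquiv.commutes, Algebra.commutes]
  | hg υ x =>
    ext ⟨l, i⟩ ⟨m, j⟩
    simp only [Matrix.mul_diagonal, Matrix.diagonal_mul, Matrix.coe_reindexAlgEquiv,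
      Matrix.reindex_apply, Matrix.submatrix_apply, Equiv.prodComm_symm, Equiv.prodComm_apply,
      Prod.swap_prod_mk, repTwo_gen]
    cases υ <;> cases x <;> fin_cases l <;> fin_cases i <;> fin_cases m <;> fin_cases j <;>
      simp [repGen, vecGen, gauge, counitGen, tw, twInv, rep_gen, link] <;> field_simp
  | hm x y hx hy =>
    rw [map_mul, mul_assoc, hy, ← mul_assoc, hx, mul_assoc, ← map_mul, ← map_mul]
  | ha x y hx hy => rw [map_add, add_mul, hx, hy, map_add, map_add, mul_add]

end QUEA

/-! ### Relations between matrix coefficients in the convolution algebra -/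

namespace QUEA
variable [Fact (Generic r r')]

/-- The matrix coefficients of the vector representation, in the convolution algebra. -/
def coef (σ : Sector) (i j : Fin 2) : WithConv (QUEA r r' s →ₗ[k] k) :=
  .toConv (Matrix.entryLinearMap k k i j ∘ₗ (rep σ).toLinearMap)

lemma coef_apply (σ : Sector) (i j : Fin 2) (x : QUEA r r' s) :
    (coef σ i j).ofConv x = rep σ x i j := rfl

/-- Right multiplication by a coefficient is the transpose of an entry of `coact`. The relations of
`F` and the later evaluation on monomials both rest on this. -/
lemma mul_coef_apply (g : WithConv (QUEA r r' s →ₗ[k] k)) (σ : Sector) (i j : Fin 2)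
    (x : QUEA r r' s) : (g * coef σ i j).ofConv x = g.ofConv (coact σ x i j) := by
  change LinearMap.mul' k k (TensorProduct.map g.ofConv (coef σ i j).ofConv (comul x)) = _
  rw [coact_apply_apply]
  induction comul (R := k) x with
  | zero => simp
  | add a b h1 h2 => simp only [map_add, h1, h2]
  | tmul a b => simp [coef, mul_comm]

lemma coef_mul_coef_apply (σ τ : Sector) (i j l m : Fin 2) (x : QUEA r r' s) :
    (coef σ i j * coef τ l m : WithConv (QUEA r r' s →ₗ[k] k)).ofConv x =
      repTwo σ τ x (l, i) (m, j) := mul_coef_apply _ _ _ _ _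

/-- One coordinate of the invariance of the determinant column; `coef_col` comes likewise from the
row. -/
lemma coef_row (σ : Sector) (i l : Fin 2) :
    (coef σ i 0 * coef σ l 1 : WithConv (QUEA r r' s →ₗ[k] k)) -
      ((root r r' σ : k) ^ 2)⁻¹ • (coef σ i 1 * coef σ l 0) = algebraMap k _ (detVec r r' σ (l, i)) := by
  ext x
  have h := congrFun (repTwo_mulVec_detVec σ x) (l, i)
  simp only [Matrix.mulVec, dotProduct, Fintype.sum_prod_type, Fin.sum_univ_two,
    ← coef_mul_coef_apply, Pi.smul_apply, smul_eq_mul] at h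
  simp only [detVec, Prod.mk.injEq, zero_ne_one, one_ne_zero, and_true, and_false, and_self, if_true,
    if_false] at h ⊢
  simp only [WithConv.ofConv_sub, WithConv.ofConv_smul, LinearMap.sub_apply, LinearMap.smul_apply,
    smul_eq_mul, LinearMap.convAlgebraMap_apply, Algebra.algebraMap_self, RingHom.id_apply]
  linear_combination h

lemma coef_col (σ : Sector) (j m : Fin 2) :
    (coef σ 0 j * coef σ 1 m : WithConv (QUEA r r' s →ₗ[k] k)) -
      ((root r r' σ : k) ^ 2)⁻¹ • (coef σ 1 j * coef σ 0 m) = algebraMap k _ (detVec r r' σ (m, j)) := by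
  ext x
  have h := congrFun (detVec_vecMul_repTwo σ x) (m, j)
  simp only [Matrix.vecMul, dotProduct, Fintype.sum_prod_type, Fin.sum_univ_two,
    ← coef_mul_coef_apply, Pi.smul_apply, smul_eq_mul] at h
  simp only [detVec, Prod.mk.injEq, zero_ne_one, one_ne_zero, and_true, and_false, and_self, if_true,
    if_false] at h ⊢
  simp only [WithConv.ofConv_sub, WithConv.ofConv_smul, LinearMap.sub_apply, LinearMap.smul_apply,
    smul_eq_mul, LinearMap.convAlgebraMap_apply, Algebra.algebraMap_self, RingHom.id_apply]
  linear_combination h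

lemma coef_cross (i j l m : Fin 2) :
    gauge s (m, j) • (coef .chiral i j * coef .anti l m : WithConv (QUEA r r' s →ₗ[k] k)) =
      gauge s (l, i) • (coef .anti l m * coef .chiral i j) := by
  ext x
  have h := congrFun (congrFun (repTwo_cross x) (l, i)) (m, j)
  simp only [Matrix.mul_diagonal, Matrix.diagonal_mul, Matrix.coe_reindexAlgEquiv,
    Matrix.reindex_apply, Matrix.submatrix_apply, Equiv.prodComm_symm, Equiv.prodComm_apply,
    Prod.swap_prod_mk, ← coef_mul_coef_apply] at h
  simp only [WithConv.ofConv_smul, LinearMap.smul_apply, smul_eq_mul]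
  linear_combination h

variable (σ : Sector)

lemma coef_AB : (coef σ 0 0 * coef σ 0 1 : WithConv (QUEA r r' s →ₗ[k] k)) =
    ((root r r' σ : k) ^ 2)⁻¹ • (coef σ 0 1 * coef σ 0 0) := by
  simpa [sub_eq_zero, detVec] using coef_row (s := s) (r := r) (r' := r') σ 0 0
lemma coef_CD : (coef σ 1 0 * coef σ 1 1 : WithConv (QUEA r r' s →ₗ[k] k)) =
    ((root r r' σ : k) ^ 2)⁻¹ • (coef σ 1 1 * coef σ 1 0) := by
  simpa [sub_eq_zero, detVec] using coef_row (s := s) (r := r) (r' := r') σ 1 1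
lemma coef_AC : (coef σ 0 0 * coef σ 1 0 : WithConv (QUEA r r' s →ₗ[k] k)) =
    ((root r r' σ : k) ^ 2)⁻¹ • (coef σ 1 0 * coef σ 0 0) := by
  simpa [sub_eq_zero, detVec] using coef_col (s := s) (r := r) (r' := r') σ 0 0
lemma coef_BD : (coef σ 0 1 * coef σ 1 1 : WithConv (QUEA r r' s →ₗ[k] k)) =
    ((root r r' σ : k) ^ 2)⁻¹ • (coef σ 1 1 * coef σ 0 1) := by
  simpa [sub_eq_zero, detVec] using coef_col (s := s) (r := r) (r' := r') σ 1 1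
lemma coef_AD : (coef σ 0 0 * coef σ 1 1 : WithConv (QUEA r r' s →ₗ[k] k)) =
    1 + ((root r r' σ : k) ^ 2)⁻¹ • (coef σ 0 1 * coef σ 1 0) := by
  simpa [sub_eq_iff_eq_add, detVec] using coef_row (s := s) (r := r) (r' := r') σ 0 1
lemma coef_CB : (coef σ 1 0 * coef σ 0 1 : WithConv (QUEA r r' s →ₗ[k] k)) =
    coef σ 0 1 * coef σ 1 0 := by
  have h : (coef σ 0 0 * coef σ 1 1 : WithConv (QUEA r r' s →ₗ[k] k)) =
      1 + ((root r r' σ : k) ^ 2)⁻¹ • (coef σ 1 0 * coef σ 0 1) := by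
    simpa [sub_eq_iff_eq_add, detVec] using coef_col (s := s) (r := r) (r' := r') σ 0 1
  rw [coef_AD, add_right_inj] at h
  exact (smul_right_injective _ (by simp) h).symm
lemma coef_DA : (coef σ 1 1 * coef σ 0 0 : WithConv (QUEA r r' s →ₗ[k] k)) =
    1 + ((root r r' σ : k) ^ 2) • (coef σ 0 1 * coef σ 1 0) := by
  have h := coef_row (s := s) (r := r) (r' := r') σ 1 0
  have h2 := congrArg (fun t => ((root r r' σ : k) ^ 2) • t) h
  rw [coef_CB] at h2
  simp [detVec, smul_sub, smul_smul, Algebra.algebraMap_eq_smul_one] at h2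
  rw [sub_eq_iff_eq_add] at h2
  rw [h2]
  abel

/-- The images of the generators of the function algebra in the dual of the enveloping algebra. -/
def coefGen : Sector → OGen → WithConv (QUEA r r' s →ₗ[k] k)
  | .chiral, .a => coef .chiral 0 0
  | .chiral, .b => coef .chiral 0 1
  | .chiral, .c => coef .chiral 1 0
  | .chiral, .d => coef .chiral 1 1
  | .anti, .d => coef .anti 0 0
  | .anti, .c => coef .anti 0 1
  | .anti, .b => coef .anti 1 0
  | .anti, .a => coef .anti 1 1

/-- Relations within a sector come from the invariant determinant vector. Reversing rows and columns
replaces the Manin parameter by its inverse, which accounts for `1/q'` in the antichiral sector.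
Each link relation is an instance of `coef_cross`, with a scalar `ℓ` left over when exactly one of
the two gauge factors is `ℓ`. -/
lemma coefGen_rel (x y : FreeAlgebra k (Sector × OGen)) (h : ORel (r ^ 2) (r' ^ 2) (s ^ 2) x y) :
    FreeAlgebra.lift k (fun p : Sector × OGen =>
      (coefGen p.1 p.2 : WithConv (QUEA r r' s →ₗ[k] k))) x =
    FreeAlgebra.lift k (fun p : Sector × OGen => coefGen p.1 p.2) y := by
  have hs : (s : k) ≠ 0 := Units.ne_zero _
  have hr' : (r' : k) ≠ 0 := Units.ne_zero _
  rcases h with σ | σ | σ | σ | σ | σ | σ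
  all_goals try
    cases σ <;> simp [coefGen, manin, coef_AB, coef_AC, coef_BD, coef_CD, coef_CB, coef_AD, coef_DA,
      root, smul_smul, hr', sub_smul]
  · simpa [gauge, coefGen] using (coef_cross (r := r) (r' := r') (s := s) 0 0 1 0).symm
  · simpa [gauge, coefGen] using (coef_cross (r := r) (r' := r') (s := s) 0 0 0 1)
  · simpa [gauge, coefGen] using (coef_cross (r := r) (r' := r') (s := s) 0 1 1 1).symm
  · simpa [gauge, coefGen] using (coef_cross (r := r) (r' := r') (s := s) 0 1 0 0)
  · simpa [gauge, coefGen] using (coef_cross (r := r) (r' := r') (s := s) 1 0 1 1)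
  · simpa [gauge, coefGen] using (coef_cross (r := r) (r' := r') (s := s) 1 0 0 0).symm
  · simpa [gauge, coefGen] using (coef_cross (r := r) (r' := r') (s := s) 1 1 1 0)
  · simpa [gauge, coefGen] using (coef_cross (r := r) (r' := r') (s := s) 1 1 0 1).symm
  · simpa [gauge, coefGen, smul_right_inj, hs] using (coef_cross (r := r) (r' := r') (s := s) 0 0 1 1)
  · simpa [gauge, coefGen, smul_right_inj, hs] using (coef_cross (r := r) (r' := r') (s := s) 0 0 0 0)
  · simpa [gauge, coefGen, smul_right_inj, hs] using (coef_cross (r := r) (r' := r') (s := s) 0 1 1 0)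
  · simpa [gauge, coefGen, smul_right_inj, hs] using (coef_cross (r := r) (r' := r') (s := s) 0 1 0 1)
  · simpa [gauge, coefGen, smul_right_inj, hs] using (coef_cross (r := r) (r' := r') (s := s) 1 0 1 0)
  · simpa [gauge, coefGen, smul_right_inj, hs] using (coef_cross (r := r) (r' := r') (s := s) 1 0 0 1)
  · simpa [gauge, coefGen, smul_right_inj, hs] using (coef_cross (r := r) (r' := r') (s := s) 1 1 1 1)
  · simpa [gauge, coefGen, smul_right_inj, hs] using (coef_cross (r := r) (r' := r') (s := s) 1 1 0 0)

end QUEA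

/-! ### Consequences of multiplicativity for a pairing of bialgebras or Hopf algebras -/

section DualPairing

variable {U O : Type*} [Ring U] [Ring O]

/-- Both coproducts are multiplicative, so expanding `⟨xy, fg⟩` in either order gives the same
fourfold sum. Hence the law for products in `U` need only be checked on generators of `O`. -/
lemma mul_left_of_mul [Bialgebra k U] [Bialgebra k O] {B : U →ₗ[k] O →ₗ[k] k}
    (hB : ∀ x f g, B x (f * g) =
      LinearMap.mul' k k (TensorProduct.map (B.flip f) (B.flip g) (comul x))) {f g : O}
    (hf : ∀ x y, B (x * y) f = LinearMap.mul' k k (TensorProduct.map (B x) (B y) (comul f)))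
    (hg : ∀ x y, B (x * y) g = LinearMap.mul' k k (TensorProduct.map (B x) (B y) (comul g)))
    (x y : U) :
    B (x * y) (f * g) = LinearMap.mul' k k (TensorProduct.map (B x) (B y) (comul (f * g))) := by
  have ef := (ℛ k f).eq
  have eg := (ℛ k g).eq
  have ex := (ℛ k x).eq
  have ey := (ℛ k y).eq
  have hxr : ∀ u v, B x (u * v) = ∑ i ∈ (ℛ k x).index,
      B ((ℛ k x).left i) u * B ((ℛ k x).right i) v := by
    intro u v; rw [hB, ← ex]; simp
  have hyr : ∀ u v, B y (u * v) = ∑ i ∈ (ℛ k y).index,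
      B ((ℛ k y).left i) u * B ((ℛ k y).right i) v := by
    intro u v; rw [hB, ← ey]; simp
  have hfl : ∀ u v, B (u * v) f = ∑ a ∈ (ℛ k f).index,
      B u ((ℛ k f).left a) * B v ((ℛ k f).right a) := by
    intro u v; rw [hf, ← ef]; simp
  have hgl : ∀ u v, B (u * v) g = ∑ a ∈ (ℛ k g).index,
      B u ((ℛ k g).left a) * B v ((ℛ k g).right a) := by
    intro u v; rw [hg, ← eg]; simp
  rw [hB, Bialgebra.comul_mul, Bialgebra.comul_mul, ← ex, ← ey, ← ef, ← eg]
  simp only [Finset.sum_mul_sum, Algebra.TensorProduct.tmul_mul_tmul, map_sum,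
    TensorProduct.map_tmul, LinearMap.mul'_apply, LinearMap.flip_apply, hfl, hgl, hxr, hyr]
  simp only [← Finset.sum_product']
  -- The two expansions run over the Sweedler terms of `x, y, f, g` in different orders; this
  -- permutation of the indices matches them.
  refine Finset.sum_nbij' (fun t => (t.2.2.1, t.2.2.2, t.1, t.2.1))
    (fun t => (t.2.2.1, t.2.2.2, t.1, t.2.1)) ?_ ?_ ?_ ?_ ?_
  · simp only [Finset.mem_product]; tauto
  · simp only [Finset.mem_product]; tauto
  · intro t _; rfl
  · intro t _; rfl
  intro t _
  ring

variable [HopfAlgebra k U] [HopfAlgebra k O]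

/-- In the convolution algebra of the dual of `U ⊗ O`, the form `⟨Sx, f⟩` is a right inverse of `⟨x,
f⟩` and `⟨x, Sf⟩` is a left inverse, so the two agree. -/
lemma antipode_of_mul {B : U →ₗ[k] O →ₗ[k] k}
    (hl : ∀ x y f, B (x * y) f =
      LinearMap.mul' k k (TensorProduct.map (B x) (B y) (comul f)))
    (hr : ∀ x f g, B x (f * g) =
      LinearMap.mul' k k (TensorProduct.map (B.flip f) (B.flip g) (comul x)))
    (ol : ∀ f, B 1 f = counit f) (or : ∀ x, B x 1 = counit x) (x : U) (f : O) :
    B (HopfAlgebra.antipode k x) f = B x (HopfAlgebra.antipode k f) := by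
  let β : WithConv (U ⊗[k] O →ₗ[k] k) := .toConv (TensorProduct.lift B)
  let γ : WithConv (U ⊗[k] O →ₗ[k] k) :=
    .toConv (TensorProduct.lift (B ∘ₗ HopfAlgebra.antipode k))
  let δ : WithConv (U ⊗[k] O →ₗ[k] k) :=
    .toConv (TensorProduct.lift (B.compl₂ (HopfAlgebra.antipode k)))
  have h1 : β * γ = 1 := by
    ext x f
    have key : ∀ u : U ⊗[k] U, LinearMap.mul' k k (TensorProduct.map β.ofConv γ.ofConv
        (TensorProduct.tensorTensorTensorComm k U U O O (u ⊗ₜ comul f))) =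
        B (LinearMap.mul' k U ((HopfAlgebra.antipode k).lTensor U u)) f := by
      intro u
      induction u with
      | zero => simp
      | add a b ha hb => simp only [TensorProduct.add_tmul, map_add, ha, hb, LinearMap.add_apply]
      | tmul a b =>
        simp only [LinearMap.lTensor_tmul, LinearMap.mul'_apply, hl]
        induction comul (R := k) f with
        | zero => simp
        | add c d hc hd => simp only [TensorProduct.tmul_add, map_add, hc, hd]
        | tmul c d => simp [β, γ]
    have h2 := key (comul x)
    rw [HopfAlgebra.mul_antipode_lTensor_comul_apply, Algebra.algebraMap_eq_smul_one, map_smul,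
      LinearMap.smul_apply, ol] at h2
    change LinearMap.mul' k k (TensorProduct.map β.ofConv γ.ofConv (comul (R := k) (x ⊗ₜ[k] f))) =
      algebraMap k k (counit (R := k) (x ⊗ₜ[k] f))
    rw [TensorProduct.comul_tmul, TensorProduct.counit_tmul]
    exact h2.trans (by simp [mul_comm])
  have h2 : δ * β = 1 := by
    ext x f
    have key : ∀ u : O ⊗[k] O, LinearMap.mul' k k (TensorProduct.map δ.ofConv β.ofConv
        (TensorProduct.tensorTensorTensorComm k U U O O (comul x ⊗ₜ u))) =
        B x (LinearMap.mul' k O ((HopfAlgebra.antipode k).rTensor O u)) := by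
      intro u
      induction u with
      | zero => simp
      | add a b ha hb => simp only [TensorProduct.tmul_add, map_add, ha, hb]
      | tmul a b =>
        simp only [LinearMap.rTensor_tmul, LinearMap.mul'_apply, hr]
        induction comul (R := k) x with
        | zero => simp
        | add c d hc hd => simp only [TensorProduct.add_tmul, map_add, hc, hd]
        | tmul c d => simp [β, δ]
    have h2 := key (comul f)
    rw [HopfAlgebra.mul_antipode_rTensor_comul_apply, Algebra.algebraMap_eq_smul_one, map_smul,
      or, smul_eq_mul, mul_comm] at h2
    change LinearMap.mul' k k (TensorProduct.map δ.ofConv β.ofConv (comul (R := k) (x ⊗ₜ[k] f))) =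
      algebraMap k k (counit (R := k) (x ⊗ₜ[k] f))
    rw [TensorProduct.comul_tmul, TensorProduct.counit_tmul]
    exact h2.trans (by simp [mul_comm])
  have h3 : δ = γ := left_inv_eq_right_inv h2 h1
  have h4 := congrArg (fun φ => φ.ofConv (x ⊗ₜ f)) h3
  simpa [γ, δ] using h4.symm

end DualPairing

/-! ### Uniqueness and existence of the pairing -/

namespace QUEA
/-- The representation of the enveloping algebra given by the values of a pairing on the matrix
of generators of a sector. -/
def pairMatrixHom {B : QUEA r r' s →ₗ[k] QFA (r ^ 2) (r' ^ 2) (s ^ 2) →ₗ[k] k}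
    (hB : IsHopfPairing B) (σ : Sector) : QUEA r r' s →ₐ[k] Matrix (Fin 2) (Fin 2) k :=
  AlgHom.ofLinearMap
    { toFun := fun x => pairMatrix B x σ
      map_add' := fun x y => by simp [pairMatrix]
      map_smul' := fun c x => by simp [pairMatrix] }
    (by
      simp only [LinearMap.coe_mk, AddHom.coe_mk, pairMatrix, hB.one_left, QFA.counit_gen,
        QFA.counitGen, Matrix.one_fin_two])
    (fun x y => by
      simp [pairMatrix, hB.mul_left, QFA.comul_gen, QFA.comulGen])

lemma pairMatrixHom_eq {B B' : QUEA r r' s →ₗ[k] QFA (r ^ 2) (r' ^ 2) (s ^ 2) →ₗ[k] k}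
    (hB : IsHopfPairing B) (hB' : IsHopfPairing B') (h : HasGeneratorValues r r' s B)
    (h' : HasGeneratorValues r r' s B') (σ : Sector) :
    pairMatrixHom hB σ = pairMatrixHom hB' σ := by
  have hK : ∀ τ, pairMatrixHom hB σ (gen τ .K) = pairMatrixHom hB' σ (gen τ .K) := by
    intro τ
    cases σ <;> cases τ
    · exact h.K_chiral.trans h'.K_chiral.symm
    · exact h.K'_chiral.trans h'.K'_chiral.symm
    · exact h.K_anti.trans h'.K_anti.symm
    · exact h.K'_anti.trans h'.K'_anti.symm
  have hL : ∀ τ, pairMatrixHom hB σ (gen τ .L) = pairMatrixHom hB' σ (gen τ .L) := by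
    intro τ
    cases σ <;> cases τ
    · exact h.L_chiral.trans h'.L_chiral.symm
    · exact h.L'_chiral.trans h'.L'_chiral.symm
    · exact h.L_anti.trans h'.L_anti.symm
    · exact h.L'_anti.trans h'.L'_anti.symm
  refine hom_ext fun τ x => ?_
  cases x
  · exact hK τ
  -- No value is prescribed on `q^{-h}`; it is forced, being the inverse of the value on `q^h`.
  · refine left_inv_eq_right_inv (a := pairMatrixHom hB σ (gen τ .K)) ?_ ?_
    · rw [← map_mul, Kinv_K, map_one]
    · rw [hK, ← map_mul, K_Kinv, map_one]
  · exact hL τ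
  · refine left_inv_eq_right_inv (a := pairMatrixHom hB σ (gen τ .L)) ?_ ?_
    · rw [← map_mul, Linv_L, map_one]
    · rw [hL, ← map_mul, L_Linv, map_one]
  · cases σ <;> cases τ
    · exact h.E_chiral.trans h'.E_chiral.symm
    · exact h.E'_chiral.trans h'.E'_chiral.symm
    · exact h.E_anti.trans h'.E_anti.symm
    · exact h.E'_anti.trans h'.E'_anti.symm
  · cases σ <;> cases τ
    · exact h.F_chiral.trans h'.F_chiral.symm
    · exact h.F'_chiral.trans h'.F'_chiral.symm
    · exact h.F_anti.trans h'.F_anti.symm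
    · exact h.F'_anti.trans h'.F'_anti.symm

lemma hopfPairing_unique {B B' : QUEA r r' s →ₗ[k] QFA (r ^ 2) (r' ^ 2) (s ^ 2) →ₗ[k] k}
    (hB : IsHopfPairing B) (hB' : IsHopfPairing B') (h : HasGeneratorValues r r' s B)
    (h' : HasGeneratorValues r r' s B') : B = B' := by
  have key : ∀ f x, B x f = B' x f := by
    intro f
    induction f using QFA.induction with
    | hc c =>
      intro x
      rw [Algebra.algebraMap_eq_smul_one, map_smul, map_smul, hB.one_right, hB'.one_right]
    | hg σ t =>
      intro x
      have h1 : pairMatrix B x σ = pairMatrix B' x σ :=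
        DFunLike.congr_fun (pairMatrixHom_eq hB hB' h h' σ) x
      have e := fun i j => congrFun (congrFun h1 i) j
      cases t
      · exact e 0 0
      · exact e 0 1
      · exact e 1 0
      · exact e 1 1
    | hm f g hf hg =>
      intro x
      have e1 : B.flip f = B'.flip f := LinearMap.ext hf
      have e2 : B.flip g = B'.flip g := LinearMap.ext hg
      rw [hB.mul_right, hB'.mul_right, e1, e2]
    | ha f g hf hg =>
      intro x
      rw [map_add, map_add, hf, hg]
  exact LinearMap.ext fun x => LinearMap.ext fun f => key f x

variable [Fact (Generic r r')]

variable (r r' s) in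
/-- The homomorphism from the function algebra to the dual of the enveloping algebra. -/
def pairHom : QFA (r ^ 2) (r' ^ 2) (s ^ 2) →ₐ[k] WithConv (QUEA r r' s →ₗ[k] k) :=
  QFA.lift coefGen coefGen_rel

/-- The pairing of the enveloping algebra with the function algebra. -/
def pairing : QUEA r r' s →ₗ[k] QFA (r ^ 2) (r' ^ 2) (s ^ 2) →ₗ[k] k :=
  ((WithConv.linearEquiv k (QUEA r r' s →ₗ[k] k)).toLinearMap ∘ₗ (pairHom r r' s).toLinearMap).flip

lemma pairing_apply (x : QUEA r r' s) (f : QFA (r ^ 2) (r' ^ 2) (s ^ 2)) : pairing x f = (pairHom r r' s f).ofConv x := rfl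

lemma pairing_gen (x : QUEA r r' s) (σ : Sector) (t : OGen) :
    pairing x (QFA.gen σ t) = (coefGen σ t).ofConv x := by
  rw [pairing_apply, pairHom, QFA.lift_gen]

lemma pairing_mul_right (x : QUEA r r' s) (f g : QFA (r ^ 2) (r' ^ 2) (s ^ 2)) : pairing x (f * g) =
    LinearMap.mul' k k (TensorProduct.map (pairing.flip f) (pairing.flip g) (comul x)) := by
  rw [pairing_apply, map_mul]
  rfl

lemma pairing_one_right (x : QUEA r r' s) : pairing x 1 = counit (R := k) x := by
  rw [pairing_apply, map_one]
  rfl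

lemma pairing_one_left (f : QFA (r ^ 2) (r' ^ 2) (s ^ 2)) : pairing (1 : QUEA r r' s) f = counit (R := k) f := by
  induction f using QFA.induction with
  | hc c =>
    rw [Algebra.algebraMap_eq_smul_one, map_smul, pairing_one_right]
    simp
  | hg σ t =>
    rw [pairing_gen, QFA.counit_gen]
    cases σ <;> cases t <;> simp [coefGen, coef_apply, QFA.counitGen]
  | hm f g hf hg =>
    rw [pairing_mul_right, Bialgebra.comul_one, Algebra.TensorProduct.one_def]
    simp [hf, hg]
  | ha f g hf hg => rw [map_add, map_add, hf, hg]

/-- On generators this is the multiplicativity of the vector representation, entry by entry.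
Reversing rows and columns in the antichiral sector preserves matrix multiplication and only changes
the order of the two summands. -/
lemma pairing_mul_left (x y : QUEA r r' s) (f : QFA (r ^ 2) (r' ^ 2) (s ^ 2)) : pairing (x * y) f =
    LinearMap.mul' k k (TensorProduct.map (pairing x) (pairing y) (comul f)) := by
  induction f using QFA.induction generalizing x y with
  | hc c =>
    rw [Algebra.algebraMap_eq_smul_one, map_smul, map_smul, Bialgebra.comul_one,
      Algebra.TensorProduct.one_def, pairing_one_right]
    simp [pairing_one_right]
  | hg σ t =>
    rw [QFA.comul_gen]
    cases σ <;> cases t <;> simp [QFA.comulGen, pairing_gen, coefGen, coef_apply, Matrix.mul_apply,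
      add_comm]
  | hm f g hf hg => exact mul_left_of_mul pairing_mul_right hf hg x y
  | ha f g hf hg => simp only [map_add, hf, hg]

lemma isHopfPairing_pairing : IsHopfPairing (pairing (r := r) (r' := r') (s := s)) where
  mul_left := pairing_mul_left
  mul_right := pairing_mul_right
  one_left := pairing_one_left
  one_right := pairing_one_right
  antipode := antipode_of_mul pairing_mul_left pairing_mul_right pairing_one_left pairing_one_right

lemma hasGeneratorValues_pairing :
    HasGeneratorValues r r' s (pairing (r := r) (r' := r') (s := s)) := by
  constructor <;> ext i j <;> fin_cases i <;> fin_cases j <;>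
    simp [pairMatrix, pairing_gen, coefGen, coef_apply, rep_gen, repGen, vecGen, counitGen, root]

end QUEA

/-! ### The Cartan group and its weights -/

namespace QUEA

/-- `q^h` as a unit. -/
def unitK (σ : Sector) : (QUEA r r' s)ˣ := ⟨gen σ .K, gen σ .Kinv, K_Kinv σ, Kinv_K σ⟩

/-- `ℓ^h` as a unit. -/
def unitL (σ : Sector) : (QUEA r r' s)ˣ := ⟨gen σ .L, gen σ .Linv, L_Linv σ, Linv_L σ⟩

/-- `q^h` together with its weights. -/
def cartanK (σ : Sector) : (QUEA r r' s)ˣ × (Sector → kˣ) :=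
  (unitK σ, Pi.mulSingle σ (root r r' σ))

/-- `ℓ^h` together with its weights. -/
def cartanL (σ : Sector) : (QUEA r r' s)ˣ × (Sector → kˣ) := (unitL σ, Pi.mulSingle σ s)

variable (r r' s) in
/-- The group of Cartan elements of the enveloping algebra together with their weights. -/
def Torus : Subgroup ((QUEA r r' s)ˣ × (Sector → kˣ)) :=
  Subgroup.closure (Set.range cartanK ∪ Set.range cartanL)

lemma cartanK_mem (σ : Sector) : cartanK σ ∈ Torus r r' s :=
  Subgroup.subset_closure (.inl ⟨σ, rfl⟩)

lemma cartanL_mem (σ : Sector) : cartanL σ ∈ Torus r r' s :=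
  Subgroup.subset_closure (.inr ⟨σ, rfl⟩)

lemma commute_cartan {x y : (QUEA r r' s)ˣ × (Sector → kˣ)}
    (hx : x ∈ Set.range (cartanK (r := r) (r' := r') (s := s)) ∪ Set.range cartanL)
    (hy : y ∈ Set.range (cartanK (r := r) (r' := r') (s := s)) ∪ Set.range cartanL) :
    Commute x y := by
  rcases hx with ⟨σ, rfl⟩ | ⟨σ, rfl⟩ <;> rcases hy with ⟨τ, rfl⟩ | ⟨τ, rfl⟩ <;>
    refine Prod.ext (Units.ext ?_) (mul_comm _ _) <;>
    cases σ <;> cases τ <;> simp [cartanK, cartanL, unitK, unitL, cross, L_K]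

lemma commute_zpow_cartan (σ τ : Sector) (m n m' n' : ℤ) :
    Commute (cartanK (r := r) (r' := r') (s := s) σ ^ m * cartanL σ ^ n)
      (cartanK τ ^ m' * cartanL τ ^ n') := by
  refine Commute.mul_left (Commute.mul_right ?_ ?_) (Commute.mul_right ?_ ?_) <;>
    refine Commute.zpow_zpow (commute_cartan ?_ ?_) _ _ <;> simp

lemma cartan_zpow_add (σ : Sector) (m n m' n' : ℤ) :
    cartanK (r := r) (r' := r') (s := s) σ ^ (m + m') * cartanL σ ^ (n + n') =
      (cartanK σ ^ m * cartanL σ ^ n) * (cartanK σ ^ m' * cartanL σ ^ n') := by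
  have h : Commute (cartanL (r := r) (r' := r') (s := s) σ) (cartanK σ) :=
    commute_cartan (by simp) (by simp)
  rw [zpow_add, zpow_add, mul_assoc, mul_assoc, ← mul_assoc (cartanL σ ^ n),
    (h.zpow_zpow n m').eq, mul_assoc]

lemma Torus.exists_zpow {x : (QUEA r r' s)ˣ × (Sector → kˣ)} (hx : x ∈ Torus r r' s) :
    ∃ m n m' n' : ℤ, x = (cartanK .chiral ^ m * cartanL .chiral ^ n) *
      (cartanK .anti ^ m' * cartanL .anti ^ n') := by
  induction hx using Subgroup.closure_induction with
  | mem x hx =>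
    rcases hx with ⟨σ, rfl⟩ | ⟨σ, rfl⟩ <;> cases σ
    · exact ⟨1, 0, 0, 0, by simp⟩
    · exact ⟨0, 0, 1, 0, by simp⟩
    · exact ⟨0, 1, 0, 0, by simp⟩
    · exact ⟨0, 0, 0, 1, by simp⟩
  | one => exact ⟨0, 0, 0, 0, by simp⟩
  | mul x y _ _ hx hy =>
    obtain ⟨m₁, n₁, m₁', n₁', rfl⟩ := hx
    obtain ⟨m₂, n₂, m₂', n₂', rfl⟩ := hy
    refine ⟨m₁ + m₂, n₁ + n₂, m₁' + m₂', n₁' + n₂', ?_⟩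
    rw [cartan_zpow_add, cartan_zpow_add, mul_assoc, mul_assoc,
      ← mul_assoc (cartanK .anti ^ m₁' * cartanL .anti ^ n₁'),
      (commute_zpow_cartan .anti .chiral m₁' n₁' m₂ n₂).eq]
    simp only [mul_assoc]
  | inv x _ hx =>
    obtain ⟨m, n, m', n', rfl⟩ := hx
    refine ⟨-m, -n, -m', -n', ?_⟩
    rw [mul_inv_rev, (commute_zpow_cartan .chiral .anti (-m) (-n) (-m') (-n')).eq]
    have e : ∀ (σ : Sector) (m n : ℤ),
        (cartanK (r := r) (r' := r') (s := s) σ ^ m * cartanL σ ^ n)⁻¹ =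
        cartanK σ ^ (-m) * cartanL σ ^ (-n) := by
      intro σ m n
      rw [inv_eq_iff_mul_eq_one, ← cartan_zpow_add]
      simp
    rw [e, e]

/-- The exponential rule is stated for natural exponents; splitting each integer as a difference of
naturals extends it to the group. -/
lemma unit_zpow_eq_one (σ : Sector) (m n : ℤ) (h : root r r' σ ^ m * s ^ n = 1) :
    (unitK σ ^ m * unitL σ ^ n : (QUEA r r' s)ˣ) = 1 := by
  obtain ⟨a, b, rfl⟩ : ∃ a b : ℕ, m = a - b := ⟨m.toNat, (-m).toNat, by omega⟩
  obtain ⟨c, d, rfl⟩ : ∃ c d : ℕ, n = c - d := ⟨n.toNat, (-n).toNat, by omega⟩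
  have h1 : root r r' σ ^ a * s ^ c = root r r' σ ^ b * s ^ d := by
    rw [zpow_sub, zpow_sub, zpow_natCast, zpow_natCast, zpow_natCast, zpow_natCast,
      ← div_eq_mul_inv, ← div_eq_mul_inv, div_mul_div_comm, div_eq_one] at h
    exact h
  have h2 : (unitK σ ^ a * unitL σ ^ c : (QUEA r r' s)ˣ) = unitK σ ^ b * unitL σ ^ d := by
    refine Units.ext ?_
    simpa [unitK, unitL] using exp_rule σ a c b d h1
  have hc : Commute (unitL σ : (QUEA r r' s)ˣ) (unitK σ) := Units.ext (L_K σ)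
  rw [zpow_sub, zpow_sub, zpow_natCast, zpow_natCast, zpow_natCast, zpow_natCast, mul_assoc,
    ← mul_assoc (unitK σ ^ b)⁻¹, ← (hc.pow_pow c b).inv_right.eq, mul_assoc, ← mul_assoc, h2,
    ← (hc.pow_pow d b).eq]
  simp [mul_assoc]

/-- A Cartan element is a product of one part from each sector, and the exponential rule trivialises
each part separately. Without that rule, left nondegeneracy could fail when `q^{1/2}` and `ℓ^{1/2}`
are dependent. -/
lemma Torus.eq_one {x : (QUEA r r' s)ˣ × (Sector → kˣ)} (hx : x ∈ Torus r r' s)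
    (h : x.2 = 1) : x = 1 := by
  obtain ⟨m, n, m', n', rfl⟩ := Torus.exists_zpow hx
  have h1 := congrFun h .chiral
  have h2 := congrFun h .anti
  simp [cartanK, cartanL] at h1 h2
  refine Prod.ext ?_ h
  have e1 := unit_zpow_eq_one (r := r) (r' := r') (s := s) .chiral m n h1
  have e2 := unit_zpow_eq_one (r := r) (r' := r') (s := s) .anti m' n' h2
  simp [cartanK, cartanL, e1, e2]

/-- The weight of a Cartan element. -/
def wt (v : Torus r r' s) : Sector → kˣ := v.1.2

/-- The Cartan element underlying an element of the torus. -/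
def el (v : Torus r r' s) : QUEA r r' s := (v.1.1 : QUEA r r' s)

lemma wt_injective : Function.Injective (wt : Torus r r' s → Sector → kˣ) := by
  intro v w h
  rw [← inv_mul_eq_one]
  refine Subtype.ext (Torus.eq_one (v⁻¹ * w).2 ?_)
  change (v.1.2)⁻¹ * w.1.2 = 1
  rw [inv_mul_eq_one]
  exact h

lemma el_mul (v w : Torus r r' s) : el (v * w) = el v * el w := rfl
lemma el_one : el (1 : Torus r r' s) = 1 := rfl
lemma wt_mul (v w : Torus r r' s) (σ : Sector) : wt (v * w) σ = wt v σ * wt w σ := rfl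
lemma wt_one (σ : Sector) : wt (1 : Torus r r' s) σ = 1 := rfl
lemma wt_inv (v : Torus r r' s) (σ : Sector) : wt v⁻¹ σ = (wt v σ)⁻¹ := rfl

/-- `q^h` as an element of the torus. -/
def torusK (σ : Sector) : Torus r r' s := ⟨cartanK σ, cartanK_mem σ⟩

/-- `ℓ^h` as an element of the torus. -/
def torusL (σ : Sector) : Torus r r' s := ⟨cartanL σ, cartanL_mem σ⟩

lemma el_torusK (σ : Sector) : el (torusK σ : Torus r r' s) = gen σ .K := rfl
lemma el_torusK_inv (σ : Sector) : el ((torusK σ)⁻¹ : Torus r r' s) = gen σ .Kinv := rfl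
lemma el_torusL (σ : Sector) : el (torusL σ : Torus r r' s) = gen σ .L := rfl
lemma Torus.induction {C : Torus r r' s → Prop} (hK : ∀ σ, C (torusK σ)) (hL : ∀ σ, C (torusL σ))
    (h1 : C 1) (hm : ∀ v w, C v → C w → C (v * w)) (hi : ∀ v, C v → C v⁻¹) (v : Torus r r' s) :
    C v := by
  obtain ⟨x, hx⟩ := v
  induction hx using Subgroup.closure_induction with
  | mem x hx =>
    rcases hx with ⟨σ, rfl⟩ | ⟨σ, rfl⟩
    · exact hK σ
    · exact hL σ
  | one => exact h1
  | mul x y hx hy h1 h2 => exact hm ⟨x, hx⟩ ⟨y, hy⟩ h1 h2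
  | inv x hx h1 => exact hi ⟨x, hx⟩ h1

/-- The square appears because weights are recorded on the vector representation, as eigenvalues on
its first basis vectors, while `e₊` connects the eigenvalues `w⁻¹` and `w`. -/
lemma el_mul_E (v : Torus r r' s) (σ : Sector) :
    el v * gen σ .E = ((wt v σ : kˣ) : k) ^ 2 • (gen σ .E * el v) := by
  induction v using Torus.induction with
  | hK τ =>
    rw [el_torusK]
    rcases eq_or_ne σ τ with rfl | h
    · simpa [wt, torusK, cartanK] using K_E σ
    · have : wt (torusK τ : Torus r r' s) σ = 1 := by simp [wt, torusK, cartanK, h]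
      rw [this]
      cases σ <;> cases τ <;> simp_all [cross]
  | hL τ =>
    rw [el_torusL]
    rcases eq_or_ne σ τ with rfl | h
    · simpa [wt, torusL, cartanL] using L_E σ
    · have : wt (torusL τ : Torus r r' s) σ = 1 := by simp [wt, torusL, cartanL, h]
      rw [this]
      cases σ <;> cases τ <;> simp_all [cross]
  | h1 => simp [el_one, wt_one]
  | hm v w hv hw =>
    rw [el_mul, mul_assoc, hw, mul_smul_comm, ← mul_assoc, hv, smul_mul_assoc, smul_smul,
      mul_assoc, wt_mul]
    push_cast
    rw [mul_pow, mul_comm (_ ^ 2)]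
  | hi v hv =>
    rw [wt_inv]
    have := inv_comm (t' := el v⁻¹) (by simp) (by rw [← el_mul, mul_inv_cancel, el_one])
      (by rw [← el_mul, inv_mul_cancel, el_one]) hv
    simpa using this

lemma el_mul_F (v : Torus r r' s) (σ : Sector) :
    el v * gen σ .F = (((wt v σ : kˣ) : k) ^ 2)⁻¹ • (gen σ .F * el v) := by
  induction v using Torus.induction with
  | hK τ =>
    rw [el_torusK]
    rcases eq_or_ne σ τ with rfl | h
    · simpa [wt, torusK, cartanK] using K_F σ
    · have : wt (torusK τ : Torus r r' s) σ = 1 := by simp [wt, torusK, cartanK, h]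
      rw [this]
      cases σ <;> cases τ <;> simp_all [cross]
  | hL τ =>
    rw [el_torusL]
    rcases eq_or_ne σ τ with rfl | h
    · simpa [wt, torusL, cartanL] using L_F σ
    · have : wt (torusL τ : Torus r r' s) σ = 1 := by simp [wt, torusL, cartanL, h]
      rw [this]
      cases σ <;> cases τ <;> simp_all [cross]
  | h1 => simp [el_one, wt_one]
  | hm v w hv hw =>
    rw [el_mul, mul_assoc, hw, mul_smul_comm, ← mul_assoc, hv, smul_mul_assoc, smul_smul,
      mul_assoc, wt_mul]
    push_cast
    rw [mul_pow, mul_inv_rev]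
  | hi v hv =>
    rw [wt_inv]
    have := inv_comm (t' := el v⁻¹) (by simp) (by rw [← el_mul, mul_inv_cancel, el_one])
      (by rw [← el_mul, inv_mul_cancel, el_one]) hv
    simpa using this

lemma counit_el (v : Torus r r' s) : counit (R := k) (el v) = 1 := by
  induction v using Torus.induction with
  | hK τ => exact counit_gen _ _
  | hL τ => exact counit_gen _ _
  | h1 => rw [el_one, Bialgebra.counit_one]
  | hm v w hv hw => rw [el_mul, Bialgebra.counit_mul, hv, hw, one_mul]
  | hi v hv =>
    have h : counit (R := k) (el (v * v⁻¹)) = 1 := by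
      rw [mul_inv_cancel, el_one, Bialgebra.counit_one]
    rwa [el_mul, Bialgebra.counit_mul, hv, one_mul] at h

variable [Fact (Generic r r')]

/-- Cartan elements are group-like and act diagonally; the inverse case follows from uniqueness of
inverses of matrices over `U`. -/
lemma coact_el (v : Torus r r' s) (σ : Sector) :
    coact σ (el v) = !![((wt v σ : kˣ) : k) • el v, 0; 0, ((wt v σ : kˣ) : k)⁻¹ • el v] := by
  induction v using Torus.induction with
  | hK τ =>
    rw [el_torusK, coact_groupLike (comul_K τ)]
    ext i j
    cases σ <;> cases τ <;> fin_cases i <;> fin_cases j <;>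
      simp [rep_gen, repGen, vecGen, wt, torusK, cartanK, root, counitGen]
  | hL τ =>
    rw [el_torusL, coact_groupLike (comul_L τ)]
    ext i j
    cases σ <;> cases τ <;> fin_cases i <;> fin_cases j <;>
      simp [rep_gen, repGen, vecGen, wt, torusL, cartanL, counitGen]
  | h1 => simp [el_one, wt_one, Matrix.one_fin_two]
  | hm v w hv hw =>
    rw [el_mul, map_mul, hv, hw, wt_mul]
    simp [smul_smul, mul_comm]
  | hi v hv =>
    refine left_inv_eq_right_inv (a := coact σ (el v)) ?_ ?_
    · rw [← map_mul, ← el_mul, inv_mul_cancel, el_one, map_one]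
    · rw [hv, wt_inv]
      simp [smul_smul, ← el_mul, el_one, Matrix.one_fin_two]

end QUEA

/-! ### Quantum integers, triangular matrices and characters -/

/-- The quantum integers that occur in the coproduct of powers of `e_±`. -/
def qnum (p : k) : ℕ → k
  | 0 => 0
  | n + 1 => p ^ n + p⁻¹ ^ 3 * qnum p n

lemma qnum_mul {p : k} (hp : p ≠ 0) (n : ℕ) :
    qnum p n * (p - p⁻¹ ^ 3) = p ^ n - p⁻¹ ^ (3 * n) := by
  induction n with
  | zero => simp [qnum]
  | succ n ih =>
    rw [qnum, add_mul, mul_assoc, ih, mul_add 3, pow_add p⁻¹, mul_one, pow_succ]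
    field_simp
    ring

/-- By the closed form `qnum_mul`, a zero would give `p^n = p^{-3n}`, that is `q^{2n} = 1` with `q =
p²`. -/
lemma qnum_ne_zero [hg : Fact (Generic r r')] (σ : Sector) {n : ℕ} (hn : n ≠ 0) :
    qnum (root r r' σ : k) n ≠ 0 := by
  have hp : (root r r' σ : k) ≠ 0 := Units.ne_zero _
  intro h
  have h1 := qnum_mul hp n
  rw [h, zero_mul, eq_comm, sub_eq_zero, inv_pow, ← mul_eq_one_iff_eq_inv₀ (pow_ne_zero _ hp)] at h1
  refine hg.out σ (2 * n) (by omega) (Units.ext ?_)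
  push_cast
  rw [← h1, ← pow_mul, ← pow_add]
  congr 1
  ring

lemma upper_mul {A : Type*} [Ring A] {a b d a' b' d' a'' b'' d'' : A} (h1 : a * a' = a'')
    (h2 : a * b' + b * d' = b'') (h3 : d * d' = d'') :
    !![a, b; 0, d] * !![a', b'; 0, d'] = !![a'', b''; 0, d''] := by
  simp [← h1, ← h2, ← h3]

lemma lower_mul {A : Type*} [Ring A] {a c d a' c' d' a'' c'' d'' : A} (h1 : a * a' = a'')
    (h2 : c * a' + d * c' = c'') (h3 : d * d' = d'') :
    !![a, 0; c, d] * !![a', 0; c', d'] = !![a'', 0; c'', d''] := by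
  simp [← h1, ← h2, ← h3]

/-- The character with exponents `N` on weights. -/
def chr (w : Sector → kˣ) (N : Sector → ℤ) : kˣ := w .chiral ^ N .chiral * w .anti ^ N .anti

lemma chr_mul (w w' : Sector → kˣ) (N : Sector → ℤ) : chr (w * w') N = chr w N * chr w' N := by
  simp only [chr, Pi.mul_apply, mul_zpow]
  exact mul_mul_mul_comm _ _ _ _

lemma chr_add (w : Sector → kˣ) (N N' : Sector → ℤ) : chr w (N + N') = chr w N * chr w N' := by
  simp only [chr, Pi.add_apply, zpow_add]
  exact mul_mul_mul_comm _ _ _ _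

lemma chr_neg (w : Sector → kˣ) (N : Sector → ℤ) : chr w (-N) = (chr w N)⁻¹ := by
  rw [eq_inv_iff_mul_eq_one, ← chr_add]
  simp [chr]

lemma chr_single (w : Sector → kˣ) (σ : Sector) : chr w (Pi.single σ 1) = w σ := by
  cases σ <;> simp [chr]

/-! ### Poincaré-Birkhoff-Witt monomials and the coaction on their factors -/

namespace QUEA

/-- `tw` as an element of the torus. -/
def torusTw : Sector → Torus r r' s
  | .chiral => torusL .anti
  | .anti => (torusL .chiral)⁻¹

/-- The group-like element in the second term of the coproduct of `e₊`. -/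
def skewE (σ : Sector) : Torus r r' s := (torusK σ)⁻¹ * (torusTw σ)⁻¹

/-- The group-like element in the second term of the coproduct of `e₋`. -/
def skewF (σ : Sector) : Torus r r' s := (torusK σ)⁻¹ * torusTw σ

lemma el_skewE (σ : Sector) : el (skewE σ : Torus r r' s) = gen σ .Kinv * twInv σ := by
  cases σ
  · rfl
  · simp [skewE, el_mul, el_torusK_inv, torusTw, inv_inv, el_torusL, twInv]

lemma el_skewF (σ : Sector) : el (skewF σ : Torus r r' s) = gen σ .Kinv * tw σ := by
  cases σ <;> rfl

lemma wt_skewE (σ : Sector) : wt (skewE σ : Torus r r' s) σ = (root r r' σ)⁻¹ := by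
  cases σ <;> simp [skewE, wt, torusK, torusTw, torusL, cartanK, cartanL]

lemma wt_skewF (σ : Sector) : wt (skewF σ : Torus r r' s) σ = (root r r' σ)⁻¹ := by
  cases σ <;> simp [skewF, wt, torusK, torusTw, torusL, cartanK, cartanL]

/-- The monomials in `e₊` and `e'₊`. -/
def monE (i : Sector → ℕ) : QUEA r r' s := gen .chiral .E ^ i .chiral * gen .anti .E ^ i .anti

/-- The monomials in `e₋` and `e'₋`. -/
def monF (i : Sector → ℕ) : QUEA r r' s := gen .chiral .F ^ i .chiral * gen .anti .F ^ i .anti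

/-- The monomials of the Poincaré-Birkhoff-Witt basis. -/
def mon (i j : Sector → ℕ) (v : Torus r r' s) : QUEA r r' s := monE i * el v * monF j

lemma el_mul_pow (v : Torus r r' s) {e : QUEA r r' s} {c : k} (h : el v * e = c • (e * el v))
    (n : ℕ) : el v * e ^ n = c ^ n • (e ^ n * el v) := by
  induction n with
  | zero => simp
  | succ n ih =>
    rw [pow_succ, ← mul_assoc, ih, smul_mul_assoc, mul_assoc, h, mul_smul_comm, smul_smul,
      mul_assoc, pow_succ]

lemma comm_E_E (σ τ : Sector) : Commute (gen σ .E : QUEA r r' s) (gen τ .E) := by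
  cases σ <;> cases τ
  exacts [.refl _, (cross _ _).symm, cross _ _, .refl _]

lemma comm_F_F (σ τ : Sector) : Commute (gen σ .F : QUEA r r' s) (gen τ .F) := by
  cases σ <;> cases τ
  exacts [.refl _, (cross _ _).symm, cross _ _, .refl _]

/-- The sectors commute, so the one under consideration may be written first; this treats both
sectors at once. -/
lemma monE_eq (σ : Sector) (i : Sector → ℕ) :
    (monE i : QUEA r r' s) = gen σ .E ^ i σ * gen σ.other .E ^ i σ.other := by
  cases σ
  · rfl
  · exact (comm_E_E _ _).pow_pow _ _

lemma monF_eq (σ : Sector) (i : Sector → ℕ) :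
    (monF i : QUEA r r' s) = gen σ.other .F ^ i σ.other * gen σ .F ^ i σ := by
  cases σ
  · exact (comm_F_F _ _).pow_pow _ _
  · rfl

variable [Fact (Generic r r')]

/-- The truncated exponent `n - 1` is harmless at `n = 0`, where `qnum` vanishes. -/
lemma coact_E_pow (σ : Sector) (n : ℕ) : coact σ (gen σ .E ^ n : QUEA r r' s) =
    !![(root r r' σ : k) ^ n • gen σ .E ^ n,
      qnum (root r r' σ : k) n • (gen σ .E ^ (n - 1) * el (skewE σ)); 0,
      ((root r r' σ : k) ^ n)⁻¹ • gen σ .E ^ n] := by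
  induction n with
  | zero => simp [qnum, Matrix.one_fin_two]
  | succ n ih =>
    rw [pow_succ, map_mul, ih, coact_E, ← el_skewE]
    have h := el_mul_E (skewE σ : Torus r r' s) σ
    rw [wt_skewE] at h
    -- Moving the group-like factor past `e₊` costs `p⁻²`; with the `p⁻¹` from the diagonal of
    -- `coact_E` this is the `p⁻³` in the recursion of `qnum`.
    have h2 : qnum (root r r' σ : k) n • (gen σ .E ^ (n - 1) * el (skewE σ) * gen σ .E :
        QUEA r r' s) = (qnum (root r r' σ : k) n * (root r r' σ : k)⁻¹ ^ 2) •
          (gen σ .E ^ n * el (skewE σ)) := by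
      rcases n with _ | n
      · simp [qnum]
      · rw [mul_assoc, h, mul_smul_comm, smul_smul, ← mul_assoc, add_tsub_cancel_right,
          ← pow_succ]
        simp
    refine upper_mul ?_ ?_ ?_
    · rw [smul_mul_smul_comm, ← pow_succ, ← pow_succ]
    · rw [smul_mul_assoc, smul_mul_assoc, mul_smul_comm, smul_comm, h2, smul_smul, ← add_smul,
        add_tsub_cancel_right, qnum]
      congr 1
      ring
    · rw [smul_mul_smul_comm, ← pow_succ, ← mul_inv, ← pow_succ]

lemma coact_F_pow (σ : Sector) (n : ℕ) : coact σ (gen σ .F ^ n : QUEA r r' s) =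
    !![(root r r' σ : k) ^ n • gen σ .F ^ n, 0;
      qnum (root r r' σ : k) n • (el (skewF σ) * gen σ .F ^ (n - 1)),
      ((root r r' σ : k) ^ n)⁻¹ • gen σ .F ^ n] := by
  induction n with
  | zero => simp [qnum, Matrix.one_fin_two]
  | succ n ih =>
    rw [pow_succ', map_mul, ih, coact_F, ← el_skewF]
    have h := el_mul_F (skewF σ : Torus r r' s) σ
    rw [wt_skewF] at h
    have h' : (gen σ .F * el (skewF σ) : QUEA r r' s) =
        ((root r r' σ : k)⁻¹ ^ 2) • (el (skewF σ) * gen σ .F) := by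
      rw [h, smul_smul]
      simp
    have h2 : qnum (root r r' σ : k) n • (gen σ .F * (el (skewF σ) * gen σ .F ^ (n - 1)) :
        QUEA r r' s) = (qnum (root r r' σ : k) n * (root r r' σ : k)⁻¹ ^ 2) •
          (el (skewF σ) * gen σ .F ^ n) := by
      rcases n with _ | n
      · simp [qnum]
      · rw [← mul_assoc, h', smul_mul_assoc, smul_smul, mul_assoc, add_tsub_cancel_right,
          ← pow_succ']
    refine lower_mul ?_ ?_ ?_
    · rw [smul_mul_smul_comm, ← pow_succ', ← pow_succ']
    · rw [smul_mul_assoc, mul_smul_comm, mul_smul_comm, h2, smul_smul, ← add_smul,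
        add_tsub_cancel_right, qnum]
      congr 1
      ring
    · rw [smul_mul_smul_comm, ← pow_succ', ← mul_inv, ← pow_succ']

lemma diag_pow' {A : Type*} [Ring A] [Algebra k A] (x y : k) (e : A) (n : ℕ) :
    (!![x • e, 0; 0, y • e] : Matrix (Fin 2) (Fin 2) A) ^ n =
      !![x ^ n • e ^ n, 0; 0, y ^ n • e ^ n] := by
  induction n with
  | zero => simp [Matrix.one_fin_two]
  | succ n ih => simp [pow_succ, ih, smul_smul]

lemma coact_E_other_pow (σ : Sector) (n : ℕ) :
    coact σ (gen σ.other .E ^ n : QUEA r r' s) =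
      !![(link s σ.other : k) ^ n • gen σ.other .E ^ n, 0; 0,
        ((link s σ.other : k) ^ n)⁻¹ • gen σ.other .E ^ n] := by
  rw [map_pow, coact_E_other, diag_pow', inv_pow]

lemma coact_F_other_pow (σ : Sector) (n : ℕ) :
    coact σ (gen σ.other .F ^ n : QUEA r r' s) =
      !![((link s σ.other : k) ^ n)⁻¹ • gen σ.other .F ^ n, 0; 0,
        (link s σ.other : k) ^ n • gen σ.other .F ^ n] := by
  rw [map_pow, coact_F_other, diag_pow', inv_pow]

/-- Only the vanishing of the constants matters later. The off-diagonal one is a quantum integer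
times units: powers of `link` from the other sector, and the squared weight paid for moving `skewE`
to the right. -/
lemma coact_monE (σ : Sector) (i : Sector → ℕ) : ∃ (z : kˣ) (c : k), (c ≠ 0 ↔ i σ ≠ 0) ∧
    coact σ (monE i : QUEA r r' s) = !![(z : k) • monE i,
      c • (monE (i - Pi.single σ 1) * el (skewE σ)); 0, (z : k)⁻¹ • monE i] := by
  have hl : (link s σ.other : k) ≠ 0 := Units.ne_zero _
  refine ⟨root r r' σ ^ i σ * link s σ.other ^ i σ.other, qnum (root r r' σ : k) (i σ) *
    ((link s σ.other : k)⁻¹ ^ i σ.other * (((wt (skewE σ : Torus r r' s) σ.other : kˣ) : k) ^ 2) ^ i σ.other), ?_, ?_⟩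
  · rw [mul_ne_zero_iff]
    refine ⟨fun h h0 => h.1 (by rw [h0, qnum]), fun h => ⟨qnum_ne_zero σ h, by simp⟩⟩
  · have e := el_mul_pow _ (el_mul_E (skewE σ : Torus r r' s) σ.other) (i σ.other)
    have ho : (i - Pi.single σ 1 : Sector → ℕ) σ.other = i σ.other := by
      cases σ <;> simp [Sector.other]
    rw [monE_eq σ, monE_eq σ, map_mul, coact_E_pow, coact_E_other_pow, ho]
    refine upper_mul ?_ ?_ ?_
    · rw [smul_mul_smul_comm]
      push_cast
      rfl
    · rw [mul_zero, zero_add, smul_mul_smul_comm, mul_assoc, e, mul_smul_comm, smul_smul, mul_assoc,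
        mul_assoc, inv_pow]
      simp
    · rw [smul_mul_smul_comm, ← mul_inv]
      push_cast
      rfl

lemma coact_monF (σ : Sector) (i : Sector → ℕ) : ∃ (z : kˣ) (c : k), (c ≠ 0 ↔ i σ ≠ 0) ∧
    coact σ (monF i : QUEA r r' s) = !![(z : k) • monF i, 0;
      c • (el (skewF σ) * monF (i - Pi.single σ 1)), (z : k)⁻¹ • monF i] := by
  have hl : (link s σ.other : k) ≠ 0 := Units.ne_zero _
  refine ⟨root r r' σ ^ i σ * (link s σ.other ^ i σ.other)⁻¹, qnum (root r r' σ : k) (i σ) *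
    ((link s σ.other : k) ^ i σ.other * (((wt (skewF σ : Torus r r' s) σ.other : kˣ) : k) ^ 2) ^ i σ.other), ?_, ?_⟩
  · rw [mul_ne_zero_iff]
    refine ⟨fun h h0 => h.1 (by rw [h0, qnum]), fun h => ⟨qnum_ne_zero σ h, by simp⟩⟩
  · have e := el_mul_pow _ (el_mul_F (skewF σ : Torus r r' s) σ.other) (i σ.other)
    have hw : ((wt (skewF σ : Torus r r' s) σ.other : kˣ) : k) ≠ 0 := Units.ne_zero _
    have e' : (gen σ.other .F ^ i σ.other * el (skewF σ) : QUEA r r' s) =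
        (((wt (skewF σ : Torus r r' s) σ.other : kˣ) : k) ^ 2) ^ i σ.other •
          (el (skewF σ) * gen σ.other .F ^ i σ.other) := by
      rw [e, smul_smul, ← mul_pow, mul_inv_cancel₀ (pow_ne_zero 2 hw), one_pow, one_smul]
    have ho : (i - Pi.single σ 1 : Sector → ℕ) σ.other = i σ.other := by
      cases σ <;> simp [Sector.other]
    rw [monF_eq σ, monF_eq σ, map_mul, coact_F_pow, coact_F_other_pow, ho]
    refine lower_mul ?_ ?_ ?_
    · rw [smul_mul_smul_comm]
      push_cast
      rw [mul_comm (_⁻¹)]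
    · rw [zero_mul, zero_add, smul_mul_smul_comm, ← mul_assoc, e', smul_mul_assoc, smul_smul,
        mul_assoc (el _)]
      simp only [Pi.sub_apply, Pi.single_eq_same]
      congr 1
      ring
    · rw [smul_mul_smul_comm]
      push_cast
      rw [mul_inv, inv_inv, mul_comm (_⁻¹)]

end QUEA

/-! ### Pairing of words with monomials: triangularity -/

namespace QFA
variable {q q' ℓ : kˣ}

/-- The matrix of generators of a sector, with rows and columns of the antichiral one swapped,
so that both sectors satisfy relations of the same form. -/
def mat : Sector → Fin 2 → Fin 2 → QFA q q' ℓ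
  | .chiral => ![![gen .chiral .a, gen .chiral .b], ![gen .chiral .c, gen .chiral .d]]
  | .anti => ![![gen .anti .d, gen .anti .c], ![gen .anti .b, gen .anti .a]]

end QFA

namespace QUEA

/-- The exponents of the weight of a Cartan element in the pairings of a monomial. -/
def expo (N : Sector → ℤ) (i j : Sector → ℕ) (τ : Sector) : ℤ := N τ - i τ - j τ

lemma counit_mon_zero (v : Torus r r' s) : counit (R := k) (mon 0 0 v) = 1 := by
  simp [mon, monE, monF, counit_el]

lemma counit_mon_of_ne {i j : Sector → ℕ} (h : ¬(i = 0 ∧ j = 0)) (v : Torus r r' s) :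
    counit (R := k) (mon i j v) = 0 := by
  have h0 : ∀ i : Sector → ℕ, i ≠ 0 → (0 : k) ^ i .chiral * 0 ^ i .anti = 0 := by
    intro i h
    rw [← pow_add, zero_pow]
    intro h2
    apply h
    ext σ
    cases σ <;> simp <;> omega
  have hE : ∀ σ, counit (R := k) (gen σ .E : QUEA r r' s) = 0 := fun σ => counit_gen _ _
  have hF : ∀ σ, counit (R := k) (gen σ .F : QUEA r r' s) = 0 := fun σ => counit_gen _ _
  simp only [mon, monE, monF, Bialgebra.counit_mul, Bialgebra.counit_pow, hE, hF, counit_el]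
  by_cases h1 : i = 0
  · rw [h0 j fun h2 => h ⟨h1, h2⟩, mul_zero]
  · rw [h0 i h1, zero_mul, zero_mul]

lemma chr_wt_mul (v w : Torus r r' s) (N : Sector → ℤ) :
    chr (wt (v * w)) N = chr (wt v) N * chr (wt w) N := chr_mul _ _ _

variable [Fact (Generic r r')]

/-- Appending a generator to a function replaces the argument by an entry of its coaction, so
pairings with words are computed one letter at a time. -/
lemma pairing_mul_mat (x : QUEA r r' s) (g : QFA (r ^ 2) (r' ^ 2) (s ^ 2)) (σ : Sector)
    (i j : Fin 2) : pairing x (g * QFA.mat σ i j) = pairing (coact σ x i j) g := by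
  have h : pairHom r r' s (QFA.mat σ i j) = coef σ i j := by
    cases σ <;> fin_cases i <;> fin_cases j <;> exact QFA.lift_gen _ _ _ _
  rw [pairing_apply, map_mul, h, mul_coef_apply, pairing_apply]

/-- The product of an upper triangular, a diagonal and a lower triangular matrix. Hence the entries
other than the first are multiples of single monomials, and the first has a correction that lowers
both exponents. The constants do not depend on `v`, and they vanish whenever a truncated index would
be wrong. -/
lemma coact_mon (σ : Sector) (i j : Sector → ℕ) : ∃ (z : kˣ) (b c c' : k),
    (b ≠ 0 → i σ ≠ 0 ∧ j σ ≠ 0) ∧ (c ≠ 0 ↔ i σ ≠ 0) ∧ (c' ≠ 0 ↔ j σ ≠ 0) ∧ ∀ v : Torus r r' s,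
    coact σ (mon i j v) 0 0 = ((z : k) * wt v σ) • mon i j v +
      (b * (wt v σ : k)⁻¹) •
        mon (i - Pi.single σ 1) (j - Pi.single σ 1) (skewE σ * v * skewF σ) ∧
    coact σ (mon i j v) 0 1 =
      (c * (wt v σ : k)⁻¹) • mon (i - Pi.single σ 1) j (skewE σ * v) ∧
    coact σ (mon i j v) 1 0 =
      (c' * (wt v σ : k)⁻¹) • mon i (j - Pi.single σ 1) (v * skewF σ) ∧
    coact σ (mon i j v) 1 1 = ((z : k)⁻¹ * (wt v σ : k)⁻¹) • mon i j v := by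
  obtain ⟨z, c, hc, hE⟩ := coact_monE (r := r) (r' := r') (s := s) σ i
  obtain ⟨z', c', hc', hF⟩ := coact_monF (r := r) (r' := r') (s := s) σ j
  refine ⟨z * z', c * c', c * (z' : k)⁻¹, c' * (z : k)⁻¹,
    fun h => ⟨hc.1 (left_ne_zero_of_mul h), hc'.1 (right_ne_zero_of_mul h)⟩, by simpa using hc, by simpa using hc',
    fun v => ?_⟩
  have hz : (z : k) ≠ 0 := Units.ne_zero _
  have hz' : (z' : k) ≠ 0 := Units.ne_zero _
  have h : coact σ (mon i j v) = coact σ (monE i) * coact σ (el v) * coact σ (monF j) := by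
    rw [mon, map_mul, map_mul]
  rw [hE, hF, coact_el, Matrix.mul_fin_two, Matrix.mul_fin_two] at h
  simp only [mul_zero, zero_mul, add_zero, zero_add, smul_mul_smul_comm] at h
  rw [h]
  simp only [Matrix.of_apply, Matrix.cons_val', Matrix.cons_val_zero, Matrix.cons_val_one,
    Matrix.cons_val_fin_one, mon, el_mul, mul_assoc]
  push_cast
  refine ⟨?_, ?_, ?_, ?_⟩
  · congr 2 <;> ring
  · congr 1
    ring
  · congr 1
    ring
  · congr 1
    rw [mul_inv]
    ring

/-- The pairings of `g` with the monomials are given, up to constants, by the character of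
exponents `N`, and are triangular with leading index `(m, l)`. -/
def HasType (g : QFA (r ^ 2) (r' ^ 2) (s ^ 2)) (N : Sector → ℤ) (m l : Sector → ℕ) : Prop :=
  ∀ i j, ∃ C : k, (∀ v : Torus r r' s,
    pairing (mon i j v) g = C * (chr (wt v) (expo N i j) : kˣ)) ∧
    (C ≠ 0 → m ≤ i ∧ l ≤ j) ∧ (m = i → l = j → C ≠ 0)

lemma hasType_one : HasType (1 : QFA (r ^ 2) (r' ^ 2) (s ^ 2)) 0 0 0 := by
  intro i j
  by_cases h : i = 0 ∧ j = 0
  · obtain ⟨rfl, rfl⟩ := h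
    refine ⟨1, fun v => ?_, fun _ => ⟨le_rfl, le_rfl⟩, fun _ _ => one_ne_zero⟩
    rw [pairing_one_right, counit_mon_zero]
    simp [chr, expo]
  · refine ⟨0, fun v => ?_, fun h => (h rfl).elim, fun h1 h2 => (h ⟨h1.symm, h2.symm⟩).elim⟩
    rw [pairing_one_right, counit_mon_of_ne h, zero_mul]

lemma single_le {i : Sector → ℕ} {σ : Sector} (h : i σ ≠ 0) : Pi.single σ 1 ≤ i := by
  intro τ
  rcases eq_or_ne τ σ with rfl | h2
  · simpa using Nat.one_le_iff_ne_zero.2 h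
  · simp [h2]

lemma cast_sub_single {i : Sector → ℕ} {σ : Sector} (h : i σ ≠ 0) (τ : Sector) :
    (((i - Pi.single σ 1 : Sector → ℕ) τ : ℕ) : ℤ) = i τ - (Pi.single σ 1 : Sector → ℤ) τ := by
  rcases eq_or_ne τ σ with rfl | h2
  · simp
    omega
  · simp [h2]

variable {g : QFA (r ^ 2) (r' ^ 2) (s ^ 2)} {N : Sector → ℤ} {m l : Sector → ℕ}

lemma HasType.mul_D (h : HasType g N m l) (σ : Sector) :
    HasType (g * QFA.mat σ 1 1) (N - Pi.single σ 1) m l := by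
  intro i j
  obtain ⟨C, h1, h2, h3⟩ := h i j
  obtain ⟨z, b, c, c', -, -, -, hx⟩ := coact_mon (r := r) (r' := r') (s := s) σ i j
  refine ⟨C * (z : k)⁻¹, fun v => ?_, fun h0 => h2 (left_ne_zero_of_mul h0),
    fun e1 e2 => mul_ne_zero (h3 e1 e2) (by simp)⟩
  have e : expo (N - Pi.single σ 1) i j = expo N i j + -Pi.single σ 1 := by
    ext τ; simp only [expo, Pi.sub_apply, Pi.add_apply, Pi.neg_apply]; ring
  rw [pairing_mul_mat, (hx v).2.2.2, map_smul, LinearMap.smul_apply, h1, e, chr_add, chr_neg,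
    chr_single]
  push_cast
  rw [smul_eq_mul]
  ring

/-- The entry lowers `i σ` by one, which raises the character exponent by one; the factor `(wt v
σ)⁻¹` compensates, so `N` is unchanged and the leading index moves up. -/
lemma HasType.mul_B (h : HasType g N m l) (σ : Sector) :
    HasType (g * QFA.mat σ 0 1) N (m + Pi.single σ 1) l := by
  intro i j
  obtain ⟨C, h1, h2, h3⟩ := h (i - Pi.single σ 1) j
  obtain ⟨z, b, c, c', -, hc, -, hx⟩ := coact_mon (r := r) (r' := r') (s := s) σ i j
  refine ⟨c * C * chr (wt (skewE σ : Torus r r' s)) (expo N (i - Pi.single σ 1) j),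
    fun v => ?_, fun h0 => ?_, fun e1 e2 => ?_⟩
  · rw [pairing_mul_mat, (hx v).2.1, map_smul, LinearMap.smul_apply, h1]
    -- Here subtraction is truncated and the exponents do not match, but the constant `c` is zero.
    by_cases hi : i σ = 0
    · have : c = 0 := not_ne_iff.1 fun h => hc.1 h hi
      simp [this]
    have e : expo N (i - Pi.single σ 1) j = expo N i j + Pi.single σ 1 := by
      ext τ; simp only [expo, cast_sub_single hi, Pi.add_apply]; ring
    have hw : (wt v σ : k) ≠ 0 := Units.ne_zero _
    rw [chr_wt_mul, e, chr_add (wt v), chr_single, smul_eq_mul]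
    push_cast
    field_simp
  · have h4 := left_ne_zero_of_mul h0
    have hi := single_le (hc.1 (left_ne_zero_of_mul h4))
    obtain ⟨h5, h6⟩ := h2 (right_ne_zero_of_mul h4)
    exact ⟨(le_tsub_iff_right hi).1 h5, h6⟩
  · subst e1
    refine mul_ne_zero (mul_ne_zero (hc.2 (by simp)) (h3 ?_ e2)) (Units.ne_zero _)
    rw [add_tsub_cancel_right]

lemma HasType.mul_C (h : HasType g N m l) (σ : Sector) :
    HasType (g * QFA.mat σ 1 0) N m (l + Pi.single σ 1) := by
  intro i j
  obtain ⟨C, h1, h2, h3⟩ := h i (j - Pi.single σ 1)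
  obtain ⟨z, b, c, c', -, -, hc, hx⟩ := coact_mon (r := r) (r' := r') (s := s) σ i j
  refine ⟨c' * C * chr (wt (skewF σ : Torus r r' s)) (expo N i (j - Pi.single σ 1)),
    fun v => ?_, fun h0 => ?_, fun e1 e2 => ?_⟩
  · rw [pairing_mul_mat, (hx v).2.2.1, map_smul, LinearMap.smul_apply, h1]
    by_cases hi : j σ = 0
    · have : c' = 0 := not_ne_iff.1 fun h => hc.1 h hi
      simp [this]
    have e : expo N i (j - Pi.single σ 1) = expo N i j + Pi.single σ 1 := by
      ext τ; simp only [expo, cast_sub_single hi, Pi.add_apply]; ring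
    have hw : (wt v σ : k) ≠ 0 := Units.ne_zero _
    rw [chr_wt_mul, e, chr_add (wt v), chr_single, smul_eq_mul]
    push_cast
    field_simp
  · have h4 := left_ne_zero_of_mul h0
    have hi := single_le (hc.1 (left_ne_zero_of_mul h4))
    obtain ⟨h5, h6⟩ := h2 (right_ne_zero_of_mul h4)
    exact ⟨h5, (le_tsub_iff_right hi).1 h6⟩
  · subst e2
    refine mul_ne_zero (mul_ne_zero (hc.2 (by simp)) (h3 e1 ?_)) (Units.ne_zero _)
    rw [add_tsub_cancel_right]

/-- The correction term has the same character as the main one: its weight factor contributes `-1`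
and the two lowered exponents `+2`. It occurs only strictly above the leading index, so the leading
constant is multiplied by the unit `z`. -/
lemma HasType.mul_A (h : HasType g N m l) (σ : Sector) :
    HasType (g * QFA.mat σ 0 0) (N + Pi.single σ 1) m l := by
  intro i j
  obtain ⟨C, h1, h2, h3⟩ := h i j
  obtain ⟨C', h1', h2', h3'⟩ := h (i - Pi.single σ 1) (j - Pi.single σ 1)
  obtain ⟨z, b, c, c', hb, -, -, hx⟩ := coact_mon (r := r) (r' := r') (s := s) σ i j
  -- A contribution needs `m ≤ i - 1` in the direction `σ`, hence stays inside the cone and misses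
  -- its vertex.
  have key : b * C' ≠ 0 → (m ≤ i ∧ l ≤ j) ∧ m ≠ i := by
    intro h0
    have h4 := hb (left_ne_zero_of_mul h0)
    have hi := single_le h4.1
    have hj := single_le h4.2
    obtain ⟨h5, h6⟩ := h2' (right_ne_zero_of_mul h0)
    rw [le_tsub_iff_right hi] at h5
    rw [le_tsub_iff_right hj] at h6
    refine ⟨⟨le_self_add.trans h5, le_self_add.trans h6⟩, ?_⟩
    rintro rfl
    have := h5 σ
    simp at this
  refine ⟨z * C + b * C' * (chr (wt (skewE σ : Torus r r' s))
      (expo N (i - Pi.single σ 1) (j - Pi.single σ 1)) *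
        chr (wt (skewF σ : Torus r r' s)) (expo N (i - Pi.single σ 1) (j - Pi.single σ 1)) : kˣ),
    fun v => ?_, fun h0 => ?_, fun e1 e2 => ?_⟩
  · rw [pairing_mul_mat, (hx v).1, map_add, map_smul, map_smul, LinearMap.add_apply,
      LinearMap.smul_apply, LinearMap.smul_apply, h1, h1']
    have e : expo (N + Pi.single σ 1) i j = expo N i j + Pi.single σ 1 := by
      ext τ; simp only [expo, Pi.add_apply]; ring
    by_cases hi : i σ = 0
    · have : b = 0 := not_ne_iff.1 fun h => (hb h).1 hi
      rw [this, e, chr_add, chr_single]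
      push_cast
      simp only [smul_eq_mul]
      ring
    by_cases hj : j σ = 0
    · have : b = 0 := not_ne_iff.1 fun h => (hb h).2 hj
      rw [this, e, chr_add, chr_single]
      push_cast
      simp only [smul_eq_mul]
      ring
    have e' : expo N (i - Pi.single σ 1) (j - Pi.single σ 1) =
        expo N i j + Pi.single σ 1 + Pi.single σ 1 := by
      ext τ; simp only [expo, cast_sub_single hi, cast_sub_single hj, Pi.add_apply]; ring
    have hw : (wt v σ : k) ≠ 0 := Units.ne_zero _
    rw [chr_wt_mul, chr_wt_mul, e', e, chr_add (wt v), chr_add (wt v), chr_single, smul_eq_mul,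
      smul_eq_mul]
    push_cast
    field_simp
  · by_cases hC : C = 0
    · rw [hC, mul_zero, zero_add] at h0
      exact (key (left_ne_zero_of_mul h0)).1
    · exact h2 hC
  · have : b * C' = 0 := not_ne_iff.1 fun h0 => (key h0).2 e1
    rw [this, zero_mul, add_zero]
    exact mul_ne_zero (Units.ne_zero _) (h3 e1 e2)

end QUEA

/-! ### The monomials span the enveloping algebra -/

namespace QUEA

lemma E_mul_monE (σ : Sector) (i : Sector → ℕ) :
    (gen σ .E * monE i : QUEA r r' s) = monE (i + Pi.single σ 1) := by
  rw [monE_eq σ, monE_eq σ, ← mul_assoc, ← pow_succ']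
  cases σ <;> simp [Sector.other]

lemma F_mul_monF (σ : Sector) (i : Sector → ℕ) :
    (gen σ .F * monF i : QUEA r r' s) = monF (i + Pi.single σ 1) := by
  rw [monF_eq σ, monF_eq σ, ← mul_assoc, ((comm_F_F σ σ.other).pow_right _).eq, mul_assoc,
    ← pow_succ']
  cases σ <;> simp [Sector.other]

lemma el_mul_monE (v : Torus r r' s) (i : Sector → ℕ) :
    ∃ c : k, el v * monE i = c • (monE i * el v) := by
  have e := fun σ => el_mul_pow v (el_mul_E v σ) (i σ)
  refine ⟨((wt v .chiral : k) ^ 2) ^ i .chiral * ((wt v .anti : k) ^ 2) ^ i .anti, ?_⟩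
  rw [monE, ← mul_assoc, e, smul_mul_assoc, mul_assoc, e, mul_smul_comm, smul_smul, mul_assoc]

variable (r r' s) in
/-- The span of the monomials. -/
def monSpan : Submodule k (QUEA r r' s) :=
  Submodule.span k (Set.range fun p : ((Sector → ℕ) × (Sector → ℕ)) × Torus r r' s =>
    mon p.1.1 p.1.2 p.2)

lemma mon_mem (i j : Sector → ℕ) (v : Torus r r' s) : mon i j v ∈ monSpan r r' s :=
  Submodule.subset_span ⟨((i, j), v), rfl⟩

lemma mul_mem_monSpan {a : QUEA r r' s} (h : ∀ i j v, a * mon i j v ∈ monSpan r r' s)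
    {y : QUEA r r' s} (hy : y ∈ monSpan r r' s) : a * y ∈ monSpan r r' s := by
  induction hy using Submodule.span_induction with
  | mem y hy =>
    obtain ⟨p, rfl⟩ := hy
    exact h _ _ _
  | zero => rw [mul_zero]; exact zero_mem _
  | add x y _ _ hx hy => rw [mul_add]; exact add_mem hx hy
  | smul c x _ hx => rw [mul_smul_comm]; exact Submodule.smul_mem _ _ hx

lemma E_mul_mem (σ : Sector) {y : QUEA r r' s} (hy : y ∈ monSpan r r' s) :
    gen σ .E * y ∈ monSpan r r' s := by
  refine mul_mem_monSpan (fun i j v => ?_) hy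
  rw [mon, ← mul_assoc, ← mul_assoc, E_mul_monE]
  exact mon_mem _ _ _

lemma el_mul_mem (v : Torus r r' s) {y : QUEA r r' s} (hy : y ∈ monSpan r r' s) :
    el v * y ∈ monSpan r r' s := by
  refine mul_mem_monSpan (fun i j w => ?_) hy
  obtain ⟨c, hc⟩ := el_mul_monE v i
  rw [mon, ← mul_assoc, ← mul_assoc, hc, smul_mul_assoc, smul_mul_assoc, mul_assoc (monE i),
    ← el_mul]
  exact Submodule.smul_mem _ _ (mon_mem _ _ _)

/-- The commutator of `e₋` with `e₊` lies in the Cartan part, which preserves the span from the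
left. -/
lemma F_mul_E_mul_mem (σ τ : Sector) {y : QUEA r r' s} (hy : y ∈ monSpan r r' s)
    (h : gen τ .F * y ∈ monSpan r r' s) : gen τ .F * (gen σ .E * y) ∈ monSpan r r' s := by
  rcases eq_or_ne σ τ with rfl | hne
  · rw [← mul_assoc, F_E, sub_mul, smul_mul_assoc, sub_mul, mul_assoc, mul_assoc, mul_assoc]
    exact sub_mem (E_mul_mem _ h) (Submodule.smul_mem _ _ (sub_mem
      (el_mul_mem (torusK σ) (el_mul_mem (torusK σ) hy))
      (el_mul_mem (torusK σ)⁻¹ (el_mul_mem (torusK σ)⁻¹ hy))))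
  · have : (gen τ .F * gen σ .E : QUEA r r' s) = gen σ .E * gen τ .F := by
      cases σ <;> cases τ <;> simp_all [cross]
    rw [← mul_assoc, this, mul_assoc]
    exact E_mul_mem _ h

lemma F_mul_mem (σ : Sector) {y : QUEA r r' s} (hy : y ∈ monSpan r r' s) :
    gen σ .F * y ∈ monSpan r r' s := by
  refine mul_mem_monSpan (fun i j v => ?_) hy
  -- Both memberships are carried along together: passing `e₋` through one more `e₊` produces Cartan
  -- elements acting on `y` itself.
  have h0 : ∀ τ (n : ℕ) (y : QUEA r r' s), y ∈ monSpan r r' s → gen σ .F * y ∈ monSpan r r' s →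
      gen τ .E ^ n * y ∈ monSpan r r' s ∧ gen σ .F * (gen τ .E ^ n * y) ∈ monSpan r r' s := by
    intro τ n y h1 h2
    induction n with
    | zero => simpa using ⟨h1, h2⟩
    | succ n ih =>
      rw [pow_succ', mul_assoc]
      exact ⟨E_mul_mem _ ih.1, F_mul_E_mul_mem _ _ ih.1 ih.2⟩
  have h1 : ∀ j, el v * monF j ∈ monSpan r r' s := by
    intro j
    have := mon_mem 0 j v
    simpa [mon, monE] using this
  have h2 : gen σ .F * (el v * monF j) ∈ monSpan r r' s := by
    have e : gen σ .F * el v = ((wt v σ : k) ^ 2) • (el v * gen σ .F) := by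
      rw [el_mul_F, smul_smul, mul_inv_cancel₀ (by simp), one_smul]
    rw [← mul_assoc, e, smul_mul_assoc, mul_assoc, F_mul_monF]
    exact Submodule.smul_mem _ _ (h1 _)
  have h3 := h0 .anti (i .anti) _ (h1 j) h2
  have h4 := h0 .chiral (i .chiral) _ h3.1 h3.2
  rw [mon, monE, mul_assoc, mul_assoc]
  exact h4.2

/-- The span is a left ideal, as every generator preserves it, and it contains `1`. -/
lemma monSpan_eq_top : monSpan r r' s = ⊤ := by
  have h : ∀ x y : QUEA r r' s, y ∈ monSpan r r' s → x * y ∈ monSpan r r' s := by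
    intro x
    induction x using induction with
    | hc c =>
      intro y hy
      rw [← Algebra.smul_def]
      exact Submodule.smul_mem _ _ hy
    | hg σ x =>
      intro y hy
      cases x
      · exact el_mul_mem (torusK σ) hy
      · exact el_mul_mem (torusK σ)⁻¹ hy
      · exact el_mul_mem (torusL σ) hy
      · exact el_mul_mem (torusL σ)⁻¹ hy
      · exact E_mul_mem σ hy
      · exact F_mul_mem σ hy
    | hm a b ha hb => intro y hy; rw [mul_assoc]; exact ha _ (hb _ hy)
    | ha a b ha hb => intro y hy; rw [add_mul]; exact add_mem (ha _ hy) (hb _ hy)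
  refine Submodule.eq_top_iff'.2 fun x => ?_
  rw [← mul_one x]
  refine h x 1 ?_
  have := mon_mem (r := r) (r' := r') (s := s) 0 0 1
  simpa [mon, monE, monF, el_one] using this

end QUEA

/-! ### The words span the function algebra -/

namespace QFA

variable (σ : Sector)

lemma mat_BA : (mat σ 0 1 * mat σ 0 0 : QFA (r ^ 2) (r' ^ 2) (s ^ 2)) =
    ((root r r' σ : k) ^ 2) • (mat σ 0 0 * mat σ 0 1) := by
  cases σ
  · have h := b_a (q := r ^ 2) (q' := r' ^ 2) (ℓ := s ^ 2) .chiral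
    simpa [manin, mat, root] using h
  · have h := flip_smul (by simp) (d_c (q := r ^ 2) (q' := r' ^ 2) (ℓ := s ^ 2) .anti)
    simpa [manin, mat, root] using h

lemma mat_CA : (mat σ 1 0 * mat σ 0 0 : QFA (r ^ 2) (r' ^ 2) (s ^ 2)) =
    ((root r r' σ : k) ^ 2) • (mat σ 0 0 * mat σ 1 0) := by
  cases σ
  · have h := c_a (q := r ^ 2) (q' := r' ^ 2) (ℓ := s ^ 2) .chiral
    simpa [manin, mat, root] using h
  · have h := flip_smul (by simp) (d_b (q := r ^ 2) (q' := r' ^ 2) (ℓ := s ^ 2) .anti)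
    simpa [manin, mat, root] using h

lemma mat_BD : (mat σ 0 1 * mat σ 1 1 : QFA (r ^ 2) (r' ^ 2) (s ^ 2)) =
    ((root r r' σ : k) ^ 2)⁻¹ • (mat σ 1 1 * mat σ 0 1) := by
  cases σ
  · have h := flip_smul (by simp) (d_b (q := r ^ 2) (q' := r' ^ 2) (ℓ := s ^ 2) .chiral)
    simpa [manin, mat, root] using h
  · have h := c_a (q := r ^ 2) (q' := r' ^ 2) (ℓ := s ^ 2) .anti
    simpa [manin, mat, root] using h

lemma mat_CD : (mat σ 1 0 * mat σ 1 1 : QFA (r ^ 2) (r' ^ 2) (s ^ 2)) =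
    ((root r r' σ : k) ^ 2)⁻¹ • (mat σ 1 1 * mat σ 1 0) := by
  cases σ
  · have h := flip_smul (by simp) (d_c (q := r ^ 2) (q' := r' ^ 2) (ℓ := s ^ 2) .chiral)
    simpa [manin, mat, root] using h
  · have h := b_a (q := r ^ 2) (q' := r' ^ 2) (ℓ := s ^ 2) .anti
    simpa [manin, mat, root] using h

lemma mat_CB : (mat σ 1 0 * mat σ 0 1 : QFA (r ^ 2) (r' ^ 2) (s ^ 2)) =
    mat σ 0 1 * mat σ 1 0 := by
  cases σ
  · exact c_b .chiral
  · exact (c_b .anti).symm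

lemma mat_DA : (mat σ 1 1 * mat σ 0 0 : QFA (r ^ 2) (r' ^ 2) (s ^ 2)) =
    1 + ((root r r' σ : k) ^ 2) • (mat σ 0 1 * mat σ 1 0) := by
  cases σ
  · have h := d_a (q := r ^ 2) (q' := r' ^ 2) (ℓ := s ^ 2) .chiral
    simpa [manin, mat, root] using h
  · have h := a_d (q := r ^ 2) (q' := r' ^ 2) (ℓ := s ^ 2) .anti
    rw [← c_b] at h
    simpa [manin, mat, root] using h

lemma mat_AD : (mat σ 0 0 * mat σ 1 1 : QFA (r ^ 2) (r' ^ 2) (s ^ 2)) =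
    1 + ((root r r' σ : k) ^ 2)⁻¹ • (mat σ 0 1 * mat σ 1 0) := by
  cases σ
  · have h := a_d (q := r ^ 2) (q' := r' ^ 2) (ℓ := s ^ 2) .chiral
    simpa [manin, mat, root] using h
  · have h := d_a (q := r ^ 2) (q' := r' ^ 2) (ℓ := s ^ 2) .anti
    rw [← c_b] at h
    simpa [manin, mat, root] using h

/-- Commutation up to a scalar. -/
def SkewComm {A : Type*} [Ring A] [Algebra k A] (y a : A) : Prop := ∃ c : k, y * a = c • (a * y)

section Skew
variable {A : Type*} [Ring A] [Algebra k A] {x y a : A}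

lemma SkewComm.mul (hx : SkewComm (k := k) x a) (hy : SkewComm (k := k) y a) :
    SkewComm (k := k) (x * y) a := by
  obtain ⟨c, hc⟩ := hx
  obtain ⟨d, hd⟩ := hy
  refine ⟨d * c, ?_⟩
  rw [mul_assoc, hd, mul_smul_comm, ← mul_assoc, hc, smul_mul_assoc, smul_smul, mul_assoc]

lemma SkewComm.pow (hx : SkewComm (k := k) x a) (n : ℕ) : SkewComm (k := k) (x ^ n) a := by
  induction n with
  | zero => exact ⟨1, by simp⟩
  | succ n ih => rw [pow_succ]; exact ih.mul hx

end Skew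

/-- The link relations only rescale, so generators of the two sectors can be sorted. -/
lemma skewComm_mat (i j l m : Fin 2) :
    SkewComm (k := k) (mat .anti i j : QFA (r ^ 2) (r' ^ 2) (s ^ 2)) (mat .chiral l m) := by
  fin_cases i <;> fin_cases j <;> fin_cases l <;> fin_cases m
  exacts [⟨1, by simpa [mat] using x_d_a⟩, ⟨_, x_d_b⟩, ⟨_, x_d_c⟩, ⟨1, by simpa [mat] using x_d_d⟩,
    ⟨_, x_c_a⟩, ⟨1, by simpa [mat] using x_c_b⟩, ⟨1, by simpa [mat] using x_c_c⟩, ⟨_, x_c_d⟩,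
    ⟨_, x_b_a⟩, ⟨1, by simpa [mat] using x_b_b⟩, ⟨1, by simpa [mat] using x_b_c⟩, ⟨_, x_b_d⟩,
    ⟨1, by simpa [mat] using x_a_a⟩, ⟨_, x_a_b⟩, ⟨_, x_a_c⟩, ⟨1, by simpa [mat] using x_a_d⟩]

/-- The powers of the diagonal entries: positive ones of the first, negative ones of the second. -/
def diagPow : ℤ → QFA (r ^ 2) (r' ^ 2) (s ^ 2)
  | .ofNat n => mat σ 0 0 ^ n
  | .negSucc n => mat σ 1 1 ^ (n + 1)

lemma diagPow_neg (n : ℕ) :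
    diagPow σ (-(n : ℤ)) = (mat σ 1 1 ^ n : QFA (r ^ 2) (r' ^ 2) (s ^ 2)) := by
  cases n
  · exact (pow_zero _).trans (pow_zero _).symm
  · rfl

/-- The monomials in the generators of a sector. -/
def sectorWord (n : ℤ) (m l : ℕ) : QFA (r ^ 2) (r' ^ 2) (s ^ 2) :=
  diagPow σ n * mat σ 0 1 ^ m * mat σ 1 0 ^ l

variable (r r' s) in
/-- The span of the monomials in the generators of a sector. -/
def sectorSpan : Submodule k (QFA (r ^ 2) (r' ^ 2) (s ^ 2)) :=
  Submodule.span k (Set.range fun p : ℤ × ℕ × ℕ => sectorWord σ p.1 p.2.1 p.2.2)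

lemma sectorWord_mem (n : ℤ) (m l : ℕ) : sectorWord σ n m l ∈ sectorSpan r r' s σ :=
  Submodule.subset_span ⟨(n, m, l), rfl⟩

lemma sectorWord_BC (n : ℤ) (m l : ℕ) : (diagPow σ n * (mat σ 0 1 * mat σ 1 0) *
    (mat σ 0 1 ^ m * mat σ 1 0 ^ l) : QFA (r ^ 2) (r' ^ 2) (s ^ 2)) =
      sectorWord σ n (m + 1) (l + 1) := by
  have h : Commute (mat σ 1 0 : QFA (r ^ 2) (r' ^ 2) (s ^ 2)) (mat σ 0 1) := mat_CB σ
  rw [sectorWord, pow_succ' (mat σ 0 1), pow_succ' (mat σ 1 0), mul_assoc, mul_assoc, mul_assoc, mul_assoc,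
    ← mul_assoc (mat σ 1 0), (h.pow_right m).eq, mul_assoc]

/-- A positive diagonal power just grows; in a negative one the last letter meets its partner, and
the determinant relation replaces the pair by `1` plus a multiple of the off-diagonal product. -/
lemma diagPow_mul_A_mem (n : ℤ) (m l : ℕ) :
    (diagPow σ n * mat σ 0 0 * (mat σ 0 1 ^ m * mat σ 1 0 ^ l) : QFA (r ^ 2) (r' ^ 2) (s ^ 2)) ∈
      sectorSpan r r' s σ := by
  rcases n with n | n
  · have : (diagPow σ (.ofNat n) * mat σ 0 0 : QFA (r ^ 2) (r' ^ 2) (s ^ 2)) =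
        diagPow σ (.ofNat (n + 1)) := (pow_succ _ _).symm
    rw [this, ← mul_assoc]
    exact sectorWord_mem _ _ _ _
  · have : (diagPow σ (.negSucc n) * mat σ 0 0 : QFA (r ^ 2) (r' ^ 2) (s ^ 2)) =
        diagPow σ (-(n : ℤ)) +
          ((root r r' σ : k) ^ 2) • (diagPow σ (-(n : ℤ)) * (mat σ 0 1 * mat σ 1 0)) := by
      rw [diagPow_neg, diagPow, pow_succ (mat σ 1 1), mul_assoc, mat_DA, mul_add, mul_one, mul_smul_comm]
    rw [this, add_mul, smul_mul_assoc, sectorWord_BC, ← mul_assoc]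
    exact add_mem (sectorWord_mem _ _ _ _) (Submodule.smul_mem _ _ (sectorWord_mem _ _ _ _))

lemma diagPow_mul_D_mem (n : ℤ) (m l : ℕ) :
    (diagPow σ n * mat σ 1 1 * (mat σ 0 1 ^ m * mat σ 1 0 ^ l) : QFA (r ^ 2) (r' ^ 2) (s ^ 2)) ∈
      sectorSpan r r' s σ := by
  rcases n with n | n
  · rcases n with _ | n
    · have : (diagPow σ (.ofNat 0) * mat σ 1 1 : QFA (r ^ 2) (r' ^ 2) (s ^ 2)) =
          diagPow σ (-((1 : ℕ) : ℤ)) := by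
        rw [diagPow_neg, diagPow, pow_zero, one_mul, pow_one]
      rw [this, ← mul_assoc]
      exact sectorWord_mem _ _ _ _
    · have : (diagPow σ (.ofNat (n + 1)) * mat σ 1 1 : QFA (r ^ 2) (r' ^ 2) (s ^ 2)) =
          diagPow σ (.ofNat n) +
            ((root r r' σ : k) ^ 2)⁻¹ • (diagPow σ (.ofNat n) * (mat σ 0 1 * mat σ 1 0)) := by
        rw [diagPow, diagPow, pow_succ (mat σ 0 0), mul_assoc, mat_AD, mul_add, mul_one, mul_smul_comm]
      rw [this, add_mul, smul_mul_assoc, sectorWord_BC, ← mul_assoc]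
      exact add_mem (sectorWord_mem _ _ _ _) (Submodule.smul_mem _ _ (sectorWord_mem _ _ _ _))
  · have : (diagPow σ (.negSucc n) * mat σ 1 1 : QFA (r ^ 2) (r' ^ 2) (s ^ 2)) =
        diagPow σ (.negSucc (n + 1)) := (pow_succ _ _).symm
    rw [this, ← mul_assoc]
    exact sectorWord_mem _ _ _ _

lemma sectorSpan_mul_mem {σ : Sector} {y : QFA (r ^ 2) (r' ^ 2) (s ^ 2)}
    (hy : y ∈ sectorSpan r r' s σ) (i j : Fin 2) : y * mat σ i j ∈ sectorSpan r r' s σ := by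
  induction hy using Submodule.span_induction with
  | zero => rw [zero_mul]; exact zero_mem _
  | add x y _ _ hx hy => rw [add_mul]; exact add_mem hx hy
  | smul c x _ hx => rw [smul_mul_assoc]; exact Submodule.smul_mem _ _ hx
  | mem y hy =>
    obtain ⟨⟨n, m, l⟩, rfl⟩ := hy
    have hB : Commute (mat σ 1 0 : QFA (r ^ 2) (r' ^ 2) (s ^ 2)) (mat σ 0 1) := mat_CB σ
    have hA : SkewComm (k := k) (mat σ 0 1 ^ m * mat σ 1 0 ^ l : QFA (r ^ 2) (r' ^ 2) (s ^ 2))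
        (mat σ 0 0) := .mul (.pow ⟨_, mat_BA σ⟩ _) (.pow ⟨_, mat_CA σ⟩ _)
    have hD : SkewComm (k := k) (mat σ 0 1 ^ m * mat σ 1 0 ^ l : QFA (r ^ 2) (r' ^ 2) (s ^ 2))
        (mat σ 1 1) := .mul (.pow ⟨_, mat_BD σ⟩ _) (.pow ⟨_, mat_CD σ⟩ _)
    obtain ⟨c, hc⟩ := hA
    obtain ⟨d, hd⟩ := hD
    have e00 : (sectorWord σ n m l * mat σ 0 0 : QFA (r ^ 2) (r' ^ 2) (s ^ 2)) ∈
        sectorSpan r r' s σ := by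
      rw [sectorWord, mul_assoc (diagPow σ n), mul_assoc, hc, mul_smul_comm, ← mul_assoc]
      exact Submodule.smul_mem _ _ (diagPow_mul_A_mem _ _ _ _)
    have e11 : (sectorWord σ n m l * mat σ 1 1 : QFA (r ^ 2) (r' ^ 2) (s ^ 2)) ∈
        sectorSpan r r' s σ := by
      rw [sectorWord, mul_assoc (diagPow σ n), mul_assoc, hd, mul_smul_comm, ← mul_assoc]
      exact Submodule.smul_mem _ _ (diagPow_mul_D_mem _ _ _ _)
    have e01 : (sectorWord σ n m l * mat σ 0 1 : QFA (r ^ 2) (r' ^ 2) (s ^ 2)) ∈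
        sectorSpan r r' s σ := by
      rw [sectorWord, mul_assoc, (hB.pow_left l).eq, ← mul_assoc, mul_assoc (diagPow σ n),
        ← pow_succ]
      exact sectorWord_mem _ _ _ _
    have e10 : (sectorWord σ n m l * mat σ 1 0 : QFA (r ^ 2) (r' ^ 2) (s ^ 2)) ∈
        sectorSpan r r' s σ := by
      rw [sectorWord, mul_assoc, ← pow_succ]
      exact sectorWord_mem _ _ _ _
    fin_cases i <;> fin_cases j
    exacts [e00, e01, e10, e11]

/-- Different words acquire different scalars when a chiral generator passes through, so a sum of
words changes, but stays in the span. -/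
lemma sectorSpan_anti_mul {y : QFA (r ^ 2) (r' ^ 2) (s ^ 2)} (hy : y ∈ sectorSpan r r' s .anti)
    (i j : Fin 2) : ∃ y' ∈ sectorSpan r r' s .anti, y * mat .chiral i j = mat .chiral i j * y' := by
  induction hy using Submodule.span_induction with
  | zero => exact ⟨0, zero_mem _, by simp⟩
  | add x y _ _ hx hy =>
    obtain ⟨x', hx, ex⟩ := hx
    obtain ⟨y', hy, ey⟩ := hy
    exact ⟨x' + y', add_mem hx hy, by rw [add_mul, mul_add, ex, ey]⟩
  | smul c x _ hx =>
    obtain ⟨x', hx, ex⟩ := hx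
    exact ⟨c • x', Submodule.smul_mem _ _ hx, by rw [smul_mul_assoc, mul_smul_comm, ex]⟩
  | mem y hy =>
    obtain ⟨⟨n, m, l⟩, rfl⟩ := hy
    have h : SkewComm (k := k) (sectorWord .anti n m l : QFA (r ^ 2) (r' ^ 2) (s ^ 2))
        (mat .chiral i j) := by
      refine .mul (.mul ?_ (.pow (skewComm_mat _ _ _ _) _)) (.pow (skewComm_mat _ _ _ _) _)
      cases n
      · exact .pow (skewComm_mat _ _ _ _) _
      · exact .pow (skewComm_mat _ _ _ _) _
    obtain ⟨c, hc⟩ := h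
    exact ⟨c • sectorWord .anti n m l, Submodule.smul_mem _ _ (sectorWord_mem _ _ _ _),
      by rw [hc, mul_smul_comm]⟩

lemma exists_mat (x : OGen) :
    ∃ i j, (gen σ x : QFA (r ^ 2) (r' ^ 2) (s ^ 2)) = mat σ i j := by
  cases σ <;> cases x
  exacts [⟨0, 0, rfl⟩, ⟨0, 1, rfl⟩, ⟨1, 0, rfl⟩, ⟨1, 1, rfl⟩, ⟨1, 1, rfl⟩, ⟨1, 0, rfl⟩,
    ⟨0, 1, rfl⟩, ⟨0, 0, rfl⟩]

lemma sectorSpan_mul_sectorSpan :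
    sectorSpan r r' s .chiral * sectorSpan r r' s .anti = ⊤ := by
  have h : ∀ f g : QFA (r ^ 2) (r' ^ 2) (s ^ 2),
      g ∈ sectorSpan r r' s .chiral * sectorSpan r r' s .anti →
      g * f ∈ sectorSpan r r' s .chiral * sectorSpan r r' s .anti := by
    intro f
    induction f using induction with
    | hc c =>
      intro y hy
      rw [← Algebra.commutes, ← Algebra.smul_def]
      exact Submodule.smul_mem _ _ hy
    | hg σ x =>
      obtain ⟨i, j, e⟩ := exists_mat (r := r) (r' := r') (s := s) σ x
      rw [e]
      intro y hy
      induction hy using Submodule.mul_induction_on' with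
      | mem_mul_mem y hy z hz =>
        cases σ
        · obtain ⟨z', hz', e⟩ := sectorSpan_anti_mul hz i j
          rw [mul_assoc, e, ← mul_assoc]
          exact Submodule.mul_mem_mul (sectorSpan_mul_mem hy i j) hz'
        · rw [mul_assoc]
          exact Submodule.mul_mem_mul hy (sectorSpan_mul_mem hz i j)
      | add y _ z _ hy hz => rw [add_mul]; exact add_mem hy hz
    | hm a b ha hb => intro y hy; rw [← mul_assoc]; exact hb _ (ha _ hy)
    | ha a b ha hb => intro y hy; rw [mul_add]; exact add_mem (ha _ hy) (hb _ hy)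
  refine Submodule.eq_top_iff'.2 fun x => ?_
  rw [← one_mul x]
  refine h x 1 ?_
  have h1 : ∀ σ, (1 : QFA (r ^ 2) (r' ^ 2) (s ^ 2)) ∈ sectorSpan r r' s σ := by
    intro σ
    have := sectorWord_mem (r := r) (r' := r') (s := s) σ (.ofNat 0) 0 0
    simpa [sectorWord, diagPow] using this
  simpa using Submodule.mul_mem_mul (h1 .chiral) (h1 .anti)

/-- The monomials in the generators of the function algebra. -/
def word (N : Sector → ℤ) (m l : Sector → ℕ) : QFA (r ^ 2) (r' ^ 2) (s ^ 2) :=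
  sectorWord .chiral (N .chiral) (m .chiral) (l .chiral) *
    sectorWord .anti (N .anti) (m .anti) (l .anti)

/-- A function on the sectors given by its two values. -/
def ofPair {α : Type*} (x y : α) : Sector → α
  | .chiral => x
  | .anti => y

lemma span_word_eq_top : Submodule.span k (Set.range
    fun p : ((Sector → ℕ) × (Sector → ℕ)) × (Sector → ℤ) =>
      (word p.2 p.1.1 p.1.2 : QFA (r ^ 2) (r' ^ 2) (s ^ 2))) = ⊤ := by
  rw [eq_top_iff, ← sectorSpan_mul_sectorSpan, sectorSpan, sectorSpan, Submodule.span_mul_span]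
  refine Submodule.span_mono ?_
  rintro _ ⟨_, ⟨⟨n, m, l⟩, rfl⟩, _, ⟨⟨n', m', l'⟩, rfl⟩, rfl⟩
  exact ⟨((ofPair m m', ofPair l l'), ofPair n n'), rfl⟩

end QFA

/-! ### Elimination, independence of characters and perfectness -/

/-- A family whose pairings are block triangular with independent diagonal blocks is independent. -/
lemma eq_zero_of_triangular {P V Λ : Type*} [PartialOrder P] (M : P → V → P → Λ → k)
    (hM : ∀ p v p' N, M p v p' N ≠ 0 → p' ≤ p)
    (hd : ∀ p, LinearIndependent k fun v => M p v p) (c : P × V →₀ k)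
    (h : ∀ p' N, (c.sum fun pv t => t * M pv.1 pv.2 p' N) = 0) : c = 0 := by
  by_contra hc
  have hcc : c.curry ≠ 0 := by
    intro h0
    apply hc
    rw [← Finsupp.uncurry_curry c, h0]
    rfl
  -- Tested against a maximal index `p` of the support, the sum keeps only its block at `p`: a block
  -- at `p'` contributes only if `p ≤ p'`.
  obtain ⟨p, hp⟩ := c.curry.support.exists_maximal (Finsupp.support_nonempty_iff.2 hcc)
  have hp0 : c.curry p ≠ 0 := Finsupp.mem_support_iff.1 hp.1
  refine hp0 (linearIndependent_iff.1 (hd p) _ ?_)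
  ext N
  have h1 := h p N
  rw [← Finsupp.sum_curry_index c fun p' v t => t * M p' v p N, Finsupp.sum,
    Finset.sum_eq_single p] at h1
  · simpa [Finsupp.linearCombination_apply, Finsupp.sum] using h1
  · intro p' hp' hne
    refine Finset.sum_eq_zero fun v _ => ?_
    rw [mul_eq_zero]
    by_contra! h2
    exact hne (hp.eq_of_le hp' (hM _ _ _ _ h2.2)).symm
  · exact fun h2 => (h2 hp.1).elim

namespace QUEA

/-- The character of the weights of the Cartan elements. -/
def chrMonoidHom (v : Torus r r' s) : Multiplicative (Sector → ℤ) →* k where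
  toFun N := (chr (wt v) N.toAdd : kˣ)
  map_one' := by simp [chr]
  map_mul' N N' := by simp [chr_add]

/-- The evaluation of the characters at a Cartan element. -/
def evalMonoidHom (N : Sector → ℤ) : Torus r r' s →* k where
  toFun v := (chr (wt v) N : kˣ)
  map_one' := by simp [chr, wt_one]
  map_mul' v w := by simp [chr_wt_mul]

/-- Dedekind's theorem for the lattice of exponents: a Cartan element defines a character of it, and
`wt_injective` makes these distinct. -/
lemma linearIndependent_chr :
    LinearIndependent k fun (v : Torus r r' s) (N : Sector → ℤ) => (chr (wt v) N : k) := by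
  refine (linearIndependent_monoidHom (Multiplicative (Sector → ℤ)) k).comp
    (chrMonoidHom (r := r) (r' := r') (s := s)) fun v w h => ?_
  apply wt_injective
  ext σ
  have := DFunLike.congr_fun h (Multiplicative.ofAdd (Pi.single σ 1))
  simpa [chrMonoidHom, chr_single] using this

lemma chr_torusK (σ : Sector) (N : Sector → ℤ) :
    chr (wt (torusK σ : Torus r r' s)) N = root r r' σ ^ N σ := by
  cases σ <;> simp [chr, wt, torusK, cartanK]

lemma single_chiral_add_single_anti {α : Type*} [AddMonoid α] (x : Sector → α) :
    0 + Pi.single .chiral (x .chiral) + Pi.single .anti (x .anti) = x := by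
  ext σ
  cases σ <;> simp

variable [hg : Fact (Generic r r')]

/-- The same theorem for the Cartan group. Two exponents giving one character agree already on the
elements `q^h`, because `q^{1/2}` and `q'^{1/2}` have infinite order. -/
lemma linearIndependent_eval :
    LinearIndependent k fun (N : Sector → ℤ) (v : Torus r r' s) => (chr (wt v) N : k) := by
  refine (linearIndependent_monoidHom (Torus r r' s) k).comp
    (evalMonoidHom (r := r) (r' := r') (s := s)) fun N N' h => ?_
  ext σ
  have h1 : (chr (wt (torusK σ : Torus r r' s)) N : k) = chr (wt (torusK σ : Torus r r' s)) N' :=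
    DFunLike.congr_fun h (torusK σ)
  rw [Units.val_inj, chr_torusK, chr_torusK] at h1
  have hinj : Function.Injective fun n : ℤ => root r r' σ ^ n := by
    rw [injective_zpow_iff_not_isOfFinOrder, isOfFinOrder_iff_pow_eq_one]
    rintro ⟨n, hn, e⟩
    exact hg.out σ n hn (by rw [← pow_mul, mul_comm, pow_mul, e, one_pow])
  exact hinj h1

variable {g : QFA (r ^ 2) (r' ^ 2) (s ^ 2)} {N : Sector → ℤ} {m l : Sector → ℕ}

lemma HasType.mul_B_pow (h : HasType g N m l) (σ : Sector) (n : ℕ) :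
    HasType (g * QFA.mat σ 0 1 ^ n) N (m + Pi.single σ n) l := by
  induction n with
  | zero => simpa using h
  | succ n ih =>
    have := ih.mul_B σ
    rwa [mul_assoc, ← pow_succ, add_assoc, ← Pi.single_add] at this

lemma HasType.mul_C_pow (h : HasType g N m l) (σ : Sector) (n : ℕ) :
    HasType (g * QFA.mat σ 1 0 ^ n) N m (l + Pi.single σ n) := by
  induction n with
  | zero => simpa using h
  | succ n ih =>
    have := ih.mul_C σ
    rwa [mul_assoc, ← pow_succ, add_assoc, ← Pi.single_add] at this

lemma HasType.mul_A_pow (h : HasType g N m l) (σ : Sector) (n : ℕ) :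
    HasType (g * QFA.mat σ 0 0 ^ n) (N + Pi.single σ (n : ℤ)) m l := by
  induction n with
  | zero => simpa using h
  | succ n ih =>
    have := ih.mul_A σ
    rw [mul_assoc, ← pow_succ, add_assoc, ← Pi.single_add] at this
    exact_mod_cast this

lemma HasType.mul_D_pow (h : HasType g N m l) (σ : Sector) (n : ℕ) :
    HasType (g * QFA.mat σ 1 1 ^ n) (N - Pi.single σ (n : ℤ)) m l := by
  induction n with
  | zero => simpa using h
  | succ n ih =>
    have := ih.mul_D σ
    rw [mul_assoc, ← pow_succ, sub_sub, ← Pi.single_add] at this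
    exact_mod_cast this

lemma HasType.mul_sectorWord (h : HasType g N m l) (σ : Sector) (n : ℤ) (m' l' : ℕ) :
    HasType (g * QFA.sectorWord σ n m' l') (N + Pi.single σ n) (m + Pi.single σ m')
      (l + Pi.single σ l') := by
  rw [QFA.sectorWord, ← mul_assoc, ← mul_assoc]
  refine (HasType.mul_B_pow ?_ σ m').mul_C_pow σ l'
  cases n with
  | ofNat n => exact h.mul_A_pow σ n
  | negSucc n =>
    have := h.mul_D_pow σ (n + 1)
    rw [sub_eq_add_neg, ← Pi.single_neg] at this
    exact_mod_cast this

lemma hasType_word (N : Sector → ℤ) (m l : Sector → ℕ) :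
    HasType (QFA.word N m l : QFA (r ^ 2) (r' ^ 2) (s ^ 2)) N m l := by
  have := ((hasType_one (r := r) (r' := r') (s := s)).mul_sectorWord .chiral (N .chiral)
    (m .chiral) (l .chiral)).mul_sectorWord .anti (N .anti) (m .anti) (l .anti)
  rwa [one_mul, single_chiral_add_single_anti, single_chiral_add_single_anti,
    single_chiral_add_single_anti] at this

/-- The pairings of the monomials. -/
def pairMon (p : (Sector → ℕ) × (Sector → ℕ)) (v : Torus r r' s)
    (p' : (Sector → ℕ) × (Sector → ℕ)) (N : Sector → ℤ) : k :=
  pairing (mon p.1 p.2 v) (QFA.word N p'.1 p'.2)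

lemma le_of_pairMon_ne_zero {p p' : (Sector → ℕ) × (Sector → ℕ)} {v : Torus r r' s}
    {N : Sector → ℤ} (h : pairMon p v p' N ≠ 0) : p' ≤ p := by
  obtain ⟨C, h1, h2, -⟩ := hasType_word (r := r) (r' := r') (s := s) N p'.1 p'.2 p.1 p.2
  rw [pairMon, h1] at h
  exact h2 (left_ne_zero_of_mul h)

/-- The constant may depend on `N` but not on the Cartan element, so a diagonal block is a character
table with its rows indexed by `N` rescaled. -/
lemma exists_pairing_diagonal (N : Sector → ℤ) (i j : Sector → ℕ) : ∃ C : kˣ,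
    ∀ v : Torus r r' s, pairing (mon i j v) (QFA.word N i j) =
      (C : k) * (chr (wt v) (expo N i j) : k) := by
  obtain ⟨C, h1, -, h2⟩ := hasType_word (r := r) (r' := r') (s := s) N i j i j
  exact ⟨Units.mk0 C (h2 rfl rfl), h1⟩

lemma linearIndependent_pairing_left (i j : Sector → ℕ) : LinearIndependent k
    fun (v : Torus r r' s) (N : Sector → ℤ) => pairing (mon i j v) (QFA.word N i j) := by
  choose C hC using fun N => exists_pairing_diagonal (r := r) (r' := r') (s := s) N i j
  refine linearIndependent_iff.2 fun a ha => linearIndependent_iff.1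
    (linearIndependent_chr (r := r) (r' := r') (s := s)) a ?_
  ext N
  -- The word exponent is shifted so that the resulting character has exponent exactly `N`.
  have h1 := congr_fun ha fun τ => N τ + i τ + j τ
  have h2 : expo (fun τ => N τ + i τ + j τ) i j = N := by
    ext τ
    simp only [expo]
    ring
  simp only [Finsupp.linearCombination_apply, Finsupp.sum, Finset.sum_apply, Pi.smul_apply,
    hC, h2, smul_eq_mul, Pi.zero_apply] at h1 ⊢
  simp only [mul_left_comm _ ((C _ : kˣ) : k), ← Finset.mul_sum] at h1
  exact (mul_eq_zero.1 h1).resolve_left (Units.ne_zero _)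

lemma linearIndependent_pairing_right (i j : Sector → ℕ) : LinearIndependent k
    fun (N : Sector → ℤ) (v : Torus r r' s) => pairing (mon i j v) (QFA.word N i j) := by
  choose C hC using fun N => exists_pairing_diagonal (r := r) (r' := r') (s := s) N i j
  have h1 := (linearIndependent_eval (r := r) (r' := r') (s := s)).comp (fun N => expo N i j)
    fun N N' h => by
      ext τ
      have := congr_fun h τ
      simpa [expo] using this
  convert h1.units_smul C using 1
  ext N v
  simp [hC, Units.smul_def]

/-- An element annihilated by all words has, in any expansion in monomials, coefficients killed by
the block triangular matrix. -/
lemma separatingLeft_pairing : (pairing (r := r) (r' := r') (s := s)).SeparatingLeft := by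
  intro x hx
  have h : x ∈ monSpan r r' s := by rw [monSpan_eq_top]; exact Submodule.mem_top
  obtain ⟨c, rfl⟩ := Finsupp.mem_span_range_iff_exists_finsupp.1 h
  have hc : c = 0 := by
    refine eq_zero_of_triangular pairMon (fun p v p' N h => le_of_pairMon_ne_zero h)
      (fun p => linearIndependent_pairing_left p.1 p.2) c fun p' N => ?_
    have h1 := hx (QFA.word N p'.1 p'.2)
    rw [map_finsuppSum, Finsupp.sum, LinearMap.sum_apply] at h1
    simp only [map_smul, LinearMap.smul_apply, smul_eq_mul] at h1
    exact h1
  rw [hc, Finsupp.sum_zero_index]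

lemma separatingRight_pairing : (pairing (r := r) (r' := r') (s := s)).SeparatingRight := by
  intro f hf
  have h := Submodule.mem_top (R := k) (x := f)
  rw [← QFA.span_word_eq_top] at h
  obtain ⟨c, rfl⟩ := Finsupp.mem_span_range_iff_exists_finsupp.1 h
  have hc : c = 0 := by
    -- Transposing the matrix reverses triangularity, so elimination runs in the dual order, from a
    -- minimal index of the words.
    refine eq_zero_of_triangular (P := ((Sector → ℕ) × (Sector → ℕ))ᵒᵈ)
      (fun p N p' (v : Torus r r' s) => pairMon (OrderDual.ofDual p') v (OrderDual.ofDual p) N)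
      (fun p N p' v h => le_of_pairMon_ne_zero h)
      (fun p => linearIndependent_pairing_right _ _) c fun p' v => ?_
    have h1 := hf (mon (OrderDual.ofDual p').1 (OrderDual.ofDual p').2 v)
    rw [map_finsuppSum] at h1
    simp only [map_smul, smul_eq_mul] at h1
    exact h1
  rw [hc, Finsupp.sum_zero_index]

end QUEA
end QLinked
end

theorem mainTheorem1 {k : Type*} [Field k] (r r' s : kˣ)
    (hq : ∀ n : ℕ, 0 < n → (r ^ 2) ^ n ≠ 1) (hq' : ∀ n : ℕ, 0 < n → (r' ^ 2) ^ n ≠ 1) :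
    ∃ B : QLinked.QUEA r r' s →ₗ[k] QLinked.QFA (r ^ 2) (r' ^ 2) (s ^ 2) →ₗ[k] k,
      QLinked.IsHopfPairing B ∧ QLinked.HasGeneratorValues r r' s B ∧
      (∀ B' : QLinked.QUEA r r' s →ₗ[k] QLinked.QFA (r ^ 2) (r' ^ 2) (s ^ 2) →ₗ[k] k,
        QLinked.IsHopfPairing B' → QLinked.HasGeneratorValues r r' s B' → B' = B) ∧
      B.SeparatingLeft ∧ B.SeparatingRight := by
  have : Fact (QLinked.Generic r r') := ⟨fun σ => by cases σ; exacts [hq, hq']⟩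
  exact ⟨QLinked.QUEA.pairing, QLinked.QUEA.isHopfPairing_pairing,
    QLinked.QUEA.hasGeneratorValues_pairing,
    fun B' h h' => QLinked.QUEA.hopfPairing_unique h QLinked.QUEA.isHopfPairing_pairing h'
      QLinked.QUEA.hasGeneratorValues_pairing,
    QLinked.QUEA.separatingLeft_pairing, QLinked.QUEA.separatingRight_pairing⟩
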